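/- Let $M$ be a smooth manifold, let $(\mathfrak g,\mathfrak h,dt,d\alpha)$ be a differential crossed module of finite-dimensional real Lie algebras (Lie algebra homomorphisms $dt:\mathfrak h\to\mathfrak g$ and $d\alpha:\mathfrak g\to\mathrm{Der}(\mathfrak h)$ with $dt(d\alpha(x)(y))=[x,dt(y)]$ and $d\alpha(dt(y))(y')=[y,y']$), let $H$ be a Lie group with Lie algebra $\mathfrak h$, and let $A\in\Omega^1(M,\mathfrak g)$, $B\in\Omega^2(M,\mathfrak h)$. For $s,t\in M$ let $\mathcal P_s^t(M)$ be the space of smooth paths $X:[0,1]\to M$ that are constantly $s$ near $0$ and constantly $t$ near $1$. For $\omega$ with values in $\mathfrak h$ or $\mathfrak g$ let $\omega^{W_A}(\sigma)=W_A[X](\sigma,1)(\omega(\sigma))$ be its parallel transport from $\sigma$ to $1$ along $X$, i.e. the series $\sum_{k\ge0}\int_{\sigma<\sigma_1<\dots<\sigma_k<1}\rho(-A(X'(\sigma_k)))\circ\dots\circ\rho(-A(X'(\sigma_1)))\,d\sigma_1\cdots d\sigma_k$ with $\rho=d\alpha$ or $\rho=\mathrm{ad}$ respectively, applied to $\omega(\sigma)$.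 The standard path space connection is the $\mathfrak h$-valued 1-form on path space $$\mathcal A_{(A,B)}(V)=\oint_A(B)(V)=\int_0^1 \big(B(X',V)\big)^{W_A}(\sigma)\,d\sigma .$$ Let $F_A=dA+\tfrac12A^a\wedge A^b[T_a,T_b]$ and $\tilde F=F_A+dt(B)$, where $(T_a)$ is a basis of $\mathfrak g$. The path space 2-form $\oint_A(d\alpha(T_a)(B),\tilde F^a)$ is $$\oint_A\big(d\alpha(T_a)(B),\tilde F^a\big)(V,W)=\int_{0<\sigma_1<\sigma_2<1}\Big[d\alpha\big(\tilde F(X',W)^{W_A}(\sigma_2)\big)\big(B(X',V)^{W_A}(\sigma_1)\big)-d\alpha\big(\tilde F(X',V)^{W_A}(\sigma_2)\big)\big(B(X',W)^{W_A}(\sigma_1)\big)\Big]d\sigma_1\,d\sigma_2 .$$ A parametrized bigon is a smooth map $\Sigma:[0,1]^2\to M$, $(\sigma,\tau)\mapsto\Sigma(\sigma,\tau)$, that is constant near $\sigma=0$, constant near $\sigma=1$, and independent of $\tau$ near $\tau=0$ and near $\tau=1$; its holonomy with respect to a path space 1-form $\mathcal A$ is $w(1)\in H$, where $w(0)=1$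 and $w'(\tau)=w(\tau)\cdot\mathcal A(\partial_\tau\Sigma(\cdot,\tau))$. Two parametrized bigons are thinly homotopic if there is a smooth homotopy $[0,1]^3\to M$ between them that fixes the boundary of the square pointwise and whose differential has rank less than $3$ everywhere. A path space 1-form is r-flat if thinly homotopic parametrized bigons (for all $s,t\in M$) have the same holonomy. Proposition. The standard path space connection $\mathcal A_{(A,B)}$ is r-flat if and only if $$\oint_A\big(d\alpha(T_a)(B),(F_A+dt(B))^a\big)(T,\tilde T)=0$$ for all $s,t\in M$, all smooth curves $\tau\mapsto X_\tau$ in $\mathcal P_s^t(M)$, all smooth functions $(\tau,\sigma)\mapsto a(\tau,\sigma)$ and all $\tau$, where $T(\sigma)=\frac{\partial}{\partial\tau}X_\tau(\sigma)$ and $\tilde T(\sigma)=a(\tau,\sigma)\frac{\partial}{\partial\tau}X_\tau(\sigma)$ are vector fields along the path $X_\tau$. -/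

import Mathlib

open Set Function MeasureTheory
open scoped Manifold ContDiff Topology

/-! ### Lie algebras and differential crossed modules -/

/-- A Lie ring together with a norm on the same additive group. No compatibility between norm and
bracket is required: in finite dimension, where this is used, the norm only provides the
(unique) vector space topology. -/
class NormedLieRing (L : Type*) extends NormedAddCommGroup L, LieRing L

/-- A real Lie algebra together with a norm on the same real vector space. -/
class NormedLieAlgebra (L : Type*) [NormedLieRing L] extends NormedSpace ℝ L, LieAlgebra ℝ L

/-- A differential crossed module `(𝔤, 𝔥, dt, dα)`. -/
structure DifferentialCrossedModule (𝔤 𝔥 : Type*) [LieRing 𝔤] [LieAlgebra ℝ 𝔤]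
    [LieRing 𝔥] [LieAlgebra ℝ 𝔥] where
  /-- the homomorphism `dt : 𝔥 → 𝔤` -/
  dt : 𝔥 →ₗ⁅ℝ⁆ 𝔤
  /-- the action of `𝔤` on `𝔥` by derivations -/
  dα : 𝔤 →ₗ⁅ℝ⁆ LieDerivation ℝ 𝔥 𝔥
  dt_dα : ∀ (x : 𝔤) (y : 𝔥), dt (dα x y) = ⁅x, dt y⁆
  dα_dt : ∀ y y' : 𝔥, dα (dt y) y' = ⁅y, y'⁆

/-- The action `dα` of a differential crossed module as a linear map `𝔤 → End 𝔥`. -/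
def DifferentialCrossedModule.action {𝔤 𝔥 : Type*} [LieRing 𝔤] [LieAlgebra ℝ 𝔤]
    [LieRing 𝔥] [LieAlgebra ℝ 𝔥] (C : DifferentialCrossedModule 𝔤 𝔥) :
    𝔤 →ₗ[ℝ] Module.End ℝ 𝔥 where
  toFun x := (C.dα x).toLinearMap
  map_add' x y := by ext z; simp
  map_smul' c x := by ext z; simp

/-- In terms of a basis `T_a` of `𝔤`, the pairing `dα(x)(y)` is the contraction
`x^a dα(T_a)(y)`. -/
theorem DifferentialCrossedModule.action_eq_sum {𝔤 𝔥 : Type*} [LieRing 𝔤] [LieAlgebra ℝ 𝔤]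
    [LieRing 𝔥] [LieAlgebra ℝ 𝔥] (C : DifferentialCrossedModule 𝔤 𝔥) {ι : Type*} [Fintype ι]
    (T : Module.Basis ι ℝ 𝔤) (x : 𝔤) (y : 𝔥) :
    C.action x y = ∑ a, T.repr x a • C.dα (T a) y := by
  conv_lhs => rw [← T.sum_repr x]
  rw [map_sum, LinearMap.sum_apply]
  simp only [map_smul, LinearMap.smul_apply]
  rfl

instance instLEInftyMinSmoothnessReal : ENat.LEInfty (minSmoothness ℝ 3) where
  out := by
    rw [minSmoothness_of_isRCLikeNormedField]
    exact ENat.LEInfty.out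

/-! ### Differential forms on a manifold -/

section Forms

variable {n : ℕ} {M : Type*} [TopologicalSpace M] [ChartedSpace (EuclideanSpace ℝ (Fin n)) M]
  {F : Type*} [NormedAddCommGroup F] [NormedSpace ℝ F] {k : ℕ}

/-- The expression of a form in the preferred chart around `x₀`, that is, its pull-back along the
inverse of that chart. Only its values on the (open) target of the chart are meaningful. -/
noncomputable def formInChart (η : ∀ x : M, TangentSpace (𝓡 n) x [⋀^Fin k]→L[ℝ] F) (x₀ : M)
    (y : EuclideanSpace ℝ (Fin n)) : EuclideanSpace ℝ (Fin n) [⋀^Fin k]→L[ℝ] F :=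
  (η ((extChartAt (𝓡 n) x₀).symm y)).compContinuousLinearMap
    (mfderiv 𝓘(ℝ, EuclideanSpace ℝ (Fin n)) (𝓡 n) (extChartAt (𝓡 n) x₀).symm y)

/-- Smooth `F`-valued differential `k`-forms on the `n`-dimensional manifold `M`. -/
structure DiffForm (n : ℕ) (M : Type*) [TopologicalSpace M]
    [ChartedSpace (EuclideanSpace ℝ (Fin n)) M] (k : ℕ)
    (F : Type*) [NormedAddCommGroup F] [NormedSpace ℝ F] where
  /-- the value of the form at a point -/
  toFun : ∀ x : M, TangentSpace (𝓡 n) x [⋀^Fin k]→L[ℝ] F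
  smooth : ∀ x₀ : M, ContDiffOn ℝ ∞ (formInChart toFun x₀) (extChartAt (𝓡 n) x₀).target

instance : CoeFun (DiffForm n M k F)
    (fun _ => ∀ x : M, TangentSpace (𝓡 n) x [⋀^Fin k]→L[ℝ] F) := ⟨DiffForm.toFun⟩

/-- The exterior derivative of a form, computed in the preferred chart at the point. -/
noncomputable def DiffForm.extDerivAt (η : DiffForm n M k F) (x : M) :
    TangentSpace (𝓡 n) x [⋀^Fin (k + 1)]→L[ℝ] F :=
  (extDeriv (formInChart η.toFun x) (extChartAt (𝓡 n) x x)).compContinuousLinearMap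
    (mfderiv (𝓡 n) 𝓘(ℝ, EuclideanSpace ℝ (Fin n)) (extChartAt (𝓡 n) x) x)

end Forms

/-! ### Paths, curves in path space, thin homotopy -/

section Paths

variable {n : ℕ} {M : Type*} [TopologicalSpace M] [ChartedSpace (EuclideanSpace ℝ (Fin n)) M]

/-- The based parametrized path space `P_s^t(M)`: smooth maps `[0,1] → M` which are constantly `s`
near `0` and constantly `t` near `1`. (Only the values on `[0,1]` matter.) -/
def IsPath (n : ℕ) {M : Type*} [TopologicalSpace M] [ChartedSpace (EuclideanSpace ℝ (Fin n)) M]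
    (s t : M) (X : ℝ → M) : Prop :=
  ContMDiffOn 𝓘(ℝ, ℝ) (𝓡 n) ∞ X (Icc 0 1) ∧
  ∃ ε > 0, ∀ σ ∈ Icc (0 : ℝ) 1, (σ < ε → X σ = s) ∧ (1 - ε < σ → X σ = t)

/-- A smooth curve `τ ↦ X_τ`, `τ ∈ [0,1]`, in `P_s^t(M)`, with `X_τ(σ)` written `X σ τ`. -/
def IsPathCurve (n : ℕ) {M : Type*} [TopologicalSpace M]
    [ChartedSpace (EuclideanSpace ℝ (Fin n)) M] (s t : M) (X : ℝ → ℝ → M) : Prop :=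
  ContMDiffOn 𝓘(ℝ, ℝ × ℝ) (𝓡 n) ∞ (uncurry X) (Icc 0 1 ×ˢ Icc 0 1) ∧
  ∀ τ ∈ Icc (0 : ℝ) 1, IsPath n s t (fun σ => X σ τ)

/-- A parametrized bigon `Σ(σ,τ)` with source vertex `s` and target vertex `t`: a smooth map
`[0,1]² → M` which is constantly `s` near `σ = 0`, constantly `t` near `σ = 1`, and independent of
`τ` near `τ = 0` and near `τ = 1`. -/
def IsBigon (n : ℕ) {M : Type*} [TopologicalSpace M] [ChartedSpace (EuclideanSpace ℝ (Fin n)) M]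
    (s t : M) (S : ℝ → ℝ → M) : Prop :=
  ContMDiffOn 𝓘(ℝ, ℝ × ℝ) (𝓡 n) ∞ (uncurry S) (Icc 0 1 ×ˢ Icc 0 1) ∧
  ∃ ε > 0, ∀ σ ∈ Icc (0 : ℝ) 1, ∀ τ ∈ Icc (0 : ℝ) 1,
    (σ < ε → S σ τ = s) ∧ (1 - ε < σ → S σ τ = t) ∧
    (τ < ε → S σ τ = S σ 0) ∧ (1 - ε < τ → S σ τ = S σ 1)

/-- Two parametrized bigons are thinly homotopic: there is a smooth `[0,1]³ → M` from one to the
other, fixing the boundary, whose differential has rank less than `3` everywhere. -/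
def ThinHomotopic (n : ℕ) {M : Type*} [TopologicalSpace M]
    [ChartedSpace (EuclideanSpace ℝ (Fin n)) M] (S₁ S₂ : ℝ → ℝ → M) : Prop :=
  ∃ K : ℝ × ℝ × ℝ → M,
    ContMDiffOn 𝓘(ℝ, ℝ × ℝ × ℝ) (𝓡 n) ∞ K (Icc 0 1 ×ˢ Icc 0 1 ×ˢ Icc 0 1) ∧
    (∀ σ ∈ Icc (0 : ℝ) 1, ∀ τ ∈ Icc (0 : ℝ) 1,
      K (σ, τ, 0) = S₁ σ τ ∧ K (σ, τ, 1) = S₂ σ τ) ∧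
    (∀ σ ∈ Icc (0 : ℝ) 1, ∀ ν ∈ Icc (0 : ℝ) 1,
      K (σ, 0, ν) = S₁ σ 0 ∧ K (σ, 0, ν) = S₂ σ 0 ∧
      K (σ, 1, ν) = S₁ σ 1 ∧ K (σ, 1, ν) = S₂ σ 1) ∧
    (∀ τ ∈ Icc (0 : ℝ) 1, ∀ ν ∈ Icc (0 : ℝ) 1,
      K (0, τ, ν) = S₁ 0 τ ∧ K (0, τ, ν) = S₂ 0 τ ∧
      K (1, τ, ν) = S₁ 1 τ ∧ K (1, τ, ν) = S₂ 1 τ) ∧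
    ∀ p ∈ Icc (0 : ℝ) 1 ×ˢ Icc (0 : ℝ) 1 ×ˢ Icc (0 : ℝ) 1,
      Module.finrank ℝ (LinearMap.range (mfderivWithin 𝓘(ℝ, ℝ × ℝ × ℝ) (𝓡 n) K
        (Icc 0 1 ×ˢ Icc 0 1 ×ˢ Icc 0 1) p).toLinearMap) < 3

/-- The velocity at parameter `σ` of a curve `c : [0,1] → M`. -/
noncomputable def velocity (n : ℕ) {M : Type*} [TopologicalSpace M]
    [ChartedSpace (EuclideanSpace ℝ (Fin n)) M] (c : ℝ → M) (σ : ℝ) :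
    TangentSpace (𝓡 n) (c σ) :=
  mfderivWithin 𝓘(ℝ, ℝ) (𝓡 n) c (Icc 0 1) σ (1 : ℝ)

/-- The tangent vector `T = ∂X_τ/∂τ` at parameter `τ` of a curve in path space: the vector field
`σ ↦ ∂X(σ,τ)/∂τ` along the path `X_τ`. -/
noncomputable def pathTangent (n : ℕ) {M : Type*} [TopologicalSpace M]
    [ChartedSpace (EuclideanSpace ℝ (Fin n)) M] (X : ℝ → ℝ → M) (τ σ : ℝ) :
    TangentSpace (𝓡 n) (X σ τ) :=
  velocity n (X σ) τ

end Paths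

/-! ### Parallel transport and Chen forms on path space -/

section Transport

variable {n : ℕ} {M : Type*} [TopologicalSpace M] [ChartedSpace (EuclideanSpace ℝ (Fin n)) M]
  {𝔤 : Type*} [NormedLieRing 𝔤] [NormedLieAlgebra 𝔤]
  {V : Type*} [NormedAddCommGroup V] [NormedSpace ℝ V] [FiniteDimensional ℝ V]

/-- The term with `k` insertions of `-A` in the series of parallel transport from `σ` to `1`:
`∫_{σ<σ₁<…<σ_k<1} ρ(-A(X'(σ_k))) ∘ ⋯ ∘ ρ(-A(X'(σ₁))) dσ₁ ⋯ dσ_k`. -/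
noncomputable def transportTerm (ρ : 𝔤 →ₗ[ℝ] Module.End ℝ V) (A : DiffForm n M 1 𝔤) (X : ℝ → M) :
    ℕ → ℝ → (V →L[ℝ] V)
  | 0, _ => ContinuousLinearMap.id ℝ V
  | k + 1, σ => ∫ r in σ..1, (transportTerm ρ A X k r).comp
      (LinearMap.toContinuousLinearMap (ρ (-(A (X r) ![velocity n X r]))))

/-- Parallel transport `W_A[X](σ,1)` from `σ` to `1` along `X`, acting on the space `V` of a
representation `ρ` of `𝔤`: the path-ordered exponential series. -/
noncomputable def parallelTransport (ρ : 𝔤 →ₗ[ℝ] Module.End ℝ V) (A : DiffForm n M 1 𝔤)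
    (X : ℝ → M) (σ : ℝ) : V →L[ℝ] V :=
  ∑' k, transportTerm ρ A X k σ

/-- The adjoint action `x ↦ [x, ·]` of `𝔤` on itself as a linear map. -/
def adjointAction (𝔤 : Type*) [LieRing 𝔤] [LieAlgebra ℝ 𝔤] : 𝔤 →ₗ[ℝ] Module.End ℝ 𝔤 :=
  LinearMap.mk₂ ℝ (fun x y => ⁅x, y⁆) add_lie smul_lie lie_add (fun c x y => lie_smul c x y)

/-- The curvature `F_A = dA + ½ A^a ∧ A^b [T_a,T_b]`; on vectors `v, w` the second term is
`[A(v), A(w)]`. -/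
noncomputable def curvature (A : DiffForm n M 1 𝔤) (x : M) (v w : TangentSpace (𝓡 n) x) : 𝔤 :=
  A.extDerivAt x ![v, w] + ⁅A x ![v], A x ![w]⁆

variable {𝔥 : Type*} [NormedLieRing 𝔥] [NormedLieAlgebra 𝔥]

/-- The 2-form `F_A + dt(B)`. -/
noncomputable def fakeCurvature (C : DifferentialCrossedModule 𝔤 𝔥) (A : DiffForm n M 1 𝔤)
    (B : DiffForm n M 2 𝔥) (x : M) (v w : TangentSpace (𝓡 n) x) : 𝔤 :=
  curvature A x v w + C.dt (B x ![v, w])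

variable [FiniteDimensional ℝ 𝔤] [FiniteDimensional ℝ 𝔥]

/-- The parallel transported contraction `ι_K B^{W_A}(σ)`, `K = X'`, evaluated on a vector field
`v` along the path `X`. -/
noncomputable def transportedB (C : DifferentialCrossedModule 𝔤 𝔥) (A : DiffForm n M 1 𝔤)
    (B : DiffForm n M 2 𝔥) (X : ℝ → M) (v : ∀ σ, TangentSpace (𝓡 n) (X σ)) (σ : ℝ) : 𝔥 :=
  parallelTransport C.action A X σ (B (X σ) ![velocity n X σ, v σ])

/-- The parallel transported contraction `ι_K (F_A + dt(B))^{W_A}(σ)`, `K = X'`, evaluated on a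
vector field `v` along the path `X`. -/
noncomputable def transportedFake (C : DifferentialCrossedModule 𝔤 𝔥) (A : DiffForm n M 1 𝔤)
    (B : DiffForm n M 2 𝔥) (X : ℝ → M) (v : ∀ σ, TangentSpace (𝓡 n) (X σ)) (σ : ℝ) : 𝔤 :=
  parallelTransport (adjointAction 𝔤) A X σ
    (fakeCurvature C A B (X σ) (velocity n X σ) (v σ))

/-- The standard connection 1-form `∮_A(B)` on path space, evaluated at the path `X` on the
vector field `v` along `X`. -/
noncomputable def standardConnection (C : DifferentialCrossedModule 𝔤 𝔥) (A : DiffForm n M 1 𝔤)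
    (B : DiffForm n M 2 𝔥) (X : ℝ → M) (v : ∀ σ, TangentSpace (𝓡 n) (X σ)) : 𝔥 :=
  ∫ σ in (0 : ℝ)..1, transportedB C A B X v σ

/-- The path space 2-form `∮_A(dα(T_a)(B), (F_A + dt(B))^a)`, evaluated at the path `X` on the
vector fields `v, w` along `X`: the integral over `0 < σ₁ < σ₂ < 1` of the wedge product of the
contracted and parallel transported forms, the first at `σ₁` and the second at `σ₂`. -/
noncomputable def chenTwoForm (C : DifferentialCrossedModule 𝔤 𝔥) (A : DiffForm n M 1 𝔤)
    (B : DiffForm n M 2 𝔥) (X : ℝ → M) (v w : ∀ σ, TangentSpace (𝓡 n) (X σ)) : 𝔥 :=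
  ∫ σ₂ in (0 : ℝ)..1, ∫ σ₁ in (0 : ℝ)..σ₂,
    (C.action (transportedFake C A B X w σ₂) (transportedB C A B X v σ₁)
      - C.action (transportedFake C A B X v σ₂) (transportedB C A B X w σ₁))

end Transport

/-! ### Path space holonomy and r-flatness -/

section Holonomy

variable {n m : ℕ} {M : Type*} [TopologicalSpace M] [ChartedSpace (EuclideanSpace ℝ (Fin n)) M]
  {H : Type*} [TopologicalSpace H] [ChartedSpace (EuclideanSpace ℝ (Fin m)) H] [Group H]

/-- `h` is the path-ordered exponential `P exp ∫₀¹ f(τ) dτ` in the Lie group `H`, with factors at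
higher parameter to the right: `h = w(1)` for the solution of `w' = w · f`, `w(0) = 1`. -/
def IsPathOrderedExp (f : ℝ → GroupLieAlgebra (𝓡 m) H) (h : H) : Prop :=
  ∃ w : ℝ → H, w 0 = 1 ∧ w 1 = h ∧ ∀ τ ∈ Icc (0 : ℝ) 1,
    MDifferentiableWithinAt 𝓘(ℝ, ℝ) (𝓡 m) w (Icc 0 1) τ ∧
    velocity m w τ = mulInvariantVectorField (f τ) (w τ)

variable {𝔥 : Type*}

/-- `h` is the holonomy of the `𝔥`-valued path space 1-form `𝒜` along the curve
`τ ↦ S(·,τ)`, `τ ∈ [0,1]`, in path space; `φ` identifies `𝔥` with the Lie algebra of `H`. -/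
def IsPathSpaceHolonomy (φ : 𝔥 → GroupLieAlgebra (𝓡 m) H)
    (𝒜 : ∀ X : ℝ → M, (∀ σ, TangentSpace (𝓡 n) (X σ)) → 𝔥) (S : ℝ → ℝ → M) (h : H) : Prop :=
  IsPathOrderedExp (fun τ => φ (𝒜 (fun σ => S σ τ) (pathTangent n S τ))) h

/-- A path space 1-form is r-flat if its holonomy is invariant under thin homotopy: thinly
homotopic parametrized bigons, with any vertices, have the same holonomy (existence of the
holonomy is part of the claim). -/
def IsRFlat (φ : 𝔥 → GroupLieAlgebra (𝓡 m) H)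
    (𝒜 : ∀ X : ℝ → M, (∀ σ, TangentSpace (𝓡 n) (X σ)) → 𝔥) : Prop :=
  ∀ (s t : M) (S₁ S₂ : ℝ → ℝ → M), IsBigon n s t S₁ → IsBigon n s t S₂ →
    ThinHomotopic n S₁ S₂ →
      ∃ h : H, IsPathSpaceHolonomy φ 𝒜 S₁ h ∧ IsPathSpaceHolonomy φ 𝒜 S₂ h

end Holonomy

open scoped Interval

/-! ### Path-ordered exponentials in a Banach algebra -/

section OrderedExp

variable {R : Type*} [NormedRing R] [NormedAlgebra ℝ R]

/-- The `k`-fold iterated integral `∫_{σ<σ₁<⋯<σ_k<1} g(σ_k) ⋯ g(σ₁)`. -/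
noncomputable def orderedExpTerm (g : ℝ → R) : ℕ → ℝ → R
  | 0, _ => 1
  | k + 1, σ => ∫ r in σ..1, orderedExpTerm g k r * g r

/-- The path-ordered exponential series from `σ` to `1`. -/
noncomputable def orderedExp (g : ℝ → R) (σ : ℝ) : R := ∑' k, orderedExpTerm g k σ

variable {Λ : Type*} [TopologicalSpace Λ]

theorem continuous_orderedExpTerm {g : Λ → ℝ → R} (hg : Continuous (uncurry g)) (k : ℕ) :
    Continuous (fun p : Λ × ℝ => orderedExpTerm (g p.1) k p.2) := by
  induction k with
  | zero => exact continuous_const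
  | succ k ih =>
    simp only [orderedExpTerm]
    have h : ∀ p : Λ × ℝ, (∫ r in p.2..1, orderedExpTerm (g p.1) k r * g p.1 r)
        = -∫ r in (1 : ℝ)..p.2, orderedExpTerm (g p.1) k r * g p.1 r :=
      fun p => intervalIntegral.integral_symm _ _
    simp only [h]
    have := intervalIntegral.continuous_parametric_primitive_of_continuous (μ := volume)
      (a₀ := (1 : ℝ)) (f := fun (l : Λ) r => orderedExpTerm (g l) k r * g l r)
      (by
        have h2 : Continuous (fun p : Λ × ℝ => orderedExpTerm (g p.1) k p.2 * (uncurry g) p) :=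
          ih.mul hg
        exact h2)
    exact this.neg

theorem norm_orderedExpTerm_le {g : ℝ → R} (hg : Continuous g) {T M : ℝ}
    (hM : ∀ r, |r - 1| ≤ T → ‖g r‖ ≤ M) (k : ℕ) :
    ∀ σ, |σ - 1| ≤ T → ‖orderedExpTerm g k σ‖ ≤ ‖(1 : R)‖ * (M ^ k * |σ - 1| ^ k / k.factorial) := by
  induction k with
  | zero => intro σ _; simp [orderedExpTerm]
  | succ k ih =>
    intro σ hσ
    have hM0 : 0 ≤ M := (norm_nonneg _).trans (hM σ hσ)
    have hc : Continuous (orderedExpTerm g k) := by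
      have := continuous_orderedExpTerm (Λ := Unit) (g := fun _ => g) (by fun_prop) k
      exact this.comp (f := fun r : ℝ => ((), r)) (by fun_prop)
    have key : ∀ r ∈ Ι (1 : ℝ) σ, ‖orderedExpTerm g k r * g r‖ ≤
        ‖(1 : R)‖ * (M ^ (k + 1) / k.factorial) * |r - 1| ^ k := by
      intro r hr
      have hr' : |r - 1| ≤ T := by
        refine le_trans ?_ hσ
        rcases mem_uIoc.1 hr with h | h
        · rw [abs_of_nonneg (by linarith), abs_of_nonneg (by linarith)]; linarith
        · rw [abs_of_nonpos (by linarith), abs_of_nonpos (by linarith)]; linarith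
      calc ‖orderedExpTerm g k r * g r‖ ≤ ‖orderedExpTerm g k r‖ * ‖g r‖ := norm_mul_le _ _
        _ ≤ ‖(1 : R)‖ * (M ^ k * |r - 1| ^ k / k.factorial) * M := by
          gcongr
          · exact ih r hr'
          · exact hM r hr'
        _ = _ := by ring
    calc ‖orderedExpTerm g (k + 1) σ‖ = ‖∫ r in (1 : ℝ)..σ, orderedExpTerm g k r * g r‖ := by
          rw [orderedExpTerm, intervalIntegral.integral_symm, norm_neg]
      _ ≤ ∫ r in Ι (1 : ℝ) σ, ‖orderedExpTerm g k r * g r‖ :=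
          intervalIntegral.norm_integral_le_integral_norm_uIoc
      _ ≤ ∫ r in Ι (1 : ℝ) σ, ‖(1 : R)‖ * (M ^ (k + 1) / k.factorial) * |r - 1| ^ k := by
          apply setIntegral_mono_on _ _ measurableSet_uIoc key
          · exact ((hc.mul hg).norm.intervalIntegrable 1 σ).def'
          · exact (Continuous.intervalIntegrable (by fun_prop) 1 σ).def'
      _ = _ := by
          rw [integral_const_mul, integral_pow_abs_sub_uIoc]
          rw [Nat.factorial_succ]; push_cast
          field_simp

theorem summable_orderedExp_bound (c M T : ℝ) :
    Summable fun k : ℕ => c * (M ^ k * T ^ k / k.factorial) := by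
  have := (Real.summable_pow_div_factorial (M * T)).mul_left c
  simpa [mul_pow] using this

theorem norm_orderedExpTerm_le' {g : ℝ → R} (hg : Continuous g) {T M : ℝ}
    (hM : ∀ r, |r - 1| ≤ T → ‖g r‖ ≤ M) (k : ℕ) (σ : ℝ) (hσ : |σ - 1| ≤ T) :
    ‖orderedExpTerm g k σ‖ ≤ ‖(1 : R)‖ * (M ^ k * T ^ k / k.factorial) := by
  have hM0 : 0 ≤ M := (norm_nonneg _).trans (hM σ hσ)
  refine (norm_orderedExpTerm_le hg hM k σ hσ).trans ?_
  gcongr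

theorem continuous_orderedExpTerm_self {g : ℝ → R} (hg : Continuous g) (k : ℕ) :
    Continuous (orderedExpTerm g k) := by
  have := continuous_orderedExpTerm (Λ := Unit) (g := fun _ => g) (by fun_prop) k
  exact this.comp (f := fun r : ℝ => ((), r)) (by fun_prop)

@[simp]
theorem orderedExp_one (g : ℝ → R) : orderedExp g 1 = 1 := by
  rw [orderedExp, tsum_eq_single 0]
  · rfl
  · intro k hk
    obtain ⟨k, rfl⟩ := Nat.exists_eq_succ_of_ne_zero hk
    simp [orderedExpTerm]

/-- The inverse of the path-ordered exponential, as an ordered exponential in the opposite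
algebra. -/
noncomputable def orderedExpInv (g : ℝ → R) (σ : ℝ) : R :=
  MulOpposite.unop (orderedExp (fun r => MulOpposite.op (-(g r))) σ)

@[simp]
theorem orderedExpInv_one (g : ℝ → R) : orderedExpInv g 1 = 1 := by simp [orderedExpInv]

variable [CompleteSpace R]

theorem continuous_orderedExp [LocallyCompactSpace Λ] {g : Λ → ℝ → R}
    (hg : Continuous (uncurry g)) :
    Continuous (fun p : Λ × ℝ => orderedExp (g p.1) p.2) := by
  rw [continuous_iff_continuousAt]
  rintro ⟨l, σ⟩
  obtain ⟨S, hS, hSl⟩ := exists_compact_mem_nhds l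
  set T := |σ - 1| + 1
  obtain ⟨M, hM⟩ := (hS.prod (isCompact_closedBall (1 : ℝ) T)).exists_bound_of_continuousOn
    (f := uncurry g) hg.continuousOn
  have hU : S ×ˢ Metric.closedBall (1 : ℝ) T ∈ 𝓝 (l, σ) := by
    refine prod_mem_nhds hSl ?_
    refine mem_nhds_iff.2 ⟨Metric.ball 1 T, Metric.ball_subset_closedBall, Metric.isOpen_ball, ?_⟩
    rw [Metric.mem_ball, Real.dist_eq]; simp [T]
  refine ContinuousOn.continuousAt (s := S ×ˢ Metric.closedBall (1 : ℝ) T) ?_ hU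
  refine continuousOn_tsum (fun k => (continuous_orderedExpTerm hg k).continuousOn)
    (summable_orderedExp_bound ‖(1 : R)‖ M T) ?_
  rintro k ⟨l', σ'⟩ ⟨h1, h2⟩
  refine norm_orderedExpTerm_le' (g := g l') (by fun_prop) (T := T) ?_ k σ' ?_
  · intro r hr
    exact hM (l', r) ⟨h1, by rwa [Metric.mem_closedBall, Real.dist_eq]⟩
  · simpa [Real.dist_eq] using h2

theorem continuous_orderedExp_self {g : ℝ → R} (hg : Continuous g) : Continuous (orderedExp g) := by
  have := continuous_orderedExp (Λ := Unit) (g := fun _ => g) (by fun_prop)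
  exact this.comp (f := fun r : ℝ => ((), r)) (by fun_prop)

theorem summable_orderedExpTerm {g : ℝ → R} (hg : Continuous g) (σ : ℝ) :
    Summable fun k => orderedExpTerm g k σ := by
  obtain ⟨M, hM⟩ := (isCompact_closedBall (1 : ℝ) |σ - 1|).exists_bound_of_continuousOn
    (f := g) hg.continuousOn
  refine Summable.of_norm_bounded (summable_orderedExp_bound ‖(1 : R)‖ M |σ - 1|) fun k => ?_
  exact norm_orderedExpTerm_le' hg (fun r hr => hM r (by rwa [Metric.mem_closedBall, Real.dist_eq]))
    k σ le_rfl

theorem orderedExp_eq_integral {g : ℝ → R} (hg : Continuous g) (σ : ℝ) :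
    orderedExp g σ = 1 + ∫ r in σ..1, orderedExp g r * g r := by
  rw [orderedExp, (summable_orderedExpTerm hg σ).tsum_eq_zero_add]
  congr 1
  simp only [orderedExpTerm]
  have hcont : ∀ k, Continuous fun r => orderedExpTerm g k r * g r :=
    fun k => (continuous_orderedExpTerm_self hg k).mul hg
  set T := |σ - 1|
  obtain ⟨M, hM⟩ := (isCompact_closedBall (1 : ℝ) T).exists_bound_of_continuousOn
    (f := g) hg.continuousOn
  have h := intervalIntegral.hasSum_integral_of_dominated_convergence (μ := volume)
    (F := fun k r => orderedExpTerm g k r * g r) (f := fun r => orderedExp g r * g r)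
    (a := σ) (b := 1)
    (bound := fun k _ => ‖(1 : R)‖ * (M ^ k * T ^ k / k.factorial) * M)
    (fun k => (hcont k).aestronglyMeasurable) ?_ ?_ ?_ ?_
  · exact h.tsum_eq
  · intro k
    refine Filter.Eventually.of_forall fun r hr => ?_
    have hr' : |r - 1| ≤ T := by
      rcases mem_uIoc.1 hr with h | h
      · simp only [T]
        rw [abs_of_nonpos (by linarith), abs_of_nonpos (by linarith)]; linarith
      · simp only [T]
        rw [abs_of_nonneg (by linarith), abs_of_nonneg (by linarith)]; linarith
    have hb : ∀ r, |r - 1| ≤ T → ‖g r‖ ≤ M :=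
      fun r hr => hM r (by rwa [Metric.mem_closedBall, Real.dist_eq])
    have hM0 : 0 ≤ M := (norm_nonneg _).trans (hb r hr')
    have hT : 0 ≤ T := abs_nonneg _
    refine (norm_mul_le _ _).trans ?_
    gcongr
    · exact norm_orderedExpTerm_le' hg hb k r hr'
    · exact hb r hr'
  · exact Filter.Eventually.of_forall fun r _ =>
      (summable_orderedExp_bound ‖(1 : R)‖ M T).mul_right M
  · exact continuous_const.intervalIntegrable _ _
  · refine Filter.Eventually.of_forall fun r _ => ?_
    exact (summable_orderedExpTerm hg r).hasSum.mul_right _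

theorem hasDerivAt_orderedExp {g : ℝ → R} (hg : Continuous g) (σ : ℝ) :
    HasDerivAt (orderedExp g) (-(orderedExp g σ * g σ)) σ := by
  have h1 : HasDerivAt (fun σ => ∫ r in σ..1, orderedExp g r * g r) (-(orderedExp g σ * g σ)) σ :=
    intervalIntegral.integral_hasDerivAt_left
      (((continuous_orderedExp_self hg).mul hg).intervalIntegrable _ _)
      (((continuous_orderedExp_self hg).mul hg).stronglyMeasurableAtFilter _ _)
      ((continuous_orderedExp_self hg).mul hg).continuousAt
  have h2 := h1.const_add 1
  exact h2.congr_of_eventuallyEq (Filter.Eventually.of_forall (orderedExp_eq_integral hg))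

theorem hasDerivAt_orderedExpInv {g : ℝ → R} (hg : Continuous g) (σ : ℝ) :
    HasDerivAt (orderedExpInv g) (g σ * orderedExpInv g σ) σ := by
  have h := hasDerivAt_orderedExp (g := fun r => MulOpposite.op (-(g r)))
    (MulOpposite.continuous_op.comp hg.neg) σ
  have h2 := ((MulOpposite.opContinuousLinearEquiv ℝ (M := R)).symm :
    Rᵐᵒᵖ →L[ℝ] R).hasFDerivAt.comp_hasDerivAt σ h
  convert! h2 using 1
  simp [orderedExpInv]

theorem hasDerivAt_linear_eq_zero {F : Type*} [NormedAddCommGroup F] [NormedSpace ℝ F]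
    {L : ℝ → F → F} {D : ℝ → F} {m : ℝ → ℝ} (hm : Continuous m)
    (hL : ∀ t x, ‖L t x‖ ≤ m t * ‖x‖) (hadd : ∀ t x y, L t (x - y) = L t x - L t y)
    (hD : ∀ t, HasDerivAt D (L t (D t)) t) {t₀ : ℝ} (h0 : D t₀ = 0) (t : ℝ) : D t = 0 := by
  obtain ⟨a, b, ht, ht0⟩ : ∃ a b, t ∈ Ioo a b ∧ t₀ ∈ Ioo a b :=
    ⟨min t t₀ - 1, max t t₀ + 1, ⟨by linarith [min_le_left t t₀], by linarith [le_max_left t t₀]⟩,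
      ⟨by linarith [min_le_right t t₀], by linarith [le_max_right t t₀]⟩⟩
  obtain ⟨M, hM⟩ := (isCompact_Icc (a := a) (b := b)).exists_bound_of_continuousOn hm.continuousOn
  have hz : ∀ t, L t 0 = 0 := fun t => by have := hadd t 0 0; simpa using this
  have := ODE_solution_unique_of_mem_Ioo (v := L) (s := fun _ => univ) (K := Real.toNNReal M)
    (f := D) (g := fun _ => (0 : F)) (t₀ := t₀) (a := a) (b := b) ?_ ht0 ?_ ?_ (by simp [h0])
  · exact this ht
  · intro t ht
    refine LipschitzWith.lipschitzOnWith (LipschitzWith.of_dist_le_mul fun x y => ?_)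
    rw [dist_eq_norm, dist_eq_norm, ← hadd]
    have h1 := hM t (Ioo_subset_Icc_self ht)
    have h2 : 0 ≤ M := (norm_nonneg _).trans h1
    rw [Real.coe_toNNReal _ h2]
    refine (hL t _).trans ?_
    gcongr
    exact (le_abs_self _).trans h1
  · exact fun t _ => ⟨hD t, trivial⟩
  · intro t _
    refine ⟨?_, trivial⟩
    rw [hz]; exact hasDerivAt_const _ _

theorem orderedExpInv_mul {g : ℝ → R} (hg : Continuous g) (σ : ℝ) :
    orderedExpInv g σ * orderedExp g σ = 1 := by
  have := hasDerivAt_linear_eq_zero (F := R) (L := fun t x => g t * x - x * g t)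
    (D := fun σ => orderedExpInv g σ * orderedExp g σ - 1) (m := fun t => 2 * ‖g t‖)
    (by fun_prop) ?_ ?_ ?_ (t₀ := 1) (by simp) σ
  · exact sub_eq_zero.1 this
  · intro t x
    calc ‖g t * x - x * g t‖ ≤ ‖g t * x‖ + ‖x * g t‖ := norm_sub_le _ _
      _ ≤ ‖g t‖ * ‖x‖ + ‖x‖ * ‖g t‖ := add_le_add (norm_mul_le _ _) (norm_mul_le _ _)
      _ = _ := by ring
  · intro t x y; noncomm_ring
  · intro t
    convert! ((hasDerivAt_orderedExpInv hg t).mul (hasDerivAt_orderedExp hg t)).sub_const 1 using 1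
    noncomm_ring

/-- Duhamel's formula. -/
theorem orderedExp_sub_orderedExp {g g' : ℝ → R} (hg : Continuous g) (hg' : Continuous g')
    (σ : ℝ) :
    orderedExp g' σ - orderedExp g σ =
      (∫ r in σ..1, orderedExp g' r * (g' r - g r) * orderedExpInv g r) * orderedExp g σ := by
  have hc : Continuous fun r => orderedExp g' r * (g' r - g r) * orderedExpInv g r := by
    have h1 : Continuous (orderedExpInv g) := by
      rw [continuous_iff_continuousAt]
      exact fun s => (hasDerivAt_orderedExpInv hg s).continuousAt
    exact ((continuous_orderedExp_self hg').mul (hg'.sub hg)).mul h1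
  have h : ∀ s, HasDerivAt (fun σ => orderedExp g' σ * orderedExpInv g σ)
      (-(orderedExp g' s * (g' s - g s) * orderedExpInv g s)) s := fun s => by
    convert! (hasDerivAt_orderedExp hg' s).mul (hasDerivAt_orderedExpInv hg s) using 1
    noncomm_ring
  have h2 := intervalIntegral.integral_eq_sub_of_hasDerivAt (a := σ) (b := 1) (fun s _ => h s)
    (hc.neg.intervalIntegrable _ _)
  rw [intervalIntegral.integral_neg] at h2
  simp only [orderedExp_one, orderedExpInv_one, mul_one] at h2
  have h3 : (∫ r in σ..1, orderedExp g' r * (g' r - g r) * orderedExpInv g r)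
      = orderedExp g' σ * orderedExpInv g σ - 1 := by rw [← neg_inj, h2]; abel
  rw [h3, sub_mul, mul_assoc, orderedExpInv_mul hg]; simp

theorem continuous_orderedExpInv_self {g : ℝ → R} (hg : Continuous g) :
    Continuous (orderedExpInv g) := by
  rw [continuous_iff_continuousAt]
  exact fun s => (hasDerivAt_orderedExpInv hg s).continuousAt

end OrderedExp

/-! ### Differentiation with respect to a parameter -/

section Parameter

variable {F : Type*} [NormedAddCommGroup F] [NormedSpace ℝ F]

theorem hasDerivAt_of_sub_eq_smul {f Φ : ℝ → F} {l : ℝ} (h : ∀ l', f l' - f l = (l' - l) • Φ l')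
    (hΦ : ContinuousAt Φ l) : HasDerivAt f (Φ l) l := by
  rw [hasDerivAt_iff_tendsto_slope]
  refine (hΦ.tendsto.mono_left nhdsWithin_le_nhds).congr' ?_
  filter_upwards [self_mem_nhdsWithin] with l' hl'
  rw [slope_def_module, h, smul_smul, inv_mul_cancel₀ (sub_ne_zero.2 hl'), one_smul]

/-- Hadamard's lemma with parameters. -/
theorem exists_continuous_sub_eq_smul [CompleteSpace F] {X : Type*} [TopologicalSpace X]
    {f f' : ℝ → X → F} (hf' : Continuous (uncurry f'))
    (h : ∀ l x, HasDerivAt (fun l => f l x) (f' l x) l) (l : ℝ) :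
    ∃ γ : ℝ → X → F, Continuous (uncurry γ) ∧ (∀ l' x, f l' x - f l x = (l' - l) • γ l' x) ∧
      ∀ x, γ l x = f' l x := by
  refine ⟨fun l' x => ∫ s in (0 : ℝ)..1, f' (l + s * (l' - l)) x, ?_, ?_, ?_⟩
  · have : Continuous (uncurry fun (p : ℝ × X) (s : ℝ) => f' (l + s * (p.1 - l)) p.2) :=
      hf'.comp (f := fun q : (ℝ × X) × ℝ => (l + q.2 * (q.1.1 - l), q.1.2)) (by fun_prop)
    exact intervalIntegral.continuous_parametric_intervalIntegral_of_continuous' this 0 1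
  · intro l' x
    have hd : ∀ s, HasDerivAt (fun s => f (l + s * (l' - l)) x)
        ((l' - l) • f' (l + s * (l' - l)) x) s := fun s => by
      have h1 : HasDerivAt (fun s : ℝ => l + s * (l' - l)) (l' - l) s := by
        simpa using ((hasDerivAt_id s).mul_const (l' - l)).const_add l
      exact (h _ x).scomp s h1
    have hc : Continuous fun s => f' (l + s * (l' - l)) x :=
      hf'.comp (f := fun s : ℝ => (l + s * (l' - l), x)) (by fun_prop)
    have := intervalIntegral.integral_eq_sub_of_hasDerivAt (a := 0) (b := 1) (fun s _ => hd s)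
      ((hc.const_smul _).intervalIntegrable _ _)
    rw [intervalIntegral.integral_smul] at this
    rw [this]; simp
  · intro x; simp

theorem hasDerivAt_integral_param [CompleteSpace F] {f f' : ℝ → ℝ → F}
    (hf : ∀ l, Continuous (f l)) (hf' : Continuous (uncurry f'))
    (h : ∀ l x, HasDerivAt (fun l => f l x) (f' l x) l) (a b l : ℝ) :
    HasDerivAt (fun l => ∫ x in a..b, f l x) (∫ x in a..b, f' l x) l := by
  obtain ⟨γ, hγ, h1, h2⟩ := exists_continuous_sub_eq_smul hf' h l
  have := hasDerivAt_of_sub_eq_smul (f := fun l => ∫ x in a..b, f l x)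
    (Φ := fun l' => ∫ x in a..b, γ l' x) (l := l) ?_ ?_
  · simpa only [h2] using this
  · intro l'
    rw [← intervalIntegral.integral_sub ((hf l').intervalIntegrable _ _)
      ((hf l).intervalIntegrable _ _), ← intervalIntegral.integral_smul]
    simp only [h1]
  · exact (intervalIntegral.continuous_parametric_intervalIntegral_of_continuous' hγ a b).continuousAt

theorem hasDerivAt_orderedExp_param {R : Type*} [NormedRing R] [NormedAlgebra ℝ R]
    [CompleteSpace R] {g g' : ℝ → ℝ → R} (hg : Continuous (uncurry g))
    (hg' : Continuous (uncurry g')) (h : ∀ l r, HasDerivAt (fun l => g l r) (g' l r) l)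
    (l σ : ℝ) :
    HasDerivAt (fun l => orderedExp (g l) σ)
      ((∫ r in σ..1, orderedExp (g l) r * g' l r * orderedExpInv (g l) r) * orderedExp (g l) σ)
      l := by
  obtain ⟨γ, hγ, h1, h2⟩ := exists_continuous_sub_eq_smul hg' h l
  have hgl : ∀ l, Continuous (g l) := fun l => by fun_prop
  have := hasDerivAt_of_sub_eq_smul (f := fun l => orderedExp (g l) σ)
    (Φ := fun l' => (∫ r in σ..1, orderedExp (g l') r * γ l' r * orderedExpInv (g l) r)
      * orderedExp (g l) σ) (l := l) ?_ ?_
  · simpa only [h2] using this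
  · intro l'
    simp only [orderedExp_sub_orderedExp (hgl l) (hgl l'), h1]
    rw [← smul_mul_assoc, ← intervalIntegral.integral_smul]
    simp only [mul_smul_comm, smul_mul_assoc]
  · have hc : Continuous (uncurry fun (l' r : ℝ) =>
        orderedExp (g l') r * γ l' r * orderedExpInv (g l) r) :=
      ((continuous_orderedExp hg).mul hγ).mul
        ((continuous_orderedExpInv_self (hgl l)).comp continuous_snd)
    exact ((intervalIntegral.continuous_parametric_intervalIntegral_of_continuous'
      hc σ 1).mul continuous_const).continuousAt

end Parameter

/-! ### Parallel transport along a path of Lie algebra elements -/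

section Rep

variable {𝔤 : Type*} [NormedLieRing 𝔤] [NormedLieAlgebra 𝔤] [FiniteDimensional ℝ 𝔤]
  {V : Type*} [NormedAddCommGroup V] [NormedSpace ℝ V] [FiniteDimensional ℝ V]

/-- A linear map `𝔤 → End V` as a continuous linear map. -/
noncomputable def repCLM (ρ : 𝔤 →ₗ[ℝ] Module.End ℝ V) : 𝔤 →L[ℝ] V →L[ℝ] V :=
  LinearMap.toContinuousLinearMap
    ((LinearMap.toContinuousLinearMap : Module.End ℝ V ≃ₗ[ℝ] V →L[ℝ] V).toLinearMap ∘ₗ ρ)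

@[simp]
theorem repCLM_apply (ρ : 𝔤 →ₗ[ℝ] Module.End ℝ V) (x : 𝔤) (v : V) : repCLM ρ x v = ρ x v := rfl

/-- The parallel transport from `σ` to `1` of the connection `A` on the line. -/
noncomputable def transport (ρ : 𝔤 →ₗ[ℝ] Module.End ℝ V) (A : ℝ → 𝔤) (σ : ℝ) : V →L[ℝ] V :=
  orderedExp (fun r => -repCLM ρ (A r)) σ

/-- The parallel transport from `1` to `σ`. -/
noncomputable def transportInv (ρ : 𝔤 →ₗ[ℝ] Module.End ℝ V) (A : ℝ → 𝔤) (σ : ℝ) : V →L[ℝ] V :=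
  orderedExpInv (fun r => -repCLM ρ (A r)) σ

variable (ρ : 𝔤 →ₗ[ℝ] Module.End ℝ V) {A : ℝ → 𝔤}

@[simp]
theorem transport_one (A : ℝ → 𝔤) : transport ρ A 1 = 1 := orderedExp_one _

@[simp]
theorem transportInv_one (A : ℝ → 𝔤) : transportInv ρ A 1 = 1 := orderedExpInv_one _

theorem continuous_neg_repCLM (hA : Continuous A) : Continuous fun r => -repCLM ρ (A r) := by
  fun_prop

theorem hasDerivAt_transport (hA : Continuous A) (σ : ℝ) :
    HasDerivAt (transport ρ A) (transport ρ A σ * repCLM ρ (A σ)) σ := by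
  convert! hasDerivAt_orderedExp (continuous_neg_repCLM ρ hA) σ using 1
  simp [transport]

theorem hasDerivAt_transportInv (hA : Continuous A) (σ : ℝ) :
    HasDerivAt (transportInv ρ A) (-(repCLM ρ (A σ) * transportInv ρ A σ)) σ := by
  convert! hasDerivAt_orderedExpInv (continuous_neg_repCLM ρ hA) σ using 1

theorem transportInv_mul (hA : Continuous A) (σ : ℝ) :
    transportInv ρ A σ * transport ρ A σ = 1 := orderedExpInv_mul (continuous_neg_repCLM ρ hA) σ

theorem transportInv_transport_apply (hA : Continuous A) (σ : ℝ) (v : V) :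
    transportInv ρ A σ (transport ρ A σ v) = v := by
  have := congrArg (fun T => T v) (transportInv_mul ρ hA σ)
  exact this

theorem continuous_transport {Λ : Type*} [TopologicalSpace Λ] [LocallyCompactSpace Λ]
    {A : Λ → ℝ → 𝔤} (hA : Continuous (uncurry A)) :
    Continuous fun p : Λ × ℝ => transport ρ (A p.1) p.2 :=
  continuous_orderedExp (g := fun l r => -repCLM ρ (A l r))
    ((repCLM ρ).continuous.comp hA).neg

theorem continuous_transport_self (hA : Continuous A) : Continuous (transport ρ A) :=
  continuous_orderedExp_self (continuous_neg_repCLM ρ hA)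

theorem continuous_transportInv_self (hA : Continuous A) : Continuous (transportInv ρ A) :=
  continuous_orderedExpInv_self (continuous_neg_repCLM ρ hA)

/-- The first variation of parallel transport: `∂_λ W = W ρ(A_λ) + (∫ W ρ(F_σλ) W⁻¹) W`, when the
path is fixed at its endpoint. -/
theorem hasDerivAt_transport_param (hρ : ∀ x y v, ρ ⁅x, y⁆ v = ρ x (ρ y v) - ρ y (ρ x v))
    {As Al dAs dAl : ℝ → ℝ → 𝔤} (hAs : Continuous (uncurry As)) (hAl : ∀ l, Continuous (Al l))
    (hdAs : Continuous (uncurry dAs)) (hdAl : ∀ l, Continuous (dAl l))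
    (h : ∀ l r, HasDerivAt (fun l => As l r) (dAs l r) l)
    (h' : ∀ l r, HasDerivAt (fun r => Al l r) (dAl l r) r) (h1 : ∀ l, Al l 1 = 0) (l σ : ℝ) :
    HasDerivAt (fun l => transport ρ (As l) σ)
      (transport ρ (As l) σ * repCLM ρ (Al l σ) +
        (∫ r in σ..1, transport ρ (As l) r *
          repCLM ρ (dAl l r - dAs l r + ⁅As l r, Al l r⁆) * transportInv ρ (As l) r) *
        transport ρ (As l) σ) l := by
  have hAsl : Continuous (As l) := by fun_prop
  have hdAsl : Continuous (dAs l) := by fun_prop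
  have hW := continuous_transport_self ρ hAsl
  have hW' := continuous_transportInv_self ρ hAsl
  have hA' := hAl l
  have hdA' := hdAl l
  have hbr : ∀ x y, repCLM ρ ⁅x, y⁆ = repCLM ρ x * repCLM ρ y - repCLM ρ y * repCLM ρ x := by
    intro x y; ext v; exact hρ x y v
  have key := hasDerivAt_orderedExp_param (g := fun l r => -repCLM ρ (As l r))
    (g' := fun l r => -repCLM ρ (dAs l r))
    ((repCLM ρ).continuous.comp hAs).neg ((repCLM ρ).continuous.comp hdAs).neg
    (fun l r => ((repCLM ρ).hasFDerivAt.comp_hasDerivAt l (h l r)).neg) l σ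
  convert! key using 1
  have hd : ∀ r, HasDerivAt
      (fun r => transport ρ (As l) r * repCLM ρ (Al l r) * transportInv ρ (As l) r)
      (transport ρ (As l) r * repCLM ρ (dAl l r) * transportInv ρ (As l) r
        + transport ρ (As l) r * (repCLM ρ (As l r) * repCLM ρ (Al l r)
          - repCLM ρ (Al l r) * repCLM ρ (As l r)) * transportInv ρ (As l) r) r := fun r => by
    have h2 := ((hasDerivAt_transport ρ hAsl r).mul
      ((repCLM ρ).hasFDerivAt.comp_hasDerivAt r (h' l r))).mul (hasDerivAt_transportInv ρ hAsl r)
    convert! h2 using 1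
    simp only [Function.comp]
    noncomm_ring
  have hc1 : Continuous fun r => transport ρ (As l) r * repCLM ρ (dAl l r) * transportInv ρ (As l) r
        + transport ρ (As l) r * (repCLM ρ (As l r) * repCLM ρ (Al l r)
          - repCLM ρ (Al l r) * repCLM ρ (As l r)) * transportInv ρ (As l) r := by fun_prop
  have hc2 : Continuous fun r =>
      transport ρ (As l) r * -repCLM ρ (dAs l r) * transportInv ρ (As l) r := by fun_prop
  have hi := intervalIntegral.integral_eq_sub_of_hasDerivAt (a := σ) (b := 1) (fun s _ => hd s)
    (hc1.intervalIntegrable _ _)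
  rw [h1] at hi
  have hF : (∫ r in σ..1, transport ρ (As l) r *
          repCLM ρ (dAl l r - dAs l r + ⁅As l r, Al l r⁆) * transportInv ρ (As l) r)
      = (∫ r in σ..1, transport ρ (As l) r * -repCLM ρ (dAs l r) * transportInv ρ (As l) r)
        - transport ρ (As l) σ * repCLM ρ (Al l σ) * transportInv ρ (As l) σ := by
    have e : - (transport ρ (As l) σ * repCLM ρ (Al l σ) * transportInv ρ (As l) σ) =
      (∫ r in σ..1, transport ρ (As l) r * repCLM ρ (dAl l r) * transportInv ρ (As l) r
        + transport ρ (As l) r * (repCLM ρ (As l r) * repCLM ρ (Al l r)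
          - repCLM ρ (Al l r) * repCLM ρ (As l r)) * transportInv ρ (As l) r) := by
      rw [hi]; simp
    rw [sub_eq_add_neg, e, ← intervalIntegral.integral_add (hc2.intervalIntegrable _ _)
      (hc1.intervalIntegrable _ _)]
    refine intervalIntegral.integral_congr fun r _ => ?_
    simp only [map_add, map_sub, hbr]
    noncomm_ring
  rw [hF, sub_mul, mul_assoc _ (transportInv ρ (As l) σ), transportInv_mul ρ hAsl]
  simp only [mul_one, add_sub_cancel]
  rfl

end Rep

section CrossedModule

variable {𝔤 : Type*} [NormedLieRing 𝔤] [NormedLieAlgebra 𝔤] [FiniteDimensional ℝ 𝔤]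
  {𝔥 : Type*} [NormedLieRing 𝔥] [NormedLieAlgebra 𝔥] [FiniteDimensional ℝ 𝔥]
  (C : DifferentialCrossedModule 𝔤 𝔥) {A : ℝ → 𝔤}

theorem action_lie (x y : 𝔤) (v : 𝔥) :
    C.action ⁅x, y⁆ v = C.action x (C.action y v) - C.action y (C.action x v) := by
  change C.dα ⁅x, y⁆ v = C.dα x (C.dα y v) - C.dα y (C.dα x v)
  simp [LieDerivation.lie_apply]

theorem dt_action (x : 𝔤) (y : 𝔥) : C.dt (C.action x y) = ⁅x, C.dt y⁆ := C.dt_dα x y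

theorem action_dt (x y : 𝔥) : C.action (C.dt x) y = ⁅x, y⁆ := C.dα_dt x y

@[simp]
theorem adjointAction_apply (x y : 𝔤) : adjointAction 𝔤 x y = ⁅x, y⁆ := rfl

theorem transport_action (hA : Continuous A) (σ : ℝ) (x : 𝔤) :
    transport C.action A σ * repCLM C.action x * transportInv C.action A σ =
      repCLM C.action (transport (adjointAction 𝔤) A σ x) := by
  set N : ℝ → 𝔥 →L[ℝ] 𝔥 := fun s => transport C.action A s *
    repCLM C.action (transportInv (adjointAction 𝔤) A s (transport (adjointAction 𝔤) A σ x)) *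
      transportInv C.action A s with hN
  have h : ∀ s, HasDerivAt N 0 s := fun s => by
    have h1 := (hasDerivAt_transportInv (adjointAction 𝔤) hA s).clm_apply
      (hasDerivAt_const s (transport (adjointAction 𝔤) A σ x))
    have h2 := ((hasDerivAt_transport C.action hA s).mul
      ((repCLM C.action).hasFDerivAt.comp_hasDerivAt s h1)).mul
        (hasDerivAt_transportInv C.action hA s)
    convert! h2 using 1
    ext v
    simp [action_lie]
  have h2 := is_const_of_deriv_eq_zero (fun x => (h x).differentiableAt) (fun x => (h x).deriv) σ 1
  simp only [hN, transportInv_transport_apply _ hA] at h2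
  rw [h2]; simp

theorem dt_transport (hA : Continuous A) (σ : ℝ) (y : 𝔥) :
    C.dt (transport C.action A σ y) = transport (adjointAction 𝔤) A σ (C.dt y) := by
  set T : 𝔥 →L[ℝ] 𝔤 := LinearMap.toContinuousLinearMap C.dt.toLinearMap with hT
  have hTa : ∀ y, T y = C.dt y := fun y => rfl
  have h : ∀ s, HasDerivAt (fun s => transport (adjointAction 𝔤) A s
      (T (transportInv C.action A s (transport C.action A σ y)))) 0 s := fun s => by
    have h1 := (hasDerivAt_transportInv C.action hA s).clm_apply
      (hasDerivAt_const s (transport C.action A σ y))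
    have h2 := (hasDerivAt_transport (adjointAction 𝔤) hA s).clm_apply
      (T.hasFDerivAt.comp_hasDerivAt s h1)
    convert! h2 using 1
    have e : ∀ u v : 𝔤, (0 : 𝔤) = ⁅u, v⁆ + ⁅v, u⁆ := fun u v => by
      rw [← lie_skew u v, neg_add_cancel]
    simp [hTa, dt_action, ← map_add, ← e]
  have h2 := is_const_of_deriv_eq_zero (fun x => (h x).differentiableAt) (fun x => (h x).deriv) σ 1
  simp only [transportInv_transport_apply _ hA] at h2
  simpa [hTa] using h2.symm

/-- The value `∫ W(q)` of the path space connection whose contracted 2-form along the path is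
`q`. -/
noncomputable def chenOne (A : ℝ → 𝔤) (q : ℝ → 𝔥) : 𝔥 :=
  ∫ σ in (0 : ℝ)..1, transport C.action A σ (q σ)

/-- The first variation of `chenOne`; here `Al` is the contraction of the connection with the
variation, `F` the curvature contracted with the velocity and the variation, and `dq` the derivative
of `q`. -/
noncomputable def chenOneVariation (A Al F : ℝ → 𝔤) (q dq : ℝ → 𝔥) : 𝔥 :=
  (∫ σ in (0 : ℝ)..1, transport C.action A σ (C.action (Al σ) (q σ) + dq σ)) +
    ∫ σ in (0 : ℝ)..1, C.action (transport (adjointAction 𝔤) A σ (F σ))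
      (∫ r in (0 : ℝ)..σ, transport C.action A r (q r))

/-- The iterated integral `∫_{σ₁<σ₂} dα(F₂)(B₁) - dα(F₁)(B₂)` of transported quantities. -/
noncomputable def chenTwo (A Fv Fw : ℝ → 𝔤) (qv qw : ℝ → 𝔥) : 𝔥 :=
  ∫ σ in (0 : ℝ)..1,
    (C.action (transport (adjointAction 𝔤) A σ (Fw σ))
        (∫ r in (0 : ℝ)..σ, transport C.action A r (qv r)) -
      C.action (transport (adjointAction 𝔤) A σ (Fv σ))
        (∫ r in (0 : ℝ)..σ, transport C.action A r (qw r)))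

variable {Λ : Type*} [TopologicalSpace Λ] [LocallyCompactSpace Λ]

theorem continuous_transport_apply {V : Type*} [NormedAddCommGroup V] [NormedSpace ℝ V]
    [FiniteDimensional ℝ V] (ρ : 𝔤 →ₗ[ℝ] Module.End ℝ V) {A : Λ → ℝ → 𝔤}
    {q : Λ → ℝ → V} (hA : Continuous (uncurry A)) (hq : Continuous (uncurry q)) :
    Continuous (uncurry fun l σ => transport ρ (A l) σ (q l σ)) :=
  (continuous_transport ρ hA).clm_apply hq

theorem continuous_action {X : Type*} [TopologicalSpace X] {f : X → 𝔤} {g : X → 𝔥}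
    (hf : Continuous f) (hg : Continuous g) : Continuous fun x => C.action (f x) (g x) :=
  ((repCLM C.action).continuous.comp hf).clm_apply hg

theorem continuous_chenOne {A : Λ → ℝ → 𝔤} {q : Λ → ℝ → 𝔥} (hA : Continuous (uncurry A))
    (hq : Continuous (uncurry q)) : Continuous fun l => chenOne C (A l) (q l) :=
  intervalIntegral.continuous_parametric_intervalIntegral_of_continuous'
    (continuous_transport_apply C.action hA hq) 0 1

theorem continuous_primitive_transport {A : Λ → ℝ → 𝔤} {q : Λ → ℝ → 𝔥}
    (hA : Continuous (uncurry A)) (hq : Continuous (uncurry q)) :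
    Continuous (uncurry fun l σ => ∫ r in (0 : ℝ)..σ, transport C.action (A l) r (q l r)) :=
  intervalIntegral.continuous_parametric_primitive_of_continuous
    (continuous_transport_apply C.action hA hq)

theorem continuous_action_primitive {A F : Λ → ℝ → 𝔤} {q : Λ → ℝ → 𝔥}
    (hA : Continuous (uncurry A)) (hF : Continuous (uncurry F)) (hq : Continuous (uncurry q)) :
    Continuous (uncurry fun l σ => C.action (transport (adjointAction 𝔤) (A l) σ (F l σ))
      (∫ r in (0 : ℝ)..σ, transport C.action (A l) r (q l r))) :=
  continuous_action C (continuous_transport_apply (adjointAction 𝔤) hA hF)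
    (continuous_primitive_transport C hA hq)

theorem continuous_chenOneVariation {A Al F : Λ → ℝ → 𝔤} {q dq : Λ → ℝ → 𝔥}
    (hA : Continuous (uncurry A)) (hAl : Continuous (uncurry Al)) (hF : Continuous (uncurry F))
    (hq : Continuous (uncurry q)) (hdq : Continuous (uncurry dq)) :
    Continuous fun l => chenOneVariation C (A l) (Al l) (F l) (q l) (dq l) := by
  refine Continuous.add ?_ ?_
  · exact intervalIntegral.continuous_parametric_intervalIntegral_of_continuous'
      (continuous_transport_apply C.action (q := fun l σ => C.action (Al l σ) (q l σ) + dq l σ) hA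
        ((continuous_action C hAl hq).add hdq)) 0 1
  · exact intervalIntegral.continuous_parametric_intervalIntegral_of_continuous'
      (continuous_action_primitive C hA hF hq) 0 1

theorem continuous_chenTwo {A Fv Fw : Λ → ℝ → 𝔤} {qv qw : Λ → ℝ → 𝔥}
    (hA : Continuous (uncurry A)) (hFv : Continuous (uncurry Fv)) (hFw : Continuous (uncurry Fw))
    (hqv : Continuous (uncurry qv)) (hqw : Continuous (uncurry qw)) :
    Continuous fun l => chenTwo C (A l) (Fv l) (Fw l) (qv l) (qw l) :=
  intervalIntegral.continuous_parametric_intervalIntegral_of_continuous'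
    (f := fun _ _ => _ - _)
    ((continuous_action_primitive C hA hFw hqv).sub (continuous_action_primitive C hA hFv hqw)) 0 1

theorem integral_action_integral {φ : ℝ → 𝔤} {b : ℝ → 𝔥} (hφ : Continuous φ) (hb : Continuous b) :
    ∫ σ in (0 : ℝ)..1, C.action (∫ r in σ..1, φ r) (b σ) =
      ∫ σ in (0 : ℝ)..1, C.action (φ σ) (∫ r in (0 : ℝ)..σ, b r) := by
  have h1 : ∀ σ, HasDerivAt (fun σ => ∫ r in σ..1, φ r) (-φ σ) σ := fun σ =>
    intervalIntegral.integral_hasDerivAt_left (hφ.intervalIntegrable _ _)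
      (hφ.stronglyMeasurableAtFilter _ _) hφ.continuousAt
  have h2 : ∀ σ, HasDerivAt (fun σ => ∫ r in (0 : ℝ)..σ, b r) (b σ) σ := fun σ =>
    intervalIntegral.integral_hasDerivAt_right (hb.intervalIntegrable _ _)
      (hb.stronglyMeasurableAtFilter _ _) hb.continuousAt
  have c1 : Continuous fun σ => ∫ r in σ..1, φ r :=
    continuous_iff_continuousAt.2 fun σ => (h1 σ).continuousAt
  have c2 : Continuous fun σ => ∫ r in (0 : ℝ)..σ, b r :=
    continuous_iff_continuousAt.2 fun σ => (h2 σ).continuousAt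
  have h : ∀ σ, HasDerivAt (fun σ => repCLM C.action (∫ r in σ..1, φ r) (∫ r in (0 : ℝ)..σ, b r))
      (C.action (∫ r in σ..1, φ r) (b σ) - C.action (φ σ) (∫ r in (0 : ℝ)..σ, b r)) σ := fun σ => by
    convert! ((repCLM C.action).hasFDerivAt.comp_hasDerivAt σ (h1 σ)).clm_apply (h2 σ) using 1
    simp [sub_eq_neg_add]
  have i1 := continuous_action C c1 hb
  have i2 := continuous_action C hφ c2
  have := intervalIntegral.integral_eq_sub_of_hasDerivAt (a := 0) (b := 1) (fun s _ => h s)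
    ((i1.sub i2).intervalIntegrable _ _)
  rw [intervalIntegral.integral_sub (i1.intervalIntegrable _ _) (i2.intervalIntegrable _ _)] at this
  simpa [sub_eq_zero] using this

theorem hasDerivAt_chenOne {As Al dAs dAl : ℝ → ℝ → 𝔤} {q dq : ℝ → ℝ → 𝔥}
    (hAs : Continuous (uncurry As)) (hAl : Continuous (uncurry Al))
    (hdAs : Continuous (uncurry dAs)) (hdAl : Continuous (uncurry dAl))
    (hq : Continuous (uncurry q)) (hdq : Continuous (uncurry dq))
    (h : ∀ l r, HasDerivAt (fun l => As l r) (dAs l r) l)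
    (h' : ∀ l r, HasDerivAt (fun r => Al l r) (dAl l r) r) (h1 : ∀ l, Al l 1 = 0)
    (h'' : ∀ l r, HasDerivAt (fun l => q l r) (dq l r) l) (l : ℝ) :
    HasDerivAt (fun l => chenOne C (As l) (q l))
      (chenOneVariation C (As l) (Al l) (fun r => dAl l r - dAs l r + ⁅As l r, Al l r⁆)
        (q l) (dq l)) l := by
  have hbr : Continuous (uncurry fun l r => ⁅As l r, Al l r⁆) :=
    ((repCLM (adjointAction 𝔤)).continuous.comp hAs).clm_apply hAl
  set F : ℝ → ℝ → 𝔤 := fun l r => dAl l r - dAs l r + ⁅As l r, Al l r⁆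
  have hF : Continuous (uncurry F) := (hdAl.sub hdAs).add hbr
  set φ : ℝ → ℝ → 𝔤 := fun l r => transport (adjointAction 𝔤) (As l) r (F l r)
  have hφ : Continuous (uncurry φ) := continuous_transport_apply _ hAs hF
  have hφi : Continuous (uncurry fun l σ => ∫ r in σ..1, φ l r) := by
    have := (intervalIntegral.continuous_parametric_primitive_of_continuous (μ := volume)
      (a₀ := (1 : ℝ)) hφ).fun_neg
    exact this.congr fun p => (intervalIntegral.integral_symm _ _).symm
  have hAsl : ∀ l, Continuous (As l) := fun l => by fun_prop
  have hd : ∀ l σ, HasDerivAt (fun l => transport C.action (As l) σ (q l σ))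
      (transport C.action (As l) σ (C.action (Al l σ) (q l σ) + dq l σ)
        + C.action (∫ r in σ..1, φ l r) (transport C.action (As l) σ (q l σ))) l := fun l σ => by
    have := (hasDerivAt_transport_param C.action (action_lie C) hAs (fun l => by fun_prop)
      hdAs (fun l => by fun_prop) h h' h1 l σ).clm_apply (h'' l σ)
    convert! this using 1
    have e : (∫ r in σ..1, transport C.action (As l) r *
          repCLM C.action (dAl l r - dAs l r + ⁅As l r, Al l r⁆) *
          transportInv C.action (As l) r) = repCLM C.action (∫ r in σ..1, φ l r) := by
      rw [← ContinuousLinearMap.intervalIntegral_comp_comm _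
        (Continuous.intervalIntegrable (by fun_prop) _ _)]
      exact intervalIntegral.integral_congr fun r _ => transport_action C (hAsl l) r _
    rw [e]
    simp only [map_add, _root_.add_apply, mul_apply_eq_comp, repCLM_apply]
    abel
  have cW : Continuous (uncurry fun l σ => transport C.action (As l) σ (q l σ)) :=
    continuous_transport_apply _ hAs hq
  have c1 : Continuous (uncurry fun l σ =>
      transport C.action (As l) σ (C.action (Al l σ) (q l σ) + dq l σ)) :=
    continuous_transport_apply C.action (q := fun l σ => C.action (Al l σ) (q l σ) + dq l σ) hAs
        ((continuous_action C hAl hq).add hdq)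
  have c2 : Continuous (uncurry fun l σ =>
      C.action (∫ r in σ..1, φ l r) (transport C.action (As l) σ (q l σ))) :=
    continuous_action C hφi cW
  have cl : ∀ {f : ℝ → ℝ → 𝔥}, Continuous (uncurry f) →
      ∀ l, Continuous (f l) := fun hf l => hf.comp (f := fun r : ℝ => (l, r)) (by fun_prop)
  have cφ : Continuous (φ l) := hφ.comp (f := fun r : ℝ => (l, r)) (by fun_prop)
  have c12 : Continuous (uncurry fun l σ =>
      transport C.action (As l) σ (C.action (Al l σ) (q l σ) + dq l σ) +
      C.action (∫ r in σ..1, φ l r) (transport C.action (As l) σ (q l σ))) := c1.fun_add c2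
  have := hasDerivAt_integral_param (cl cW) c12 hd 0 1 l
  convert! this using 1
  rw [chenOneVariation, intervalIntegral.integral_add
    ((cl c1 l).intervalIntegrable _ _) ((cl c2 l).intervalIntegrable _ _)]
  congr 1
  exact (integral_action_integral C cφ (cl cW l)).symm

/-- The curvature of the path space connection, evaluated on two variations along which the
exterior covariant derivative of the 2-form vanishes. -/
theorem chenOneVariation_sub_add_lie {As Av Aw Fv Fw : ℝ → 𝔤} {qv qw dqv dqw r dr : ℝ → 𝔥}
    (hAs : Continuous As) (hAv : Continuous Av) (hAw : Continuous Aw) (hFv : Continuous Fv)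
    (hFw : Continuous Fw) (hqv : Continuous qv) (hqw : Continuous qw) (hdqv : Continuous dqv)
    (hdqw : Continuous dqw) (hdr : Continuous dr) (hr : ∀ σ, HasDerivAt r (dr σ) σ)
    (hr0 : r 0 = 0) (hr1 : r 1 = 0)
    (hthin : ∀ σ ∈ Icc (0 : ℝ) 1, dr σ - dqw σ + dqv σ + C.action (As σ) (r σ)
      - C.action (Av σ) (qw σ) + C.action (Aw σ) (qv σ) = 0) :
    chenOneVariation C As Av Fv qw dqw - chenOneVariation C As Aw Fw qv dqv
      + ⁅chenOne C As qv, chenOne C As qw⁆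
      = - chenTwo C As (fun σ => Fv σ + C.dt (qv σ)) (fun σ => Fw σ + C.dt (qw σ)) qv qw := by
  have hW := continuous_transport_self C.action hAs
  have hWg := continuous_transport_self (adjointAction 𝔤) hAs
  have hrc : Continuous r := continuous_iff_continuousAt.2 fun s => (hr s).continuousAt
  set W := transport C.action As
  set Wg := transport (adjointAction 𝔤) As
  set P : (ℝ → 𝔥) → ℝ → 𝔥 := fun q σ => ∫ r in (0 : ℝ)..σ, W r (q r)
  have hP : ∀ q, Continuous q → ∀ σ, HasDerivAt (P q) (W σ (q σ)) σ := fun q hq σ =>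
    intervalIntegral.integral_hasDerivAt_right ((hW.clm_apply hq).intervalIntegrable _ _)
      ((hW.clm_apply hq).stronglyMeasurableAtFilter _ _) (hW.clm_apply hq).continuousAt
  have hPc : ∀ q, Continuous q → Continuous (P q) := fun q hq =>
    continuous_iff_continuousAt.2 fun s => (hP q hq s).continuousAt
  have hact : ∀ {f : ℝ → 𝔤} {g : ℝ → 𝔥}, Continuous f → Continuous g →
    Continuous fun x => C.action (f x) (g x) := fun hf hg => continuous_action C hf hg
  have hdtW : ∀ σ y, C.dt (W σ y) = Wg σ (C.dt y) := dt_transport C hAs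
  have hlie : ∀ σ x y, ⁅W σ x, y⁆ = C.action (Wg σ (C.dt x)) y := fun σ x y => by
    rw [← hdtW, action_dt]
  have cdt : ∀ {q : ℝ → 𝔥}, Continuous q → Continuous fun σ => C.dt (q σ) := fun hq =>
    (LinearMap.toContinuousLinearMap C.dt.toLinearMap).continuous.comp hq
  have hg1 : ∀ {f : ℝ → 𝔤} {q : ℝ → 𝔥}, Continuous f → Continuous q →
      Continuous fun σ => C.action (Wg σ (f σ)) (P q σ) := fun hf hq =>
    hact (hWg.clm_apply hf) (hPc _ hq)
  -- the bracket
  have hL : ⁅chenOne C As qv, chenOne C As qw⁆ =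
      ∫ σ in (0 : ℝ)..1, (C.action (Wg σ (C.dt (qv σ))) (P qw σ)
        - C.action (Wg σ (C.dt (qw σ))) (P qv σ)) := by
    have hd : ∀ σ, HasDerivAt (fun σ => repCLM (adjointAction 𝔥) (P qv σ) (P qw σ))
        (C.action (Wg σ (C.dt (qv σ))) (P qw σ) - C.action (Wg σ (C.dt (qw σ))) (P qv σ)) σ := by
      intro σ
      convert! ((repCLM (adjointAction 𝔥)).hasFDerivAt.comp_hasDerivAt σ (hP qv hqv σ)).clm_apply
        (hP qw hqw σ) using 1
      simp only [repCLM_apply, adjointAction_apply, Function.comp]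
      rw [← hlie, ← hlie, ← lie_skew (W σ (qw σ)) (P qv σ)]
      abel
    rw [intervalIntegral.integral_eq_sub_of_hasDerivAt (fun s _ => hd s)
      (((hg1 (cdt hqv) hqw).fun_sub (hg1 (cdt hqw) hqv)).intervalIntegrable _ _)]
    simp [P, chenOne, W]
  -- the total derivative
  have hT : (∫ σ in (0 : ℝ)..1, W σ (C.action (Av σ) (qw σ) + dqw σ))
      - (∫ σ in (0 : ℝ)..1, W σ (C.action (Aw σ) (qv σ) + dqv σ)) = 0 := by
    have hd : ∀ σ, HasDerivAt (fun σ => W σ (r σ)) (W σ (C.action (As σ) (r σ) + dr σ)) σ := by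
      intro σ
      convert! (hasDerivAt_transport C.action hAs σ).clm_apply (hr σ) using 1
      simp [W]
    have hc : Continuous fun σ => W σ (C.action (As σ) (r σ) + dr σ) :=
      hW.clm_apply ((hact hAs hrc).add hdr)
    have hi := intervalIntegral.integral_eq_sub_of_hasDerivAt (a := 0) (b := 1) (fun s _ => hd s)
      (hc.intervalIntegrable _ _)
    rw [hr0, hr1, map_zero, map_zero, sub_zero] at hi
    rw [← intervalIntegral.integral_sub
      ((hW.clm_apply ((hact hAv hqw).fun_add hdqw)).intervalIntegrable _ _)
      ((hW.clm_apply ((hact hAw hqv).fun_add hdqv)).intervalIntegrable _ _), ← hi]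
    refine intervalIntegral.integral_congr fun σ hσ => ?_
    rw [uIcc_of_le zero_le_one] at hσ
    have := hthin σ hσ
    simp only [← map_sub]
    congr 1
    rw [← sub_eq_zero, ← neg_eq_zero, ← this]
    abel
  simp only [chenOneVariation, chenTwo]
  rw [hL, add_sub_add_comm, hT, zero_add]
  change (∫ σ in (0 : ℝ)..1, C.action (Wg σ (Fv σ)) (P qw σ))
      - (∫ σ in (0 : ℝ)..1, C.action (Wg σ (Fw σ)) (P qv σ)) + _ =
    - ∫ σ in (0 : ℝ)..1, (C.action (Wg σ (Fw σ + C.dt (qw σ))) (P qv σ) -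
      C.action (Wg σ (Fv σ + C.dt (qv σ))) (P qw σ))
  rw [← intervalIntegral.integral_sub ((hg1 hFv hqw).intervalIntegrable _ _)
      ((hg1 hFw hqv).intervalIntegrable _ _),
    ← intervalIntegral.integral_add
      (((hg1 hFv hqw).fun_sub (hg1 hFw hqv)).intervalIntegrable _ _)
      (((hg1 (cdt hqv) hqw).fun_sub (hg1 (cdt hqw) hqv)).intervalIntegrable _ _),
    ← intervalIntegral.integral_neg]
  refine intervalIntegral.integral_congr fun σ _ => ?_
  simp only [map_add, LinearMap.add_apply]
  abel

end CrossedModule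

/-! ### A Lie group in the chart at the identity -/

section LieGroupChart

variable {m : ℕ} {H : Type*} [TopologicalSpace H] [ChartedSpace (EuclideanSpace ℝ (Fin m)) H]
  [Group H]

local notation "𝔼" => EuclideanSpace ℝ (Fin m)

variable (m H) in
/-- The preferred chart at the identity. -/
noncomputable def chartOne : PartialEquiv H (EuclideanSpace ℝ (Fin m)) := extChartAt (𝓡 m) (1 : H)

variable (m H) in
/-- The image of the identity in the preferred chart. -/
noncomputable def chartBase : EuclideanSpace ℝ (Fin m) := chartOne m H 1

variable (m H) in
/-- The multiplication in the preferred chart at the identity. -/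
noncomputable def chartMul (p : 𝔼 × 𝔼) : 𝔼 :=
  chartOne m H ((chartOne m H).symm p.1 * (chartOne m H).symm p.2)

variable (m H) in
/-- The left invariant vector fields in the chart. -/
noncomputable def leftField (y : 𝔼) : 𝔼 →L[ℝ] 𝔼 :=
  (fderiv ℝ (chartMul m H) (y, chartBase m H)).comp (ContinuousLinearMap.inr ℝ 𝔼 𝔼)

variable (m H) in
/-- The right invariant vector fields in the chart. -/
noncomputable def rightField (y : 𝔼) : 𝔼 →L[ℝ] 𝔼 :=
  (fderiv ℝ (chartMul m H) (chartBase m H, y)).comp (ContinuousLinearMap.inl ℝ 𝔼 𝔼)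

theorem one_mem_chartOne : (1 : H) ∈ (chartOne m H).source := mem_extChartAt_source _

theorem chartBase_mem : chartBase m H ∈ (chartOne m H).target := mem_extChartAt_target _

@[simp]
theorem chartOne_symm_base : (chartOne m H).symm (chartBase m H) = 1 :=
  (chartOne m H).left_inv one_mem_chartOne

theorem isOpen_chartOne_target : IsOpen (chartOne m H).target := isOpen_extChartAt_target _

theorem isOpen_chartOne_source : IsOpen (chartOne m H).source := isOpen_extChartAt_source _

theorem chartMul_base_right {y : 𝔼} (hy : y ∈ (chartOne m H).target) :
    chartMul m H (y, chartBase m H) = y := by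
  simp [chartMul, (chartOne m H).right_inv hy]

theorem chartMul_base_left {y : 𝔼} (hy : y ∈ (chartOne m H).target) :
    chartMul m H (chartBase m H, y) = y := by
  simp [chartMul, (chartOne m H).right_inv hy]

variable [LieGroup (𝓡 m) ∞ H]

theorem contMDiffAt_chartOne_symm {y : 𝔼} (hy : y ∈ (chartOne m H).target) :
    ContMDiffAt 𝓘(ℝ, 𝔼) (𝓡 m) ∞ (chartOne m H).symm y :=
  (contMDiffOn_extChartAt_symm (1 : H)).contMDiffAt (isOpen_chartOne_target.mem_nhds hy)

theorem contMDiffAt_chartOne {g : H} (hg : g ∈ (chartOne m H).source) :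
    ContMDiffAt (𝓡 m) 𝓘(ℝ, 𝔼) ∞ (chartOne m H) g :=
  contMDiffAt_extChartAt' (by rwa [← extChartAt_source (𝓡 m)])

theorem contDiffAt_chartOne_comp {E' : Type*} [NormedAddCommGroup E'] [NormedSpace ℝ E']
    {F : E' → H} {p : E'} (hF : ContMDiffAt 𝓘(ℝ, E') (𝓡 m) ∞ F p)
    (hp : F p ∈ (chartOne m H).source) : ContDiffAt ℝ ∞ (fun q => chartOne m H (F q)) p :=
  contMDiffAt_iff_contDiffAt.1 ((contMDiffAt_chartOne hp).comp p hF)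

theorem contDiffAt_chartMul {p : 𝔼 × 𝔼} (h1 : p.1 ∈ (chartOne m H).target)
    (h2 : p.2 ∈ (chartOne m H).target)
    (h : (chartOne m H).symm p.1 * (chartOne m H).symm p.2 ∈ (chartOne m H).source) :
    ContDiffAt ℝ ∞ (chartMul m H) p := by
  refine contDiffAt_chartOne_comp (F := fun p : 𝔼 × 𝔼 =>
    (chartOne m H).symm p.1 * (chartOne m H).symm p.2) ?_ h
  have e1 : ContMDiffAt 𝓘(ℝ, 𝔼 × 𝔼) 𝓘(ℝ, 𝔼) ∞ (Prod.fst : 𝔼 × 𝔼 → 𝔼) p :=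
    contMDiffAt_iff_contDiffAt.2 contDiffAt_fst
  have e2 : ContMDiffAt 𝓘(ℝ, 𝔼 × 𝔼) 𝓘(ℝ, 𝔼) ∞ (Prod.snd : 𝔼 × 𝔼 → 𝔼) p :=
    contMDiffAt_iff_contDiffAt.2 contDiffAt_snd
  exact ((contMDiffAt_chartOne_symm h1).comp p e1).mul ((contMDiffAt_chartOne_symm h2).comp p e2)

theorem contDiffAt_chartMul_right {y : 𝔼} (hy : y ∈ (chartOne m H).target) :
    ContDiffAt ℝ ∞ (chartMul m H) (y, chartBase m H) :=
  contDiffAt_chartMul hy chartBase_mem (by simpa using (chartOne m H).map_target hy)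

theorem contDiffAt_chartMul_left {y : 𝔼} (hy : y ∈ (chartOne m H).target) :
    ContDiffAt ℝ ∞ (chartMul m H) (chartBase m H, y) :=
  contDiffAt_chartMul chartBase_mem hy (by simpa using (chartOne m H).map_target hy)

theorem contDiffAt_leftField {y : 𝔼} (hy : y ∈ (chartOne m H).target) :
    ContDiffAt ℝ ∞ (leftField m H) y := by
  have h1 : ContDiffAt ℝ ∞ (fderiv ℝ (chartMul m H)) (y, chartBase m H) :=
    (contDiffAt_chartMul_right hy).fderiv_right (m := ∞) (by simp)
  have h2 : ContDiffAt ℝ ∞ (fun y => fderiv ℝ (chartMul m H) (y, chartBase m H)) y :=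
    h1.comp y (f := fun y => (y, chartBase m H)) (contDiffAt_id.prodMk contDiffAt_const)
  exact h2.clm_comp contDiffAt_const

theorem contDiffAt_rightField {y : 𝔼} (hy : y ∈ (chartOne m H).target) :
    ContDiffAt ℝ ∞ (rightField m H) y := by
  have h1 : ContDiffAt ℝ ∞ (fderiv ℝ (chartMul m H)) (chartBase m H, y) :=
    (contDiffAt_chartMul_left hy).fderiv_right (m := ∞) (by simp)
  have h2 : ContDiffAt ℝ ∞ (fun y => fderiv ℝ (chartMul m H) (chartBase m H, y)) y :=
    h1.comp y (f := fun y => (chartBase m H, y)) (contDiffAt_const.prodMk contDiffAt_id)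
  exact h2.clm_comp contDiffAt_const

theorem hasFDerivAt_leftField {y : 𝔼} (hy : y ∈ (chartOne m H).target) :
    HasFDerivAt (fun q => chartMul m H (y, q)) (leftField m H y) (chartBase m H) := by
  have h := ((contDiffAt_chartMul_right hy).differentiableAt (by simp)).hasFDerivAt
  exact h.comp (chartBase m H) (f := fun q => (y, q)) (hasFDerivAt_prodMk_right y _)

theorem hasFDerivAt_rightField {y : 𝔼} (hy : y ∈ (chartOne m H).target) :
    HasFDerivAt (fun q => chartMul m H (q, y)) (rightField m H y) (chartBase m H) := by
  have h := ((contDiffAt_chartMul_left hy).differentiableAt (by simp)).hasFDerivAt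
  exact h.comp (chartBase m H) (f := fun q => (q, y)) (hasFDerivAt_prodMk_left _ y)

theorem hasFDerivAt_chartMul_left_slot {y : 𝔼} (hy : y ∈ (chartOne m H).target) :
    HasFDerivAt (fun q => chartMul m H (q, chartBase m H)) (ContinuousLinearMap.id ℝ 𝔼) y := by
  refine (hasFDerivAt_id y).congr_of_eventuallyEq ?_
  filter_upwards [isOpen_chartOne_target.mem_nhds hy] with z hz
  exact chartMul_base_right hz

theorem leftField_base : leftField m H (chartBase m H) = ContinuousLinearMap.id ℝ 𝔼 := by
  refine (hasFDerivAt_leftField chartBase_mem).unique ?_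
  refine (hasFDerivAt_id _).congr_of_eventuallyEq ?_
  filter_upwards [isOpen_chartOne_target.mem_nhds chartBase_mem] with z hz
  exact chartMul_base_left hz

theorem rightField_base : rightField m H (chartBase m H) = ContinuousLinearMap.id ℝ 𝔼 :=
  (hasFDerivAt_rightField chartBase_mem).unique (hasFDerivAt_chartMul_left_slot chartBase_mem)

theorem fderiv_rightField_base (ξ z : 𝔼) :
    fderiv ℝ (rightField m H) (chartBase m H) ξ z = fderiv ℝ (leftField m H) (chartBase m H) z ξ := by
  set e := chartBase m H
  have hc : ContDiffAt ℝ ∞ (chartMul m H) (e, e) := contDiffAt_chartMul_left chartBase_mem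
  have hd : HasFDerivAt (fderiv ℝ (chartMul m H)) (fderiv ℝ (fderiv ℝ (chartMul m H)) (e, e)) (e, e) :=
    ((hc.fderiv_right (m := ∞) (by simp)).differentiableAt (by simp)).hasFDerivAt
  have hsymm : IsSymmSndFDerivAt ℝ (chartMul m H) (e, e) :=
    hc.isSymmSndFDerivAt (by
      rw [minSmoothness_of_isRCLikeNormedField]
      exact ENat.LEInfty.out)
  have h1 : HasFDerivAt (rightField m H) _ e :=
    (hd.comp e (f := fun y => (e, y)) (hasFDerivAt_prodMk_right e e)).clm_comp
      (hasFDerivAt_const (ContinuousLinearMap.inl ℝ 𝔼 𝔼) e)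
  have h2 : HasFDerivAt (leftField m H) _ e :=
    (hd.comp e (f := fun y => (y, e)) (hasFDerivAt_prodMk_left e e)).clm_comp
      (hasFDerivAt_const (ContinuousLinearMap.inr ℝ 𝔼 𝔼) e)
  rw [h1.fderiv, h2.fderiv]
  simpa using hsymm.eq (0, ξ) (z, 0)

/-! ### Logarithmic derivatives of curves -/

theorem hasFDerivAt_translate {y : 𝔼} (hy : y ∈ (chartOne m H).target) :
    ∃ N : 𝔼 →L[ℝ] 𝔼, HasFDerivAt
      (fun q => chartOne m H (((chartOne m H).symm y)⁻¹ * (chartOne m H).symm q)) N y ∧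
      ∀ x, N (leftField m H y x) = x := by
  have h0 : ((chartOne m H).symm y)⁻¹ * (chartOne m H).symm y ∈ (chartOne m H).source := by
    simpa using one_mem_chartOne
  have hN : ContDiffAt ℝ ∞
      (fun q => chartOne m H (((chartOne m H).symm y)⁻¹ * (chartOne m H).symm q)) y :=
    contDiffAt_chartOne_comp (contMDiffAt_const.mul (contMDiffAt_chartOne_symm hy)) h0
  have hN' := (hN.differentiableAt (by simp)).hasFDerivAt
  refine ⟨_, hN', fun x => ?_⟩
  have h1 := chartMul_base_right (m := m) (H := H) hy
  have h2 := HasFDerivAt.comp (chartBase m H) (g := fun q =>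
    chartOne m H (((chartOne m H).symm y)⁻¹ * (chartOne m H).symm q)) (by rw [h1]; exact hN')
    (hasFDerivAt_leftField hy)
  have h3 : HasFDerivAt (fun q => q) (ContinuousLinearMap.id ℝ 𝔼) (chartBase m H) :=
    hasFDerivAt_id _
  have h4 := h2.unique (h3.congr_of_eventuallyEq ?_)
  · have := congrArg (fun T => T x) h4
    exact this
  · have hO : ∀ᶠ q in 𝓝 (chartBase m H),
        (chartOne m H).symm y * (chartOne m H).symm q ∈ (chartOne m H).source := by
      have hc : ContinuousAt (fun q => (chartOne m H).symm y * (chartOne m H).symm q)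
          (chartBase m H) :=
        (contMDiffAt_const.mul (contMDiffAt_chartOne_symm chartBase_mem)).continuousAt
      refine hc.eventually (isOpen_chartOne_source.mem_nhds ?_)
      simpa using (chartOne m H).map_target hy
    filter_upwards [hO, isOpen_chartOne_target.mem_nhds chartBase_mem] with q hq hq'
    simp only [Function.comp, chartMul]
    rw [(chartOne m H).left_inv hq, inv_mul_cancel_left, (chartOne m H).right_inv hq']

/-- The curve `w` has left logarithmic derivative `x` at `τ`, within `s`. -/
def HasLogDerivWithinAt (w : ℝ → H) (x : 𝔼) (s : Set ℝ) (τ : ℝ) : Prop :=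
  ContinuousWithinAt w s τ ∧
    HasDerivWithinAt (fun r => chartOne m H ((w τ)⁻¹ * w r)) x s τ

theorem hasMFDerivAt_chartOne_symm {y : 𝔼} (hy : y ∈ (chartOne m H).target) :
    HasMFDerivAt 𝓘(ℝ, 𝔼) (𝓡 m) (chartOne m H).symm y
      (mfderiv 𝓘(ℝ, 𝔼) (𝓡 m) (chartOne m H).symm y) :=
  ((contMDiffAt_chartOne_symm hy).mdifferentiableAt (by simp)).hasMFDerivAt

theorem hasMFDerivAt_mul_left (g h : H) :
    HasMFDerivAt (𝓡 m) (𝓡 m) (g * ·) h (mfderiv (𝓡 m) (𝓡 m) (g * ·) h) :=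
  ((contMDiff_mul_left (I := 𝓡 m) (n := ∞) (a := g)).mdifferentiableAt (by simp)).hasMFDerivAt

theorem mfderiv_chartOne_symm_base (v : 𝔼) :
    mfderiv 𝓘(ℝ, 𝔼) (𝓡 m) (chartOne m H).symm (chartBase m H) v = v := by
  have h := mfderivWithin_range_extChartAt_symm (I := 𝓡 m) (x := (1 : H))
  rw [ModelWithCorners.Boundaryless.range_eq_univ, mfderivWithin_univ] at h
  exact congrArg (fun T => T v) h

theorem hasMFDerivAt_mul_chartOne_symm (g : H) :
    HasMFDerivAt 𝓘(ℝ, 𝔼) (𝓡 m) (fun q => g * (chartOne m H).symm q) (chartBase m H)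
      (mfderiv (𝓡 m) (𝓡 m) (g * ·) (1 : H) : 𝔼 →L[ℝ] 𝔼) := by
  have h1 := hasMFDerivAt_chartOne_symm (m := m) (H := H) chartBase_mem
  have h2 : HasMFDerivAt (𝓡 m) (𝓡 m) (g * ·) ((chartOne m H).symm (chartBase m H))
      (mfderiv (𝓡 m) (𝓡 m) (g * ·) (1 : H) : 𝔼 →L[ℝ] 𝔼) := by
    rw [chartOne_symm_base]
    exact hasMFDerivAt_mul_left g 1
  refine (h2.comp (chartBase m H) h1).congr_mfderiv ?_
  refine ContinuousLinearMap.ext fun v => ?_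
  exact congrArg (mfderiv (𝓡 m) (𝓡 m) (g * ·) (1 : H) : 𝔼 →L[ℝ] 𝔼)
    (mfderiv_chartOne_symm_base v)

theorem mfderiv_mul_left_eq_leftField {y : 𝔼} (hy : y ∈ (chartOne m H).target) (v : 𝔼) :
    (mfderiv (𝓡 m) (𝓡 m) ((chartOne m H).symm y * ·) (1 : H) : 𝔼 →L[ℝ] 𝔼) v =
      (mfderiv 𝓘(ℝ, 𝔼) (𝓡 m) (chartOne m H).symm y : 𝔼 →L[ℝ] 𝔼) (leftField m H y v) := by
  have h1 := hasMFDerivAt_mul_chartOne_symm (m := m) ((chartOne m H).symm y)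
  have hb := chartMul_base_right (m := m) (H := H) hy
  have h2 : HasMFDerivAt 𝓘(ℝ, 𝔼) (𝓡 m) (chartOne m H).symm (chartMul m H (y, chartBase m H))
      (mfderiv 𝓘(ℝ, 𝔼) (𝓡 m) (chartOne m H).symm y : 𝔼 →L[ℝ] 𝔼) := by
    rw [hb]; exact hasMFDerivAt_chartOne_symm hy
  have h3 := h2.comp (chartBase m H) (f := fun q => chartMul m H (y, q))
    (hasMFDerivAt_iff_hasFDerivAt.2 (hasFDerivAt_leftField hy))
  have h4 : HasMFDerivAt 𝓘(ℝ, 𝔼) (𝓡 m) ((chartOne m H).symm ∘ fun q => chartMul m H (y, q))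
      (chartBase m H) (mfderiv (𝓡 m) (𝓡 m) ((chartOne m H).symm y * ·) (1 : H) : 𝔼 →L[ℝ] 𝔼) := by
    have hO : ∀ᶠ q in 𝓝 (chartBase m H),
        (chartOne m H).symm y * (chartOne m H).symm q ∈ (chartOne m H).source := by
      refine h1.continuousAt.eventually (isOpen_chartOne_source.mem_nhds ?_)
      simpa using (chartOne m H).map_target hy
    have hEq : ((chartOne m H).symm ∘ fun q => chartMul m H (y, q)) =ᶠ[𝓝 (chartBase m H)]
        fun q => (chartOne m H).symm y * (chartOne m H).symm q := by
      filter_upwards [hO] with q hq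
      exact (chartOne m H).left_inv hq
    exact h1.congr_of_eventuallyEq hEq
  exact congrArg (fun T : 𝔼 →L[ℝ] 𝔼 => T v) (hasMFDerivAt_unique h4 h3)

theorem hasLogDerivWithinAt_iff {w : ℝ → H} {x : 𝔼} {s : Set ℝ} {τ : ℝ} :
    HasLogDerivWithinAt w x s τ ↔
      HasMFDerivWithinAt 𝓘(ℝ, ℝ) (𝓡 m) w s τ
        (ContinuousLinearMap.toSpanSingleton ℝ
          (mfderiv (𝓡 m) (𝓡 m) (w τ * ·) (1 : H) x : 𝔼) : ℝ →L[ℝ] 𝔼) := by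
  constructor
  · rintro ⟨hc, hd⟩
    have hb : chartOne m H ((w τ)⁻¹ * w τ) = chartBase m H := by simp [chartBase]
    have h1 : HasMFDerivAt 𝓘(ℝ, 𝔼) (𝓡 m) (fun q => w τ * (chartOne m H).symm q)
        (chartOne m H ((w τ)⁻¹ * w τ)) (mfderiv (𝓡 m) (𝓡 m) (w τ * ·) (1 : H) : 𝔼 →L[ℝ] 𝔼) := by
      rw [hb]; exact hasMFDerivAt_mul_chartOne_symm (w τ)
    have h2 := h1.comp_hasMFDerivWithinAt τ (hasMFDerivWithinAt_iff_hasFDerivWithinAt.2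
      hd.hasFDerivWithinAt)
    have h3 := h2.congr_of_eventuallyEq (f₁ := w) ?_ ?_
    · refine h3.congr_mfderiv (ContinuousLinearMap.ext fun (c : ℝ) => ?_)
      exact (map_smul (mfderiv (𝓡 m) (𝓡 m) (w τ * ·) (1 : H) : 𝔼 →L[ℝ] 𝔼) c x)
    · have hc' : ContinuousWithinAt (fun r => (w τ)⁻¹ * w r) s τ :=
        ((contMDiff_mul_left (I := 𝓡 m) (n := ∞) (a := (w τ)⁻¹)).continuous.continuousAt).comp_continuousWithinAt hc
      have := hc'.eventually (isOpen_chartOne_source (m := m).mem_nhds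
        (by simpa using one_mem_chartOne))
      filter_upwards [this] with r hr
      simp [(chartOne m H).left_inv hr]
    · simp [(chartOne m H).left_inv one_mem_chartOne]
  · intro h
    refine ⟨h.continuousWithinAt, ?_⟩
    have hs : (w τ)⁻¹ * w τ ∈ (chartOne m H).source := by simpa using one_mem_chartOne
    have h1 : HasMFDerivAt (𝓡 m) 𝓘(ℝ, 𝔼) (fun h => chartOne m H ((w τ)⁻¹ * h)) (w τ)
        (mfderiv (𝓡 m) 𝓘(ℝ, 𝔼) (fun h => chartOne m H ((w τ)⁻¹ * h)) (w τ)) :=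
      (((contMDiffAt_chartOne hs).comp (w τ)
        (contMDiff_mul_left (I := 𝓡 m) (n := ∞) (a := (w τ)⁻¹)).contMDiffAt).mdifferentiableAt
          (by simp)).hasMFDerivAt
    set L : 𝔼 →L[ℝ] 𝔼 := mfderiv (𝓡 m) 𝓘(ℝ, 𝔼) (fun h => chartOne m H ((w τ)⁻¹ * h)) (w τ)
    have h2 : L ((mfderiv (𝓡 m) (𝓡 m) (w τ * ·) (1 : H) : 𝔼 →L[ℝ] 𝔼) x) = x := by
      have h1' : HasMFDerivAt (𝓡 m) 𝓘(ℝ, 𝔼) (fun h => chartOne m H ((w τ)⁻¹ * h)) (w τ * 1)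
        L := by rw [mul_one]; exact h1
      have h3 := h1'.comp (1 : H) (hasMFDerivAt_mul_left (w τ) 1)
      have h4 : HasMFDerivAt (𝓡 m) 𝓘(ℝ, 𝔼) (chartOne m H) (1 : H)
          (ContinuousLinearMap.id ℝ 𝔼) := by
        refine (((contMDiffAt_chartOne one_mem_chartOne).mdifferentiableAt
          (by simp)).hasMFDerivAt).congr_mfderiv ?_
        exact mfderiv_extChartAt_self
      have h5 := h4.congr_of_eventuallyEq
        (f₁ := (fun h => chartOne m H ((w τ)⁻¹ * h)) ∘ (w τ * ·))
        (Filter.Eventually.of_forall fun h => by simp)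
      exact congrArg (fun T : 𝔼 →L[ℝ] 𝔼 => T x) (hasMFDerivAt_unique h3 h5)
    have h6 : HasFDerivWithinAt (fun r => chartOne m H ((w τ)⁻¹ * w r))
        (L.comp (ContinuousLinearMap.toSpanSingleton ℝ
          ((mfderiv (𝓡 m) (𝓡 m) (w τ * ·) (1 : H) : 𝔼 →L[ℝ] 𝔼) x))) s τ :=
      hasMFDerivWithinAt_iff_hasFDerivWithinAt.1 (h1.comp_hasMFDerivWithinAt τ h)
    have h7 := h6.hasDerivWithinAt
    convert! h7 using 1
    refine h2.symm.trans (congrArg L ?_)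
    exact (one_smul ℝ _).symm

theorem bracket_groupLieAlgebra (x z : GroupLieAlgebra (𝓡 m) H) :
    (⁅x, z⁆ : GroupLieAlgebra (𝓡 m) H) =
      (fderiv ℝ (leftField m H) (chartBase m H) x z
        - fderiv ℝ (leftField m H) (chartBase m H) z x : 𝔼) := by
  have hcb : (chartOne m H) 1 = chartBase m H := rfl
  have hV : ∀ v : 𝔼, ∀ y ∈ (chartOne m H).target,
      VectorField.mpullbackWithin 𝓘(ℝ, 𝔼) (𝓡 m) (extChartAt (𝓡 m) (1 : H)).symm
        (mulInvariantVectorField (I := 𝓡 m) (v : GroupLieAlgebra (𝓡 m) H)) (range (𝓡 m)) y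
      = leftField m H y v := by
    intro v y hy
    have h := mfderiv_mul_left_eq_leftField (m := m) (H := H) hy v
    have hi := isInvertible_mfderivWithin_extChartAt_symm (I := 𝓡 m) (x := (1 : H)) hy
    rw [VectorField.mpullbackWithin_apply]
    refine (hi.inverse_apply_eq).2 ?_
    rw [ModelWithCorners.Boundaryless.range_eq_univ, mfderivWithin_univ]
    exact h
  have hd : ∀ v : 𝔼, HasFDerivAt (fun y => leftField m H y v)
      ((fderiv ℝ (leftField m H) (chartBase m H)).flip v) (chartBase m H) := fun v => by
    have := ((contDiffAt_leftField (m := m) (H := H) chartBase_mem).differentiableAt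
      (by simp)).hasFDerivAt
    convert! this.clm_apply (hasFDerivAt_const v _) using 1
    ext; simp
  have he : ∀ v : 𝔼, VectorField.mpullbackWithin 𝓘(ℝ, 𝔼) (𝓡 m) (extChartAt (𝓡 m) (1 : H)).symm
        (mulInvariantVectorField (I := 𝓡 m) (v : GroupLieAlgebra (𝓡 m) H)) (range (𝓡 m))
      =ᶠ[𝓝 (chartBase m H)] fun y => leftField m H y v := fun v => by
    filter_upwards [isOpen_chartOne_target.mem_nhds chartBase_mem] with y hy
    exact hV v y hy
  rw [GroupLieAlgebra.bracket_def, ← VectorField.mlieBracketWithin_univ,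
    VectorField.mlieBracketWithin_apply, mfderiv_extChartAt_self]
  have h1 : ∀ v : 𝔼, (ContinuousLinearMap.id ℝ 𝔼).inverse v = v := fun v => by simp
  refine (h1 _).trans ?_
  rw [ModelWithCorners.Boundaryless.range_eq_univ, preimage_univ, univ_inter]
  have hx := he x
  have hz := he z
  rw [ModelWithCorners.Boundaryless.range_eq_univ] at hx hz
  refine (Filter.EventuallyEq.lieBracketWithin_vectorField_eq_of_mem (𝕜 := ℝ) (s := univ)
    (V := fun y => leftField m H y x) (W := fun y => leftField m H y z)
    (by rw [nhdsWithin_univ]; exact hx) (by rw [nhdsWithin_univ]; exact hz) (mem_univ _)).trans ?_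
  rw [VectorField.lieBracketWithin_univ]
  change VectorField.lieBracket ℝ _ _ (chartBase m H) = _
  have hb : ∀ v : 𝔼, leftField m H (chartBase m H) v = v := fun v => by rw [leftField_base]; rfl
  rw [VectorField.lieBracket, (hd x).fderiv, (hd z).fderiv]
  set D := fderiv ℝ (leftField m H) (chartBase m H)
  exact congrArg₂ (fun a b : 𝔼 => (D.flip z) a - (D.flip x) b) (hb x) (hb z)

end LieGroupChart

/-! ### Ordinary differential equations on a Lie group -/

section LieGroupODE

variable {m : ℕ} {H : Type*} [TopologicalSpace H] [ChartedSpace (EuclideanSpace ℝ (Fin m)) H]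
  [Group H]

local notation "𝔼" => EuclideanSpace ℝ (Fin m)

theorem HasLogDerivWithinAt.congr {w v : ℝ → H} {x : 𝔼} {s : Set ℝ} {τ : ℝ}
    (h : HasLogDerivWithinAt w x s τ) (hs : ∀ r ∈ s, v r = w r) (hτ : v τ = w τ) :
    HasLogDerivWithinAt v x s τ := by
  refine ⟨h.1.congr hs hτ, h.2.congr (fun r hr => ?_) ?_⟩
  · rw [hs r hr, hτ]
  · rw [hτ]

theorem HasLogDerivWithinAt.union {w : ℝ → H} {x : 𝔼} {s t : Set ℝ} {τ : ℝ}
    (hs : HasLogDerivWithinAt w x s τ) (ht : HasLogDerivWithinAt w x t τ) :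
    HasLogDerivWithinAt w x (s ∪ t) τ :=
  ⟨hs.1.union ht.1, hs.2.union ht.2⟩

theorem hasLogDerivWithinAt_of_notMem_closure {w : ℝ → H} {x : 𝔼} {s : Set ℝ} {τ : ℝ}
    (h : τ ∉ closure s) : HasLogDerivWithinAt w x s τ := by
  refine ⟨?_, HasFDerivWithinAt.of_notMem_closure h⟩
  rw [mem_closure_iff_nhdsWithin_neBot, Filter.not_neBot] at h
  rw [ContinuousWithinAt, h]
  exact Filter.tendsto_bot

variable [LieGroup (𝓡 m) ∞ H]

theorem HasLogDerivWithinAt.const_mul {w : ℝ → H} {x : 𝔼} {s : Set ℝ} {τ : ℝ}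
    (h : HasLogDerivWithinAt w x s τ) (g : H) :
    HasLogDerivWithinAt (fun r => g * w r) x s τ := by
  refine ⟨(contMDiff_mul_left (I := 𝓡 m) (n := ∞) (a := g)).continuous.continuousAt.comp_continuousWithinAt h.1, ?_⟩
  have : (fun r => chartOne m H ((g * w τ)⁻¹ * (g * w r))) =
      fun r => chartOne m H ((w τ)⁻¹ * w r) := by
    funext r; congr 1; group
  rw [this]
  exact h.2

/-- A solution in the chart of the equation of the left invariant fields. -/
theorem HasDerivWithinAt.hasLogDerivWithinAt {y : ℝ → 𝔼} {x : 𝔼} {s : Set ℝ} {τ : ℝ}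
    (h : HasDerivWithinAt y (leftField m H (y τ) x) s τ) (hy : y τ ∈ (chartOne m H).target) :
    HasLogDerivWithinAt (fun r => (chartOne m H).symm (y r)) x s τ := by
  refine ⟨(contMDiffAt_chartOne_symm hy).continuousAt.comp_continuousWithinAt
    h.continuousWithinAt, ?_⟩
  obtain ⟨N, hN, hNx⟩ := hasFDerivAt_translate (m := m) (H := H) hy
  have := hN.comp_hasDerivWithinAt τ h
  rwa [hNx] at this

variable (m H) in
theorem exists_lipschitzOnWith_leftField_rightField : ∃ r > 0, ∃ K : NNReal,
    Metric.closedBall (chartBase m H) r ⊆ (chartOne m H).target ∧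
    LipschitzOnWith K (leftField m H) (Metric.closedBall (chartBase m H) r) ∧
    LipschitzOnWith K (rightField m H) (Metric.closedBall (chartBase m H) r) := by
  obtain ⟨K1, t1, ht1, h1⟩ := ((contDiffAt_leftField (m := m) (H := H)
    chartBase_mem).of_le (m := 1) (by simp)).exists_lipschitzOnWith
  obtain ⟨K2, t2, ht2, h2⟩ := ((contDiffAt_rightField (m := m) (H := H)
    chartBase_mem).of_le (m := 1) (by simp)).exists_lipschitzOnWith
  obtain ⟨r, hr, hsub⟩ := Metric.nhds_basis_closedBall.mem_iff.1
    (Filter.inter_mem (isOpen_chartOne_target.mem_nhds (chartBase_mem (m := m) (H := H)))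
      (Filter.inter_mem ht1 ht2))
  exact ⟨r, hr, max K1 K2, fun y hy => (hsub hy).1,
    (h1.mono fun y hy => (hsub hy).2.1).weaken (le_max_left _ _),
    (h2.mono fun y hy => (hsub hy).2.2).weaken (le_max_right _ _)⟩

theorem exists_logDeriv_of_short {f : ℝ → 𝔼} (hf : Continuous f) : ∃ δ > 0, ∀ a b : ℝ,
    0 ≤ a → a ≤ b → b ≤ 1 → b ≤ a + δ → ∃ w : ℝ → H, w a = 1 ∧
      ∀ τ ∈ Icc a b, HasLogDerivWithinAt w (f τ) (Icc a b) τ := by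
  obtain ⟨r, hr, K, hsub, hL, -⟩ := exists_lipschitzOnWith_leftField_rightField m H
  obtain ⟨M, hM⟩ := (isCompact_Icc (a := (0 : ℝ)) (b := 1)).exists_bound_of_continuousOn
    hf.continuousOn
  have hM0 : 0 ≤ M := (norm_nonneg _).trans (hM 0 (by simp))
  set M' : NNReal := ⟨M, hM0⟩
  set R : NNReal := ⟨r, hr.le⟩
  set e := chartBase m H
  set C : NNReal := (1 + K * R) * M' + 1
  have hCpos : (0 : ℝ) < C := by positivity
  have hLb : ∀ y ∈ Metric.closedBall e r, ‖leftField m H y‖ ≤ 1 + K * r := by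
    intro y hy
    have h1 := hL.dist_le_mul y hy e (Metric.mem_closedBall_self hr.le)
    rw [dist_eq_norm] at h1
    have h2 : ‖leftField m H e‖ ≤ 1 := by
      rw [leftField_base]; exact ContinuousLinearMap.norm_id_le
    have h3 : dist y e ≤ r := hy
    calc ‖leftField m H y‖ = ‖leftField m H e + (leftField m H y - leftField m H e)‖ := by abel_nf
      _ ≤ ‖leftField m H e‖ + ‖leftField m H y - leftField m H e‖ := norm_add_le _ _
      _ ≤ 1 + K * r := by gcongr; exact h1.trans (by gcongr)
  refine ⟨r / C, by positivity, fun a b ha hab hb hδ => ?_⟩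
  have ht : ∀ t ∈ Icc a b, ‖f t‖ ≤ M := fun t ht => hM t ⟨ha.trans ht.1, ht.2.trans hb⟩
  have hP : IsPicardLindelof (fun t y => leftField m H y (f t))
      (⟨a, left_mem_Icc.2 hab⟩ : Icc a b) e R 0 C (K * M') := by
    refine ⟨fun t htt => ?_, fun x hx => ?_, fun t htt x hx => ?_, ?_⟩
    · refine LipschitzOnWith.of_dist_le_mul fun x hx y hy => ?_
      rw [dist_eq_norm, ← sub_apply]
      refine (ContinuousLinearMap.le_opNorm _ _).trans ?_
      have := hL.dist_le_mul x hx y hy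
      rw [dist_eq_norm] at this
      calc _ ≤ (K * dist x y) * M := by gcongr; exact ht t htt
        _ = _ := by push_cast; change _ = (K * M) * _; ring
    · fun_prop
    · refine (ContinuousLinearMap.le_opNorm _ _).trans ?_
      calc _ ≤ (1 + K * r) * M := by gcongr; exacts [hLb x hx, ht t htt]
        _ ≤ C := by change _ ≤ (1 + K * r) * M + 1; linarith
    · simp only [sub_self, NNReal.coe_zero, sub_zero]
      rw [max_eq_left (by linarith)]
      change _ ≤ r
      calc (C : ℝ) * (b - a) ≤ C * (r / C) := by gcongr; linarith
        _ = r := by field_simp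
  obtain ⟨α, hα⟩ := ODE.FunSpace.exists_isFixedPt_next hP (Metric.mem_closedBall_self le_rfl)
  have hαmem : ∀ t, α.compProj t ∈ Metric.closedBall e r := fun t =>
    α.compProj_mem_closedBall hP.mul_max_le
  have heq : ∀ t ∈ Icc a b, α.compProj t =
      ODE.picard (fun t y => leftField m H y (f t)) a e α.compProj t := by
    intro t ht
    have : α.compProj t = (ODE.FunSpace.next hP (Metric.mem_closedBall_self le_rfl) α).compProj t := by
      rw [hα]
    rw [this, ODE.FunSpace.compProj_apply, ODE.FunSpace.next_apply, projIcc_of_mem _ ht]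
  have hcont : ContinuousOn (uncurry fun t y => leftField m H y (f t))
      (Icc a b ×ˢ Metric.closedBall e r) := by
    have h1 : ContinuousOn (fun p : ℝ × 𝔼 => leftField m H p.2) (Icc a b ×ˢ Metric.closedBall e r) :=
      hL.continuousOn.comp continuousOn_snd fun p hp => hp.2
    exact h1.clm_apply (hf.comp continuous_fst).continuousOn
  refine ⟨fun t => (chartOne m H).symm (α.compProj t), ?_, fun τ hτ => ?_⟩
  · simp only
    rw [heq a (left_mem_Icc.2 hab), ODE.picard_apply₀, chartOne_symm_base]
  · refine HasDerivWithinAt.hasLogDerivWithinAt ?_ (hsub (hαmem τ))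
    exact (ODE.hasDerivWithinAt_picard_Icc (left_mem_Icc.2 hab) hcont
      (α.continuous_compProj).continuousOn (fun t _ => hαmem t) e hτ).congr heq (heq τ hτ)

/-- Path-ordered exponentials exist. -/
theorem exists_logDeriv {f : ℝ → 𝔼} (hf : Continuous f) : ∃ w : ℝ → H, w 0 = 1 ∧
      ∀ τ ∈ Icc (0 : ℝ) 1, HasLogDerivWithinAt w (f τ) (Icc 0 1) τ := by
  obtain ⟨δ, hδ, hshort⟩ := exists_logDeriv_of_short (H := H) hf
  obtain ⟨N, hN⟩ := exists_nat_one_div_lt hδ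
  have hN' : (0 : ℝ) < N + 1 := by positivity
  have key : ∀ k : ℕ, k ≤ N + 1 → ∃ w : ℝ → H, w 0 = 1 ∧
      ∀ τ ∈ Icc (0 : ℝ) (k / (N + 1)), HasLogDerivWithinAt w (f τ) (Icc 0 (k / (N + 1))) τ := by
    intro k
    induction k with
    | zero =>
      intro _
      obtain ⟨w, hw, h⟩ := hshort 0 0 le_rfl le_rfl zero_le_one (by linarith)
      refine ⟨w, hw, ?_⟩
      simpa using h
    | succ k ih =>
      intro hk
      obtain ⟨w, hw, h⟩ := ih (by omega)
      set a : ℝ := k / (N + 1) with ha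
      set b : ℝ := ((k + 1 : ℕ) : ℝ) / (N + 1) with hb
      have ha0 : 0 ≤ a := by positivity
      have hab : b = a + 1 / (N + 1) := by rw [ha, hb]; push_cast; ring
      have hab' : a ≤ b := by rw [hab]; have : 0 < 1 / ((N : ℝ) + 1) := by positivity
                              linarith
      have hb1 : b ≤ 1 := by
        rw [hb, div_le_one hN']; exact_mod_cast hk
      obtain ⟨v, hv, h'⟩ := hshort a b ha0 hab' hb1 (by rw [hab]; linarith)
      refine ⟨fun r => if r ≤ a then w r else w a * v r, by simp [ha0, hw], fun τ hτ => ?_⟩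
      rw [← Icc_union_Icc_eq_Icc ha0 hab']
      refine HasLogDerivWithinAt.union ?_ ?_
      · by_cases hτa : τ ≤ a
        · exact (h τ ⟨hτ.1, hτa⟩).congr (fun r hr => by simp [hr.2]) (by simp [hτa])
        · exact hasLogDerivWithinAt_of_notMem_closure (by
            rw [isClosed_Icc.closure_eq]; exact fun h => hτa h.2)
      · by_cases hτa : a ≤ τ
        · have hE : ∀ r ∈ Icc a b, (if r ≤ a then w r else w a * v r) = w a * v r := by
            intro r hr
            by_cases hra : r ≤ a
            · obtain rfl : r = a := le_antisymm hra hr.1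
              simp [hv]
            · simp [hra]
          exact ((h' τ ⟨hτa, hτ.2⟩).const_mul (w a)).congr hE (hE τ ⟨hτa, hτ.2⟩)
        · exact hasLogDerivWithinAt_of_notMem_closure (by
            rw [isClosed_Icc.closure_eq]; exact fun h => hτa h.1)
  obtain ⟨w, hw, h⟩ := key (N + 1) le_rfl
  have h1 : ((N + 1 : ℕ) : ℝ) / (N + 1) = 1 := by push_cast; field_simp
  rw [h1] at h
  exact ⟨w, hw, h⟩

theorem isPathOrderedExp_of_logDeriv {f : ℝ → 𝔼} {w : ℝ → H} (h0 : w 0 = 1)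
    (h : ∀ τ ∈ Icc (0 : ℝ) 1, HasLogDerivWithinAt w (f τ) (Icc 0 1) τ) :
    IsPathOrderedExp (m := m) f (w 1) := by
  refine ⟨w, h0, rfl, fun τ hτ => ?_⟩
  have h1 := hasLogDerivWithinAt_iff.1 (h τ hτ)
  refine ⟨h1.mdifferentiableWithinAt, ?_⟩
  rw [velocity, h1.mfderivWithin (uniqueMDiffWithinAt_iff_uniqueDiffWithinAt.2
    (uniqueDiffOn_Icc zero_lt_one τ hτ))]
  exact one_smul ℝ _

theorem IsPathOrderedExp.exists_logDeriv {f : ℝ → 𝔼} {h : H}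
    (hf : IsPathOrderedExp (m := m) f h) : ∃ w : ℝ → H, w 0 = 1 ∧ w 1 = h ∧
      ∀ τ ∈ Icc (0 : ℝ) 1, HasLogDerivWithinAt w (f τ) (Icc 0 1) τ := by
  obtain ⟨w, h0, h1, hw⟩ := hf
  refine ⟨w, h0, h1, fun τ hτ => hasLogDerivWithinAt_iff.2 ?_⟩
  obtain ⟨hd, hv⟩ := hw τ hτ
  refine hd.hasMFDerivWithinAt.congr_mfderiv ?_
  refine ContinuousLinearMap.ext_ring ?_
  exact hv.trans (one_smul ℝ _).symm

end LieGroupODE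

/-! ### Dependence of path-ordered exponentials on a parameter -/

section LieGroupVariation

variable {m : ℕ} {H : Type*} [TopologicalSpace H] [ChartedSpace (EuclideanSpace ℝ (Fin m)) H]
  [Group H] [LieGroup (𝓡 m) ∞ H]

local notation "𝔼" => EuclideanSpace ℝ (Fin m)

variable (m H) in
/-- The inversion in the preferred chart at the identity. -/
noncomputable def chartInv (p : 𝔼) : 𝔼 := chartOne m H ((chartOne m H).symm p)⁻¹

variable (m H) in
theorem contMDiffAt_inv_chartOne_symm :
    ContMDiffAt 𝓘(ℝ, 𝔼) (𝓡 m) ∞ (fun p => ((chartOne m H).symm p)⁻¹) (chartBase m H) :=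
  (contMDiffAt_chartOne_symm chartBase_mem).inv

theorem chartInv_base : chartInv m H (chartBase m H) = chartBase m H := by
  rw [chartInv, chartOne_symm_base, inv_one]; rfl

variable (m H) in
theorem eventually_inv_mem_chartOne : ∀ᶠ p in 𝓝 (chartBase m H),
    ((chartOne m H).symm p)⁻¹ ∈ (chartOne m H).source := by
  refine (contMDiffAt_inv_chartOne_symm m H).continuousAt.eventually
    (isOpen_chartOne_source.mem_nhds ?_)
  simpa using one_mem_chartOne

variable (m H) in
theorem hasFDerivAt_chartInv :
    HasFDerivAt (chartInv m H) (-ContinuousLinearMap.id ℝ 𝔼) (chartBase m H) := by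
  set e := chartBase m H
  have hd : HasFDerivAt (chartInv m H) (fderiv ℝ (chartInv m H) e) e :=
    ((contDiffAt_chartOne_comp (contMDiffAt_inv_chartOne_symm m H)
      (by simpa [e] using one_mem_chartOne)).differentiableAt (by simp)).hasFDerivAt
  have hm : HasFDerivAt (chartMul m H) (fderiv ℝ (chartMul m H) (e, e)) (e, chartInv m H e) := by
    rw [chartInv_base]
    exact ((contDiffAt_chartMul_left chartBase_mem).differentiableAt (by simp)).hasFDerivAt
  have h1 := hm.comp e (f := fun p => (p, chartInv m H p)) ((hasFDerivAt_id e).prodMk hd)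
  have h2 : HasFDerivAt (fun p => chartMul m H (p, chartInv m H p)) (0 : 𝔼 →L[ℝ] 𝔼) e := by
    refine (hasFDerivAt_const e e).congr_of_eventuallyEq ?_
    filter_upwards [eventually_inv_mem_chartOne m H] with p hp
    simp only [chartMul, chartInv, (chartOne m H).left_inv hp, mul_inv_cancel]
    rfl
  have h3 := h1.unique h2
  have hk : fderiv ℝ (chartInv m H) e = -ContinuousLinearMap.id ℝ 𝔼 := by
    refine ContinuousLinearMap.ext fun v => ?_
    have h4 := congrArg (fun T : 𝔼 →L[ℝ] 𝔼 => T v) h3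
    have hl : fderiv ℝ (chartMul m H) (e, e) (v, 0) = v :=
      congrArg (fun T : 𝔼 →L[ℝ] 𝔼 => T v) (rightField_base (m := m) (H := H))
    have hr : ∀ v, fderiv ℝ (chartMul m H) (e, e) (0, v) = v := fun v =>
      congrArg (fun T : 𝔼 →L[ℝ] 𝔼 => T v) (leftField_base (m := m) (H := H))
    have h5 : fderiv ℝ (chartMul m H) (e, e) (v, fderiv ℝ (chartInv m H) e v) = 0 := h4
    have h6 : ((v, fderiv ℝ (chartInv m H) e v) : 𝔼 × 𝔼) =
      (v, 0) + (0, fderiv ℝ (chartInv m H) e v) := by simp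
    rw [h6, map_add, hl, hr] at h5
    simpa using (neg_eq_of_add_eq_zero_right h5).symm
  exact hk ▸ hd

/-- The quotient of two curves with given logarithmic derivatives, in the chart. -/
theorem HasLogDerivWithinAt.inv_mul {w₀ w₁ : ℝ → H} {z x : 𝔼} {s : Set ℝ} {τ : ℝ}
    (h₀ : HasLogDerivWithinAt w₀ z s τ) (h₁ : HasLogDerivWithinAt w₁ x s τ)
    (hu : (w₀ τ)⁻¹ * w₁ τ ∈ (chartOne m H).source) :
    HasDerivWithinAt (fun r => chartOne m H ((w₀ r)⁻¹ * w₁ r))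
      (leftField m H (chartOne m H ((w₀ τ)⁻¹ * w₁ τ)) x
        - rightField m H (chartOne m H ((w₀ τ)⁻¹ * w₁ τ)) z) s τ := by
  set e := chartBase m H
  set g := (w₀ τ)⁻¹ * w₁ τ with hg
  set y := chartOne m H g with hy
  have hyt : y ∈ (chartOne m H).target := (chartOne m H).map_source hu
  have hyg : (chartOne m H).symm y = g := (chartOne m H).left_inv hu
  set Φ : 𝔼 × 𝔼 → 𝔼 := fun p =>
    chartOne m H (((chartOne m H).symm p.1)⁻¹ * (g * (chartOne m H).symm p.2)) with hΦ
  have hΦs : ContMDiffAt 𝓘(ℝ, 𝔼 × 𝔼) (𝓡 m) ∞ (fun p : 𝔼 × 𝔼 =>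
      ((chartOne m H).symm p.1)⁻¹ * (g * (chartOne m H).symm p.2)) (e, e) := by
    have e1 : ContMDiffAt 𝓘(ℝ, 𝔼 × 𝔼) 𝓘(ℝ, 𝔼) ∞ (Prod.fst : 𝔼 × 𝔼 → 𝔼) (e, e) :=
      contMDiffAt_iff_contDiffAt.2 contDiffAt_fst
    have e2 : ContMDiffAt 𝓘(ℝ, 𝔼 × 𝔼) 𝓘(ℝ, 𝔼) ∞ (Prod.snd : 𝔼 × 𝔼 → 𝔼) (e, e) :=
      contMDiffAt_iff_contDiffAt.2 contDiffAt_snd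
    exact ((contMDiffAt_inv_chartOne_symm m H).comp (e, e) e1).mul
      (contMDiffAt_const.mul ((contMDiffAt_chartOne_symm chartBase_mem).comp (e, e) e2))
  have hΦd : HasFDerivAt Φ (fderiv ℝ Φ (e, e)) (e, e) :=
    ((contDiffAt_chartOne_comp hΦs (by simpa [e] using hu)).differentiableAt
      (by simp)).hasFDerivAt
  have hD1 : ∀ v, fderiv ℝ Φ (e, e) (v, 0) = -rightField m H y v := by
    intro v
    have h1 := hΦd.comp e (f := fun p => (p, e)) (hasFDerivAt_prodMk_left e e)
    have h2 : HasFDerivAt (fun p => chartMul m H (chartInv m H p, y))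
        ((rightField m H y).comp (-ContinuousLinearMap.id ℝ 𝔼)) e := by
      refine HasFDerivAt.comp (g := fun p => chartMul m H (p, y)) e ?_ (hasFDerivAt_chartInv m H)
      rw [chartInv_base]
      exact hasFDerivAt_rightField hyt
    have h3 := h1.unique (h2.congr_of_eventuallyEq ?_)
    · have := congrArg (fun T : 𝔼 →L[ℝ] 𝔼 => T v) h3
      simpa using this
    · filter_upwards [eventually_inv_mem_chartOne m H] with p hp
      simp [chartMul, chartInv, (chartOne m H).left_inv hp, Φ, e, hyg]
  have hD2 : ∀ v, fderiv ℝ Φ (e, e) (0, v) = leftField m H y v := by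
    intro v
    have h1 := hΦd.comp e (f := fun p => (e, p)) (hasFDerivAt_prodMk_right e e)
    have h3 := h1.unique ((hasFDerivAt_leftField hyt).congr_of_eventuallyEq ?_)
    · have := congrArg (fun T : 𝔼 →L[ℝ] 𝔼 => T v) h3
      simpa using this
    · refine Filter.Eventually.of_forall fun p => ?_
      simp [chartMul, Φ, e, hyg]
  have hb : ∀ w : ℝ → H, chartOne m H ((w τ)⁻¹ * w τ) = e := fun w => by simp [e, chartBase]
  have hΦd' : HasFDerivAt Φ (fderiv ℝ Φ (e, e))
      (chartOne m H ((w₀ τ)⁻¹ * w₀ τ), chartOne m H ((w₁ τ)⁻¹ * w₁ τ)) := by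
    rw [hb, hb]; exact hΦd
  have h1 := hΦd'.comp_hasDerivWithinAt τ (f := fun r =>
    (chartOne m H ((w₀ τ)⁻¹ * w₀ r), chartOne m H ((w₁ τ)⁻¹ * w₁ r))) (h₀.2.prodMk h₁.2)
  have h2 : fderiv ℝ Φ (e, e) (z, x) = leftField m H y x - rightField m H y z := by
    rw [show ((z, x) : 𝔼 × 𝔼) = (z, 0) + (0, x) by simp, map_add, hD1, hD2]; abel
  rw [h2] at h1
  have hmem : ∀ w : ℝ → H, ContinuousWithinAt w s τ →
      ∀ᶠ r in 𝓝[s] τ, (w τ)⁻¹ * w r ∈ (chartOne m H).source := by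
    intro w hw
    have hc : ContinuousWithinAt (fun r => (w τ)⁻¹ * w r) s τ :=
      (contMDiff_mul_left (I := 𝓡 m) (n := ∞)
        (a := (w τ)⁻¹)).continuous.continuousAt.comp_continuousWithinAt hw
    exact hc.eventually (isOpen_chartOne_source.mem_nhds (by simpa using one_mem_chartOne))
  refine h1.congr_of_eventuallyEq ?_ ?_
  · filter_upwards [hmem w₀ h₀.1, hmem w₁ h₁.1] with r hr0 hr1
    simp only [Φ, Function.comp, (chartOne m H).left_inv hr0, (chartOne m H).left_inv hr1, hg]
    congr 1; group
  · simp only [Φ, Function.comp, hb, e, chartOne_symm_base, hg]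
    congr 1; group

/-- A curve starting at the identity stays in a chart ball if, as long as it does, it stays in
half of it. -/
theorem mem_ball_of_bootstrap [T2Space H] {u : ℝ → H} (hu : ContinuousOn u (Icc 0 1))
    (h0 : u 0 = 1) {r : ℝ} (hr : 0 < r)
    (hsub : Metric.closedBall (chartBase m H) r ⊆ (chartOne m H).target)
    (h : ∀ T ∈ Icc (0 : ℝ) 1, (∀ t ∈ Icc 0 T, u t ∈ (chartOne m H).source ∧
      chartOne m H (u t) ∈ Metric.ball (chartBase m H) r) →
      chartOne m H (u T) ∈ Metric.closedBall (chartBase m H) (r / 2)) :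
    ∀ t ∈ Icc (0 : ℝ) 1, u t ∈ (chartOne m H).source ∧
      chartOne m H (u t) ∈ Metric.ball (chartBase m H) r := by
  set e := chartBase m H
  set V : Set H := (chartOne m H).source ∩ chartOne m H ⁻¹' Metric.ball e r with hV
  have hVo : IsOpen V := (continuousOn_extChartAt (I := 𝓡 m) (1 : H)).isOpen_inter_preimage
    isOpen_chartOne_source Metric.isOpen_ball
  have h1V : (1 : H) ∈ V := ⟨one_mem_chartOne, Metric.mem_ball_self hr⟩
  by_contra! hne
  obtain ⟨t₁, ht₁, ht₁'⟩ := hne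
  set S : Set ℝ := Icc 0 1 ∩ u ⁻¹' Vᶜ with hS
  have hSc : IsCompact S := isCompact_Icc.of_isClosed_subset
    (hu.preimage_isClosed_of_isClosed isClosed_Icc hVo.isClosed_compl) inter_subset_left
  have hSne : S.Nonempty := ⟨t₁, ht₁, fun hv => ht₁' hv.1 hv.2⟩
  obtain ⟨T, hTS, hTmin⟩ := hSc.exists_isLeast hSne
  have hlt : ∀ t ∈ Ico 0 T, u t ∈ V := by
    intro t ht
    by_contra hv
    exact absurd (hTmin ⟨⟨ht.1, ht.2.le.trans hTS.1.2⟩, hv⟩) (not_le.2 ht.2)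
  have hT0 : 0 < T := by
    rcases hTS.1.1.eq_or_lt with h' | h'
    · exact absurd h1V (by rw [← h0, h']; exact hTS.2)
    · exact h'
  set Z : Set H := (chartOne m H).symm '' Metric.closedBall e (r / 2) with hZ
  have hball : Metric.closedBall e (r / 2) ⊆ (chartOne m H).target :=
    (Metric.closedBall_subset_closedBall (by linarith)).trans hsub
  have hZc : IsClosed Z := ((isCompact_closedBall e (r / 2)).image_of_continuousOn
    ((continuousOn_extChartAt_symm (I := 𝓡 m) (1 : H)).mono hball)).isClosed
  have hmem : ∀ t ∈ Ico 0 T, u t ∈ Z := by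
    intro t ht
    refine ⟨chartOne m H (u t), h t ⟨ht.1, ht.2.le.trans hTS.1.2⟩ fun t' ht' =>
      hlt t' ⟨ht'.1, ht'.2.trans_lt ht.2⟩, (chartOne m H).left_inv (hlt t ht).1⟩
  have hTZ : u T ∈ Z := by
    have hc : ContinuousWithinAt u (Ico 0 T) T :=
      (hu T hTS.1).mono (Ico_subset_Icc_self.trans (Icc_subset_Icc_right hTS.1.2))
    exact hZc.closure_subset (hc.mem_closure (by rw [closure_Ico hT0.ne]; simp [hT0.le]) hmem)
  obtain ⟨y, hy, hyT⟩ := hTZ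
  refine hTS.2 ?_
  rw [← hyT]
  refine ⟨(chartOne m H).map_target (hball hy), ?_⟩
  rw [mem_preimage, (chartOne m H).right_inv (hball hy)]
  exact Metric.closedBall_subset_ball (by linarith) hy

end LieGroupVariation

section LieGroupVariationEstimate

variable {m : ℕ} {H : Type*} [TopologicalSpace H] [ChartedSpace (EuclideanSpace ℝ (Fin m)) H]
  [Group H] [LieGroup (𝓡 m) ∞ H]

local notation "𝔼" => EuclideanSpace ℝ (Fin m)

theorem norm_leftField_sub_rightField_sub_le {r : ℝ} {K : NNReal}
    (hL : LipschitzOnWith K (leftField m H) (Metric.closedBall (chartBase m H) r))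
    (hR : LipschitzOnWith K (rightField m H) (Metric.closedBall (chartBase m H) r))
    {y x z γ g ξ : 𝔼} {ε η : ℝ} (hy : y ∈ Metric.closedBall (chartBase m H) r)
    (hp : chartBase m H + ε • ξ ∈ Metric.closedBall (chartBase m H) r)
    (hx : x = z + ε • γ) (hg : ‖γ - g‖ ≤ η) (hε : |ε| ≤ η)
    (hLd : ‖leftField m H (chartBase m H + ε • ξ) - leftField m H (chartBase m H)
      - fderiv ℝ (leftField m H) (chartBase m H) (ε • ξ)‖ ≤ η * ‖ε • ξ‖)
    (hRd : ‖rightField m H (chartBase m H + ε • ξ) - rightField m H (chartBase m H)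
      - fderiv ℝ (rightField m H) (chartBase m H) (ε • ξ)‖ ≤ η * ‖ε • ξ‖) :
    ‖leftField m H y x - rightField m H y z - ε • (g +
        (fderiv ℝ (leftField m H) (chartBase m H) ξ z
          - fderiv ℝ (leftField m H) (chartBase m H) z ξ))‖
      ≤ K * (‖x‖ + ‖z‖) * ‖y - (chartBase m H + ε • ξ)‖
        + |ε| * η * (2 * (‖ξ‖ * ‖z‖) + K * ‖ξ‖ * ‖γ‖ + 1) := by
  set e := chartBase m H
  set p := e + ε • ξ with hpdef
  have hη : 0 ≤ η := (abs_nonneg ε).trans hε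
  have he : e ∈ Metric.closedBall e r :=
    Metric.mem_closedBall_self (dist_nonneg.trans (Metric.mem_closedBall.1 hy))
  have h1 : ‖leftField m H y - leftField m H p‖ ≤ K * ‖y - p‖ := by
    simpa [dist_eq_norm] using hL.dist_le_mul y hy p hp
  have h2 : ‖rightField m H y - rightField m H p‖ ≤ K * ‖y - p‖ := by
    simpa [dist_eq_norm] using hR.dist_le_mul y hy p hp
  have h3 : ‖leftField m H p - leftField m H e‖ ≤ K * (|ε| * ‖ξ‖) := by
    have := hL.dist_le_mul p hp e he
    rw [dist_eq_norm, dist_eq_norm] at this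
    simpa [hpdef, norm_smul] using this
  have h4 : ‖ε • ξ‖ = |ε| * ‖ξ‖ := by rw [norm_smul, Real.norm_eq_abs]
  have key : leftField m H y x - rightField m H y z - ε • (g +
        (fderiv ℝ (leftField m H) e ξ z - fderiv ℝ (leftField m H) e z ξ)) =
      (leftField m H y - leftField m H p) x - (rightField m H y - rightField m H p) z
      + (leftField m H p - leftField m H e - fderiv ℝ (leftField m H) e (ε • ξ)) z
      - (rightField m H p - rightField m H e - fderiv ℝ (rightField m H) e (ε • ξ)) z
      + ε • ((leftField m H p - leftField m H e) γ) + ε • (γ - g) := by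
    have h5 := fderiv_rightField_base (m := m) (H := H) ξ z
    change fderiv ℝ (rightField m H) e ξ z = fderiv ℝ (leftField m H) e z ξ at h5
    have h6 : leftField m H e = ContinuousLinearMap.id ℝ 𝔼 := leftField_base
    have h7 : rightField m H e = ContinuousLinearMap.id ℝ 𝔼 := rightField_base
    rw [← h5, h6, h7, hx]
    simp only [sub_apply, map_add, map_smul, smul_apply, ContinuousLinearMap.id_apply]
    module
  rw [key]
  refine (norm_add_le _ _).trans ((add_le_add_left (norm_add_le _ _) _).trans ((add_le_add_left
    (add_le_add_left (norm_sub_le _ _) _) _).trans ((add_le_add_left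
    (add_le_add_left (add_le_add_left (norm_add_le _ _) _) _) _).trans ((add_le_add_left
    (add_le_add_left (add_le_add_left (add_le_add_left (norm_sub_le _ _) _) _) _) _).trans ?_))))
  have b1 := ((leftField m H y - leftField m H p).le_opNorm x).trans
    (mul_le_mul_of_nonneg_right h1 (norm_nonneg x))
  have b2 := ((rightField m H y - rightField m H p).le_opNorm z).trans
    (mul_le_mul_of_nonneg_right h2 (norm_nonneg z))
  have b3 := (ContinuousLinearMap.le_opNorm _ z).trans
    (mul_le_mul_of_nonneg_right hLd (norm_nonneg z))
  have b4 := (ContinuousLinearMap.le_opNorm _ z).trans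
    (mul_le_mul_of_nonneg_right hRd (norm_nonneg z))
  have b5 : ‖ε • ((leftField m H p - leftField m H e) γ)‖ ≤ |ε| * (K * (η * ‖ξ‖) * ‖γ‖) := by
    rw [norm_smul, Real.norm_eq_abs]
    refine mul_le_mul_of_nonneg_left (((leftField m H p - leftField m H e).le_opNorm γ).trans
      (mul_le_mul_of_nonneg_right (h3.trans ?_) (norm_nonneg γ))) (abs_nonneg ε)
    gcongr
  have b6 : ‖ε • (γ - g)‖ ≤ |ε| * η := by
    rw [norm_smul, Real.norm_eq_abs]; gcongr
  rw [h4] at b3 b4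
  calc _ ≤ K * ‖y - p‖ * ‖x‖ + K * ‖y - p‖ * ‖z‖ + η * (|ε| * ‖ξ‖) * ‖z‖ + η * (|ε| * ‖ξ‖) * ‖z‖
        + |ε| * (K * (η * ‖ξ‖) * ‖γ‖) + |ε| * η := by gcongr
    _ = _ := by ring

theorem norm_sub_le_of_logDeriv [T2Space H] {r : ℝ} (hr : 0 < r) {K : NNReal}
    (hsub : Metric.closedBall (chartBase m H) r ⊆ (chartOne m H).target)
    (hL : LipschitzOnWith K (leftField m H) (Metric.closedBall (chartBase m H) r))
    (hR : LipschitzOnWith K (rightField m H) (Metric.closedBall (chartBase m H) r))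
    {w₀ w₁ : ℝ → H} {z x γ g ξ : ℝ → 𝔼} {ε η Mz Mγ Mξ : ℝ}
    (hw₀ : w₀ 0 = 1) (hw₁ : w₁ 0 = 1)
    (h₀ : ∀ τ ∈ Icc (0 : ℝ) 1, HasLogDerivWithinAt w₀ (z τ) (Icc 0 1) τ)
    (h₁ : ∀ τ ∈ Icc (0 : ℝ) 1, HasLogDerivWithinAt w₁ (x τ) (Icc 0 1) τ)
    (hξ0 : ξ 0 = 0)
    (hξ : ∀ τ ∈ Icc (0 : ℝ) 1, HasDerivWithinAt ξ (g τ +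
        (fderiv ℝ (leftField m H) (chartBase m H) (ξ τ) (z τ)
          - fderiv ℝ (leftField m H) (chartBase m H) (z τ) (ξ τ))) (Icc 0 1) τ)
    (hx : ∀ τ ∈ Icc (0 : ℝ) 1, x τ = z τ + ε • γ τ) (hε : |ε| ≤ η) (hε1 : |ε| ≤ 1)
    (hg : ∀ τ ∈ Icc (0 : ℝ) 1, ‖γ τ - g τ‖ ≤ η)
    (hz : ∀ τ ∈ Icc (0 : ℝ) 1, ‖z τ‖ ≤ Mz) (hγ : ∀ τ ∈ Icc (0 : ℝ) 1, ‖γ τ‖ ≤ Mγ)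
    (hξM : ∀ τ ∈ Icc (0 : ℝ) 1, ‖ξ τ‖ ≤ Mξ)
    (hLd : ∀ v : 𝔼, ‖v‖ ≤ |ε| * Mξ → ‖leftField m H (chartBase m H + v) -
      leftField m H (chartBase m H) - fderiv ℝ (leftField m H) (chartBase m H) v‖ ≤ η * ‖v‖)
    (hRd : ∀ v : 𝔼, ‖v‖ ≤ |ε| * Mξ → ‖rightField m H (chartBase m H + v) -
      rightField m H (chartBase m H) - fderiv ℝ (rightField m H) (chartBase m H) v‖ ≤ η * ‖v‖)
    (hsmall : |ε| * η * ((2 * (Mξ * Mz) + K * Mξ * Mγ + 1) *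
      (Real.exp (K * (2 * Mz + Mγ) + 1))) + |ε| * Mξ ≤ r / 2) :
    (∀ t ∈ Icc (0 : ℝ) 1, (w₀ t)⁻¹ * w₁ t ∈ (chartOne m H).source) ∧
    ‖chartOne m H ((w₀ 1)⁻¹ * w₁ 1) - (chartBase m H + ε • ξ 1)‖ ≤
      |ε| * η * ((2 * (Mξ * Mz) + K * Mξ * Mγ + 1) *
      (Real.exp (K * (2 * Mz + Mγ) + 1))) := by
  set e := chartBase m H
  set y : ℝ → 𝔼 := fun t => chartOne m H ((w₀ t)⁻¹ * w₁ t) with hydef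
  set C₁ : ℝ := K * (2 * Mz + Mγ) + 1 with hC₁
  set C₂ : ℝ := 2 * (Mξ * Mz) + K * Mξ * Mγ + 1 with hC₂
  have m0 : (0 : ℝ) ∈ Icc (0 : ℝ) 1 := by simp
  have hMz : 0 ≤ Mz := (norm_nonneg _).trans (hz 0 m0)
  have hMγ : 0 ≤ Mγ := (norm_nonneg _).trans (hγ 0 m0)
  have hMξ : 0 ≤ Mξ := (norm_nonneg _).trans (hξM 0 m0)
  have hη : 0 ≤ η := (abs_nonneg ε).trans hε
  have hC₁p : 1 ≤ C₁ := by
    have : 0 ≤ K * (2 * Mz + Mγ) := by positivity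
    linarith
  have hC₂p : 0 ≤ C₂ := by positivity
  have hbd : 0 ≤ |ε| * η * (C₂ * Real.exp C₁) := by positivity
  have key : ∀ T ∈ Icc (0 : ℝ) 1, (∀ t ∈ Icc 0 T, (w₀ t)⁻¹ * w₁ t ∈ (chartOne m H).source ∧
      y t ∈ Metric.ball e r) → ‖y T - (e + ε • ξ T)‖ ≤ |ε| * η * (C₂ * Real.exp C₁) := by
    intro T hT hball
    have hsubT : Icc 0 T ⊆ Icc (0 : ℝ) 1 := Icc_subset_Icc_right hT.2
    have hder : ∀ t ∈ Icc (0 : ℝ) T, HasDerivWithinAt (fun t => y t - (e + ε • ξ t))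
        (leftField m H (y t) (x t) - rightField m H (y t) (z t) - ε • (g t +
        (fderiv ℝ (leftField m H) e (ξ t) (z t)
          - fderiv ℝ (leftField m H) e (z t) (ξ t)))) (Icc 0 1) t := by
      intro t ht
      exact ((h₀ t (hsubT ht)).inv_mul (h₁ t (hsubT ht)) (hball t ht).1).sub
        (((hξ t (hsubT ht)).const_smul ε).const_add e)
    have hgr := norm_le_gronwallBound_of_norm_deriv_right_le
      (f := fun t => y t - (e + ε • ξ t)) (δ := 0) (K := C₁) (ε := |ε| * η * C₂)
      (a := 0) (b := T) (fun t ht => ((hder t ht).mono hsubT).continuousWithinAt)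
      (fun t ht => (hder t (Ico_subset_Icc_self ht)).mono_of_mem_nhdsWithin
        (Icc_mem_nhdsGE_of_mem ⟨ht.1, ht.2.trans_le hT.2⟩))
      (by simp [y, hξ0, hw₀, hw₁, e, chartBase])
      (fun t ht => ?_) T ⟨hT.1, le_rfl⟩
    · refine hgr.trans ?_
      rw [gronwallBound_of_K_ne_0 (by linarith)]
      simp only [zero_mul, zero_add, sub_zero]
      have e1 : Real.exp (C₁ * T) ≤ Real.exp C₁ := Real.exp_le_exp.2 (by nlinarith [hT.1, hT.2])
      have e2 : |ε| * η * C₂ / C₁ ≤ |ε| * η * C₂ := div_le_self (by positivity) hC₁p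
      calc |ε| * η * C₂ / C₁ * (Real.exp (C₁ * T) - 1)
          ≤ |ε| * η * C₂ / C₁ * Real.exp C₁ := by gcongr; linarith
        _ ≤ |ε| * η * C₂ * Real.exp C₁ := by gcongr
        _ = _ := by ring
    · have ht' : t ∈ Icc (0 : ℝ) T := Ico_subset_Icc_self ht
      have ht1 := hsubT ht'
      have hv : ‖ε • ξ t‖ ≤ |ε| * Mξ := by
        rw [norm_smul, Real.norm_eq_abs]; gcongr; exact hξM t ht1
      have hp : e + ε • ξ t ∈ Metric.closedBall e r := by
        rw [Metric.mem_closedBall, dist_eq_norm, add_sub_cancel_left]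
        linarith
      refine (norm_leftField_sub_rightField_sub_le hL hR
        (Metric.ball_subset_closedBall (hball t ht').2) hp (hx t ht1) (hg t ht1) hε
        (hLd _ hv) (hRd _ hv)).trans ?_
      have hzt := hz t ht1
      have hγt := hγ t ht1
      have hξt := hξM t ht1
      have hxt : ‖x t‖ ≤ Mz + Mγ := by
        rw [hx t ht1]
        refine (norm_add_le _ _).trans (add_le_add hzt ?_)
        rw [norm_smul, Real.norm_eq_abs]
        calc |ε| * ‖γ t‖ ≤ 1 * Mγ := by gcongr
          _ = Mγ := one_mul _
      have hK : K * (‖x t‖ + ‖z t‖) ≤ C₁ := by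
        calc K * (‖x t‖ + ‖z t‖) ≤ K * ((Mz + Mγ) + Mz) := by gcongr
          _ ≤ C₁ := by rw [hC₁]; linarith
      have hC : 2 * (‖ξ t‖ * ‖z t‖) + K * ‖ξ t‖ * ‖γ t‖ + 1 ≤ C₂ := by rw [hC₂]; gcongr
      exact add_le_add (mul_le_mul_of_nonneg_right hK (norm_nonneg _))
        (mul_le_mul_of_nonneg_left hC (by positivity))
  have hstay := mem_ball_of_bootstrap (m := m) (u := fun t => (w₀ t)⁻¹ * w₁ t)
    (fun t ht => ?_) (by simp [hw₀, hw₁]) hr hsub (fun T hT hball => ?_)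
  · exact ⟨fun t ht => (hstay t ht).1, key 1 (by simp) hstay⟩
  · have : ContinuousWithinAt (fun t => (w₀ t)⁻¹) (Icc 0 1) t :=
      (contMDiff_inv (𝓡 m) ∞ (G := H)).continuous.continuousAt.comp_continuousWithinAt (h₀ t ht).1
    have h2 : Continuous fun p : H × H => p.1 * p.2 := (contMDiff_mul (𝓡 m) ∞ (G := H)).continuous
    exact h2.continuousAt.comp_continuousWithinAt (this.prodMk (h₁ t ht).1)
  · have h1 := key T hT hball
    rw [Metric.mem_closedBall, dist_eq_norm]
    have hv : ‖ε • ξ T‖ ≤ |ε| * Mξ := by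
      rw [norm_smul, Real.norm_eq_abs]; gcongr; exact hξM T hT
    calc ‖y T - e‖ = ‖(y T - (e + ε • ξ T)) + ε • ξ T‖ := by congr 1; abel
      _ ≤ _ := norm_add_le _ _
      _ ≤ _ := add_le_add h1 hv
      _ ≤ _ := hsmall

theorem eventually_norm_sub_le_of_hasFDerivAt {E F : Type*} [NormedAddCommGroup E]
    [NormedSpace ℝ E] [NormedAddCommGroup F] [NormedSpace ℝ F] {f : E → F} {f' : E →L[ℝ] F} {a : E}
    (h : HasFDerivAt f f' a) {η : ℝ} (hη : 0 < η) (M : ℝ) :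
    ∀ᶠ ε : ℝ in 𝓝 0, ∀ v : E, ‖v‖ ≤ |ε| * M → ‖f (a + v) - f a - f' v‖ ≤ η * ‖v‖ := by
  have h1 := (hasFDerivAt_iff_isLittleO_nhds_zero.1 h).def hη
  obtain ⟨δ, hδ, hball⟩ := Metric.eventually_nhds_iff.1 h1
  have h2 : Filter.Tendsto (fun ε : ℝ => |ε| * M) (𝓝 0) (𝓝 (|0| * M)) :=
    (continuous_abs.mul continuous_const).tendsto 0
  rw [abs_zero, zero_mul] at h2
  filter_upwards [h2.eventually (gt_mem_nhds hδ)] with ε hε v hv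
  exact hball (by simpa using hv.trans_lt hε)

/-- Derivative of the end point of a path-ordered exponential with respect to a parameter. -/
theorem hasLogDerivWithinAt_endpoint [T2Space H] {f f' : ℝ → ℝ → 𝔼}
    (hf : Continuous (uncurry f)) (hf' : Continuous (uncurry f'))
    (hd : ∀ ν τ, HasDerivAt (fun ν => f ν τ) (f' ν τ) ν) {w : ℝ → ℝ → H}
    (hw0 : ∀ ν, w ν 0 = 1)
    (hw : ∀ ν, ∀ τ ∈ Icc (0 : ℝ) 1, HasLogDerivWithinAt (w ν) (f ν τ) (Icc 0 1) τ)
    {ν₀ : ℝ} {ξ : ℝ → 𝔼} (hξ0 : ξ 0 = 0)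
    (hξ : ∀ τ ∈ Icc (0 : ℝ) 1, HasDerivWithinAt ξ (f' ν₀ τ +
        (fderiv ℝ (leftField m H) (chartBase m H) (ξ τ) (f ν₀ τ)
          - fderiv ℝ (leftField m H) (chartBase m H) (f ν₀ τ) (ξ τ))) (Icc 0 1) τ) :
    HasLogDerivWithinAt (fun ν => w ν 1) (ξ 1) univ ν₀ := by
  obtain ⟨r, hr, K, hsub, hL, hR⟩ := exists_lipschitzOnWith_leftField_rightField m H
  obtain ⟨γ, hγc, hγ, hγ₀⟩ := exists_continuous_sub_eq_smul hf' hd ν₀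
  have hbound : ∀ {F : ℝ → 𝔼}, ContinuousOn F (Icc 0 1) → ∃ M, ∀ t ∈ Icc (0 : ℝ) 1, ‖F t‖ ≤ M :=
    fun hF => isCompact_Icc.exists_bound_of_continuousOn hF
  obtain ⟨Mz, hMz⟩ := hbound (F := f ν₀) (by fun_prop)
  obtain ⟨Mg, hMg⟩ := hbound (F := f' ν₀) (by fun_prop)
  obtain ⟨Mξ, hMξ⟩ := hbound (F := ξ) fun t ht => (hξ t ht).continuousWithinAt
  set e := chartBase m H
  set C : ℝ := (2 * (Mξ * Mz) + K * Mξ * (Mg + 1) + 1) * Real.exp (K * (2 * Mz + (Mg + 1)) + 1)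
    with hC
  have m0 : (0 : ℝ) ∈ Icc (0 : ℝ) 1 := by simp
  have hMz0 : 0 ≤ Mz := (norm_nonneg _).trans (hMz 0 m0)
  have hMg0 : 0 ≤ Mg := (norm_nonneg _).trans (hMg 0 m0)
  have hMξ0 : 0 ≤ Mξ := (norm_nonneg _).trans (hMξ 0 m0)
  have hCp : 0 < C := by positivity
  have hLd := ((contDiffAt_leftField (m := m) (H := H) chartBase_mem).differentiableAt
    (by simp)).hasFDerivAt
  have hRd := ((contDiffAt_rightField (m := m) (H := H) chartBase_mem).differentiableAt
    (by simp)).hasFDerivAt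
  have key : ∀ η : ℝ, 0 < η → η ≤ 1 → ∀ᶠ ν in 𝓝 ν₀,
      (w ν₀ 1)⁻¹ * w ν 1 ∈ (chartOne m H).source ∧
      ‖chartOne m H ((w ν₀ 1)⁻¹ * w ν 1) - (e + (ν - ν₀) • ξ 1)‖ ≤ |ν - ν₀| * η * C := by
    intro η hη hη1
    have ht : Filter.Tendsto (fun ν => ν - ν₀) (𝓝 ν₀) (𝓝 0) := by
      have : Continuous fun ν => ν - ν₀ := by fun_prop
      simpa using this.tendsto ν₀
    have hγe : ∀ᶠ ν in 𝓝 ν₀, ∀ τ ∈ Icc (0 : ℝ) 1, ‖γ ν τ - f' ν₀ τ‖ < η := by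
      refine isCompact_Icc.eventually_forall_of_forall_eventually fun τ _ => ?_
      have hc : Continuous fun p : ℝ × ℝ => ‖γ p.1 p.2 - f' ν₀ p.2‖ := by
        have h1 : Continuous fun p : ℝ × ℝ => γ p.1 p.2 := hγc
        have h2 : Continuous fun p : ℝ × ℝ => f' ν₀ p.2 :=
          hf'.comp (f := fun p : ℝ × ℝ => (ν₀, p.2)) (by fun_prop)
        exact (h1.sub h2).norm
      refine hc.continuousAt.eventually (gt_mem_nhds ?_)
      simpa [hγ₀] using hη
    have hsm : ∀ᶠ ε : ℝ in 𝓝 0, |ε| ≤ η ∧ |ε| * η * C + |ε| * Mξ ≤ r / 2 := by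
      have h1 : Continuous fun ε : ℝ => |ε| := continuous_abs
      have h2 : Continuous fun ε : ℝ => |ε| * η * C + |ε| * Mξ := by fun_prop
      refine Filter.Eventually.and ?_ ?_
      · exact (h1.continuousAt.eventually (gt_mem_nhds (by simpa using hη))).mono
          fun _ h => h.le
      · exact (h2.continuousAt.eventually (gt_mem_nhds (by simpa using hr))).mono
          fun _ h => h.le
    filter_upwards [hγe, ht.eventually hsm,
      ht.eventually (eventually_norm_sub_le_of_hasFDerivAt hLd hη Mξ),
      ht.eventually (eventually_norm_sub_le_of_hasFDerivAt hRd hη Mξ)] with ν h1 h2 h3 h4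
    have h5 := norm_sub_le_of_logDeriv (m := m) (H := H) hr hsub hL hR (hw0 ν₀) (hw0 ν) (hw ν₀) (hw ν) hξ0 hξ
      (γ := γ ν) (ε := ν - ν₀) (η := η) (Mz := Mz) (Mγ := Mg + 1) (Mξ := Mξ)
      (fun τ _ => by rw [← hγ ν τ]; abel) h2.1 (h2.1.trans hη1) (fun τ hτ => (h1 τ hτ).le) hMz
      (fun τ hτ => ?_) hMξ h3 h4 h2.2
    · exact ⟨h5.1 1 (by simp), h5.2⟩
    · calc ‖γ ν τ‖ = ‖f' ν₀ τ + (γ ν τ - f' ν₀ τ)‖ := by congr 1; abel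
        _ ≤ ‖f' ν₀ τ‖ + ‖γ ν τ - f' ν₀ τ‖ := norm_add_le _ _
        _ ≤ Mg + 1 := add_le_add (hMg τ hτ) ((h1 τ hτ).le.trans hη1)
  have hb : chartOne m H ((w ν₀ 1)⁻¹ * w ν₀ 1) = e := by simp [e, chartBase]
  have hder : HasDerivAt (fun ν => chartOne m H ((w ν₀ 1)⁻¹ * w ν 1)) (ξ 1) ν₀ := by
    rw [hasDerivAt_iff_isLittleO, Asymptotics.isLittleO_iff]
    intro c hc
    filter_upwards [key (min 1 (c / C)) (by positivity) (min_le_left _ _)] with ν hν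
    rw [hb, sub_sub]
    refine hν.2.trans ?_
    rw [Real.norm_eq_abs]
    have h6 : min 1 (c / C) * C ≤ c := by
      calc min 1 (c / C) * C ≤ c / C * C := by gcongr; exact min_le_right _ _
        _ = c := by field_simp
    calc |ν - ν₀| * min 1 (c / C) * C = |ν - ν₀| * (min 1 (c / C) * C) := by ring
      _ ≤ |ν - ν₀| * c := by gcongr
      _ = c * |ν - ν₀| := mul_comm _ _
  refine ⟨?_, hder.hasDerivWithinAt⟩
  rw [continuousWithinAt_univ]
  have h7 : ContinuousAt (fun ν => w ν₀ 1 * (chartOne m H).symm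
      (chartOne m H ((w ν₀ 1)⁻¹ * w ν 1))) ν₀ := by
    have h8 : ContinuousAt (chartOne m H).symm (chartOne m H ((w ν₀ 1)⁻¹ * w ν₀ 1)) := by
      rw [hb]; exact (contMDiffAt_chartOne_symm chartBase_mem).continuousAt
    exact (contMDiff_mul_left (I := 𝓡 m) (n := ∞) (a := w ν₀ 1)).continuous.continuousAt.comp
      (ContinuousAt.comp (f := fun ν => chartOne m H ((w ν₀ 1)⁻¹ * w ν 1)) h8 hder.continuousAt)
  refine h7.congr ?_
  filter_upwards [key 1 one_pos le_rfl] with ν hν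
  rw [(chartOne m H).left_inv hν.1]
  group

theorem HasLogDerivWithinAt.unique {w : ℝ → H} {x z : 𝔼} {s : Set ℝ} {τ : ℝ}
    (hs : UniqueDiffWithinAt ℝ s τ) (h₁ : HasLogDerivWithinAt w x s τ)
    (h₂ : HasLogDerivWithinAt w z s τ) : x = z :=
  hs.eq_deriv _ h₁.2 h₂.2

theorem hasLogDerivWithinAt_const (g : H) (s : Set ℝ) (τ : ℝ) :
    HasLogDerivWithinAt (m := m) (fun _ => g) 0 s τ :=
  ⟨continuousWithinAt_const, hasDerivWithinAt_const _ _ _⟩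

/-- A curve with vanishing logarithmic derivative is constant. -/
theorem eq_of_hasLogDerivWithinAt_zero {w : ℝ → H}
    (h : ∀ τ, HasLogDerivWithinAt (m := m) w 0 univ τ) (a b : ℝ) : w a = w b := by
  have hl : IsLocallyConstant w := by
    rw [IsLocallyConstant.iff_eventually_eq]
    intro τ
    have hc : ContinuousAt (fun r => (w τ)⁻¹ * w r) τ :=
      (contMDiff_mul_left (I := 𝓡 m) (n := ∞) (a := (w τ)⁻¹)).continuous.continuousAt.comp
        ((continuousWithinAt_univ _ _).1 (h τ).1)
    obtain ⟨δ, hδ, hball⟩ := Metric.eventually_nhds_iff_ball.1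
      (hc.eventually (isOpen_chartOne_source (m := m).mem_nhds (by simpa using one_mem_chartOne)))
    refine Metric.eventually_nhds_iff_ball.2 ⟨δ, hδ, fun r hr => ?_⟩
    have hd : ∀ t ∈ Metric.ball τ δ, HasDerivWithinAt
        (fun r => chartOne m H ((w τ)⁻¹ * w r)) 0 (Metric.ball τ δ) t := by
      intro t ht
      have := (hasLogDerivWithinAt_const (m := m) (w τ) univ t).inv_mul (h t) (hball t ht)
      simpa using this.mono (subset_univ (Metric.ball τ δ))
    have h1 := (convex_ball τ δ).norm_image_sub_le_of_norm_hasDerivWithin_le (C := 0) hd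
      (fun t _ => by simp) (Metric.mem_ball_self hδ) hr
    rw [zero_mul, norm_le_zero_iff, sub_eq_zero] at h1
    have h2 := (chartOne m H).injOn (hball r hr) (hball τ (Metric.mem_ball_self hδ)) h1
    exact mul_left_cancel h2
  exact hl.apply_eq_of_isPreconnected isPreconnected_univ (mem_univ _) (mem_univ _)

end LieGroupVariationEstimate

/-! ### Pull-back of differential forms -/

section AlternatingApply

variable {E F G : Type*} [NormedAddCommGroup E] [NormedSpace ℝ E] [NormedAddCommGroup F]
  [NormedSpace ℝ F] [NormedAddCommGroup G] [NormedSpace ℝ G] {N : WithTop ℕ∞}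

theorem ContDiffWithinAt.continuousAlternatingMap_apply {k : ℕ} {f : E → F [⋀^Fin k]→L[ℝ] G}
    {v : E → Fin k → F} {s : Set E} {x : E} (hf : ContDiffWithinAt ℝ N f s x)
    (hv : ∀ i, ContDiffWithinAt ℝ N (fun y => v y i) s x) :
    ContDiffWithinAt ℝ N (fun y => f y (v y)) s x := by
  induction k with
  | zero =>
    have h1 : (fun y => f y (v y)) = fun y => ContinuousAlternatingMap.apply ℝ F G
        (Fin.elim0 : Fin 0 → F) (f y) := by
      funext y
      exact congrArg (f y) (Subsingleton.elim _ _)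
    rw [h1]
    exact (ContinuousAlternatingMap.apply ℝ F G _).contDiff.comp_contDiffWithinAt hf
  | succ k ih =>
    let l : F [⋀^Fin (k + 1)]→L[ℝ] G →ₗ[ℝ] F →L[ℝ] F [⋀^Fin k]→L[ℝ] G :=
      { toFun := fun g => g.curryLeft, map_add' := fun _ _ => rfl, map_smul' := fun _ _ => rfl }
    let c : F [⋀^Fin (k + 1)]→L[ℝ] G →L[ℝ] F →L[ℝ] F [⋀^Fin k]→L[ℝ] G :=
      ⟨l, (ContinuousAlternatingMap.curryLeftLI (𝕜 := ℝ) (E := F) (F := G) (n := k)).continuous⟩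
    have hc : ContDiff ℝ N c := ContinuousLinearMap.contDiff (𝕜 := ℝ)
      (E := F [⋀^Fin (k + 1)]→L[ℝ] G) (F := F →L[ℝ] F [⋀^Fin k]→L[ℝ] G) c
    have h1 : (fun y => f y (v y)) = fun y => (c (f y) (v y 0)) (Fin.tail (v y)) := by
      funext y
      exact congrArg (f y) (Fin.cons_self_tail (v y)).symm
    rw [h1]
    exact ih ((hc.comp_contDiffWithinAt hf).clm_apply (hv 0)) fun i => hv i.succ

end AlternatingApply

section Pullback

variable {n : ℕ} {M : Type*} [TopologicalSpace M] [ChartedSpace (EuclideanSpace ℝ (Fin n)) M]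
  [IsManifold (𝓡 n) ∞ M]
  {F : Type*} [NormedAddCommGroup F] [NormedSpace ℝ F] {k : ℕ}
  {E : Type*} [NormedAddCommGroup E] [NormedSpace ℝ E] {K : E → M} {s : Set E} {p : E}

/-- The derivative of a map from a vector space to `M`, within a set. -/
noncomputable def tangentWithin (n : ℕ) {M : Type*} [TopologicalSpace M]
    [ChartedSpace (EuclideanSpace ℝ (Fin n)) M] (K : E → M) (s : Set E) (p : E) :
    E →L[ℝ] EuclideanSpace ℝ (Fin n) :=
  mfderivWithin 𝓘(ℝ, E) (𝓡 n) K s p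

/-- The value of a form at a point, on the model space. -/
def formAt (η : DiffForm n M k F) (x : M) : EuclideanSpace ℝ (Fin n) [⋀^Fin k]→L[ℝ] F := η x

/-- The value of the exterior derivative of a form at a point, on the model space. -/
noncomputable def extDerivForm (η : DiffForm n M k F) (x : M) :
    EuclideanSpace ℝ (Fin n) [⋀^Fin (k + 1)]→L[ℝ] F := η.extDerivAt x

/-- The derivative of the preferred chart at `x₀`. -/
noncomputable def chartDeriv (n : ℕ) {M : Type*} [TopologicalSpace M]
    [ChartedSpace (EuclideanSpace ℝ (Fin n)) M] (x₀ x : M) :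
    EuclideanSpace ℝ (Fin n) →L[ℝ] EuclideanSpace ℝ (Fin n) :=
  mfderiv (𝓡 n) 𝓘(ℝ, EuclideanSpace ℝ (Fin n)) (extChartAt (𝓡 n) x₀) x

/-- The derivative of the inverse of the preferred chart at `x₀`. -/
noncomputable def chartSymmDeriv (n : ℕ) {M : Type*} [TopologicalSpace M]
    [ChartedSpace (EuclideanSpace ℝ (Fin n)) M] (x₀ : M) (y : EuclideanSpace ℝ (Fin n)) :
    EuclideanSpace ℝ (Fin n) →L[ℝ] EuclideanSpace ℝ (Fin n) :=
  mfderiv 𝓘(ℝ, EuclideanSpace ℝ (Fin n)) (𝓡 n) (extChartAt (𝓡 n) x₀).symm y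

/-- The pull-back of a form along a map defined on a subset of a vector space. -/
noncomputable def pullbackWithin (η : DiffForm n M k F) (K : E → M) (s : Set E) (p : E) :
    E [⋀^Fin k]→L[ℝ] F :=
  (formAt η (K p)).compContinuousLinearMap (tangentWithin n K s p)

theorem hasFDerivWithinAt_chart_comp (hK : ContMDiffWithinAt 𝓘(ℝ, E) (𝓡 n) ∞ K s p) {x₀ : M}
    (hp : K p ∈ (extChartAt (𝓡 n) x₀).source) :
    HasFDerivWithinAt (fun q => extChartAt (𝓡 n) x₀ (K q))
      ((chartDeriv n x₀ (K p)).comp (tangentWithin n K s p)) s p := by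
  have h1 := ((contMDiffAt_extChartAt' (I := 𝓡 n) (n := ∞) (x := x₀)
    (by rwa [← extChartAt_source (𝓡 n)])).mdifferentiableAt (by simp)).hasMFDerivAt
  exact hasMFDerivWithinAt_iff_hasFDerivWithinAt.1
    (h1.comp_hasMFDerivWithinAt p (hK.mdifferentiableWithinAt (by simp)).hasMFDerivWithinAt)

theorem contDiffWithinAt_chart_comp (hK : ContMDiffWithinAt 𝓘(ℝ, E) (𝓡 n) ∞ K s p) {x₀ : M}
    (hp : K p ∈ (extChartAt (𝓡 n) x₀).source) :
    ContDiffWithinAt ℝ ∞ (fun q => extChartAt (𝓡 n) x₀ (K q)) s p :=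
  contMDiffWithinAt_iff_contDiffWithinAt.1 ((contMDiffAt_extChartAt' (I := 𝓡 n) (n := ∞) (x := x₀)
    (by rwa [← extChartAt_source (𝓡 n)])).comp_contMDiffWithinAt p hK)

theorem mfderiv_symm_comp_mfderiv_chart {x₀ x : M} (hx : x ∈ (extChartAt (𝓡 n) x₀).source)
    (v : EuclideanSpace ℝ (Fin n)) :
    chartSymmDeriv n x₀ (extChartAt (𝓡 n) x₀ x) (chartDeriv n x₀ x v) = v := by
  have h := mfderivWithin_extChartAt_symm_comp_mfderiv_extChartAt' (I := 𝓡 n) hx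
  rw [ModelWithCorners.Boundaryless.range_eq_univ, mfderivWithin_univ] at h
  exact congrArg (fun T : EuclideanSpace ℝ (Fin n) →L[ℝ] EuclideanSpace ℝ (Fin n) => T v) h

theorem pullbackWithin_eq_formInChart (η : DiffForm n M k F)
    (hK : ContMDiffWithinAt 𝓘(ℝ, E) (𝓡 n) ∞ K s p) (hs : UniqueDiffWithinAt ℝ s p) {x₀ : M}
    (hp : K p ∈ (extChartAt (𝓡 n) x₀).source) :
    pullbackWithin η K s p = (formInChart η.toFun x₀ (extChartAt (𝓡 n) x₀ (K p))).compContinuousLinearMap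
      (fderivWithin ℝ (fun q => extChartAt (𝓡 n) x₀ (K q)) s p) := by
  rw [(hasFDerivWithinAt_chart_comp hK hp).fderivWithin hs]
  have hleft := (extChartAt (𝓡 n) x₀).left_inv hp
  ext v
  have h1 : ∀ (x : M) (_ : x = K p) (L : EuclideanSpace ℝ (Fin n) →L[ℝ] EuclideanSpace ℝ (Fin n))
      (L' : E →L[ℝ] EuclideanSpace ℝ (Fin n))
      (_ : ∀ v, L (L' v) = tangentWithin n K s p v),
      pullbackWithin η K s p v = formAt η x (fun i => L (L' (v i))) := by
    rintro x rfl L L' hL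
    simp only [hL]
    rfl
  refine h1 _ hleft _ _ fun v => ?_
  exact mfderiv_symm_comp_mfderiv_chart hp _

theorem eventually_mem_chart (hK : ContMDiffWithinAt 𝓘(ℝ, E) (𝓡 n) ∞ K s p) :
    ∀ᶠ q in 𝓝[s] p, K q ∈ (extChartAt (𝓡 n) (K p)).source :=
  hK.continuousWithinAt.eventually (extChartAt_source_mem_nhds (I := 𝓡 n) (K p))

theorem pullbackWithin_eventuallyEq (η : DiffForm n M k F)
    (hK : ContMDiffOn 𝓘(ℝ, E) (𝓡 n) ∞ K s) (hs : UniqueDiffOn ℝ s) (hp : p ∈ s) :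
    pullbackWithin η K s =ᶠ[𝓝[s] p] fun q =>
      (formInChart η.toFun (K p) (extChartAt (𝓡 n) (K p) (K q))).compContinuousLinearMap
        (fderivWithin ℝ (fun q => extChartAt (𝓡 n) (K p) (K q)) s q) := by
  filter_upwards [eventually_mem_chart (hK p hp), self_mem_nhdsWithin] with q hq hqs
  exact pullbackWithin_eq_formInChart η (hK q hqs) (hs q hqs) hq

theorem contDiffAt_formInChart (η : DiffForm n M k F) (x : M) :
    ContDiffAt ℝ ∞ (formInChart η.toFun x) (extChartAt (𝓡 n) x x) :=
  (η.smooth x).contDiffAt (extChartAt_target_mem_nhds x)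

theorem contDiffOn_pullbackWithin_apply (η : DiffForm n M k F)
    (hK : ContMDiffOn 𝓘(ℝ, E) (𝓡 n) ∞ K s) (hs : UniqueDiffOn ℝ s) (v : Fin k → E) :
    ContDiffOn ℝ ∞ (fun p => pullbackWithin η K s p v) s := by
  intro p hp
  have hx : K p ∈ (extChartAt (𝓡 n) (K p)).source := mem_extChartAt_source (K p)
  have hk := contDiffWithinAt_chart_comp (hK p hp) hx
  have h1 : ContDiffWithinAt ℝ ∞
      (fun q => formInChart η.toFun (K p) (extChartAt (𝓡 n) (K p) (K q))) s p :=
    ContDiffAt.comp_contDiffWithinAt (g := formInChart η.toFun (K p)) p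
      (contDiffAt_formInChart η (K p)) hk
  have h2 : ContDiffWithinAt ℝ ∞
      (fderivWithin ℝ (fun q => extChartAt (𝓡 n) (K p) (K q)) s) s p :=
    hk.fderivWithin_right hs (by simp) hp
  refine (h1.continuousAlternatingMap_apply (v := fun q i =>
    fderivWithin ℝ (fun q => extChartAt (𝓡 n) (K p) (K q)) s q (v i))
    fun i => h2.clm_apply contDiffWithinAt_const).congr_of_eventuallyEq_of_mem ?_ hp
  filter_upwards [pullbackWithin_eventuallyEq η hK hs hp] with q hq
  rw [hq]; rfl

theorem differentiableWithinAt_pullbackWithin (η : DiffForm n M k F)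
    (hK : ContMDiffOn 𝓘(ℝ, E) (𝓡 n) ∞ K s) (hs : UniqueDiffOn ℝ s) (hp : p ∈ s) :
    DifferentiableWithinAt ℝ (pullbackWithin η K s) s p := by
  have hk := contDiffWithinAt_chart_comp (hK p hp) (mem_extChartAt_source (K p))
  have h1 : DifferentiableWithinAt ℝ
      (fun q => formInChart η.toFun (K p) (extChartAt (𝓡 n) (K p) (K q))) s p :=
    (ContDiffAt.comp_contDiffWithinAt (g := formInChart η.toFun (K p)) p
      (contDiffAt_formInChart η (K p)) hk).differentiableWithinAt (by simp)
  have h2 : DifferentiableWithinAt ℝ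
      (fderivWithin ℝ (fun q => extChartAt (𝓡 n) (K p) (K q)) s) s p :=
    (hk.fderivWithin_right (m := ∞) hs (by simp) hp).differentiableWithinAt (by simp)
  exact (h1.continuousAlternatingMapCompContinuousLinearMap h2).congr_of_eventuallyEq_of_mem
    (pullbackWithin_eventuallyEq η hK hs hp) hp

theorem extDerivWithin_pullbackWithin (η : DiffForm n M k F)
    (hK : ContMDiffOn 𝓘(ℝ, E) (𝓡 n) ∞ K s) (hs : UniqueDiffOn ℝ s)
    (hsc : s ⊆ closure (interior s)) (hp : p ∈ s) :
    extDerivWithin (pullbackWithin η K s) s p =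
      (extDerivForm η (K p)).compContinuousLinearMap (tangentWithin n K s p) := by
  have hx : K p ∈ (extChartAt (𝓡 n) (K p)).source := mem_extChartAt_source (K p)
  have hk := contDiffWithinAt_chart_comp (hK p hp) hx
  rw [(pullbackWithin_eventuallyEq η hK hs hp).extDerivWithin_eq_of_mem hp]
  have hd : DifferentiableWithinAt ℝ (formInChart η.toFun (K p)) univ
      (extChartAt (𝓡 n) (K p) (K p)) :=
    ((contDiffAt_formInChart η (K p)).differentiableAt (by simp)).differentiableWithinAt
  have h := extDerivWithin_pullback (𝕜 := ℝ) (t := univ)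
    (f := fun q => extChartAt (𝓡 n) (K p) (K q)) (x := p) (s := s) (r := ∞) hd hk
    (by rw [minSmoothness_of_isRCLikeNormedField]; exact ENat.LEInfty.out) hs (hsc hp) hp
    (mapsTo_univ _ _)
  rw [extDerivWithin_univ] at h
  rw [h, (hasFDerivWithinAt_chart_comp (hK p hp) hx).fderivWithin (hs p hp)]
  rfl

theorem extDerivAt_mfderivWithin_one (η : DiffForm n M 1 F)
    (hK : ContMDiffOn 𝓘(ℝ, E) (𝓡 n) ∞ K s) (hs : UniqueDiffOn ℝ s)
    (hsc : s ⊆ closure (interior s)) (hp : p ∈ s) (u v : E) :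
    extDerivForm η (K p) ![tangentWithin n K s p u, tangentWithin n K s p v] =
      fderivWithin ℝ (fun q => pullbackWithin η K s q ![v]) s p u
        - fderivWithin ℝ (fun q => pullbackWithin η K s q ![u]) s p v := by
  have h := congrArg (fun T => T ![u, v]) (extDerivWithin_pullbackWithin η hK hs hsc hp)
  rw [extDerivWithin_apply (differentiableWithinAt_pullbackWithin η hK hs hp) (hs p hp)] at h
  have e1 : (fun i => tangentWithin n K s p (![u, v] i)) =
      ![tangentWithin n K s p u, tangentWithin n K s p v] := by
    funext i; fin_cases i <;> rfl
  have e2 : Fin.removeNth 0 ![u, v] = ![v] := by funext i; fin_cases i; rfl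
  have e3 : Fin.removeNth 1 ![u, v] = ![u] := by funext i; fin_cases i; rfl
  refine Eq.trans ?_ (h.symm.trans ?_)
  · exact (congrArg (extDerivForm η (K p)) e1).symm
  · simp [Fin.sum_univ_two, e2, e3, sub_eq_add_neg]

theorem extDerivAt_mfderivWithin_two (η : DiffForm n M 2 F)
    (hK : ContMDiffOn 𝓘(ℝ, E) (𝓡 n) ∞ K s) (hs : UniqueDiffOn ℝ s)
    (hsc : s ⊆ closure (interior s)) (hp : p ∈ s) (u v w : E) :
    extDerivForm η (K p) ![tangentWithin n K s p u, tangentWithin n K s p v, tangentWithin n K s p w] =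
      fderivWithin ℝ (fun q => pullbackWithin η K s q ![v, w]) s p u
        - fderivWithin ℝ (fun q => pullbackWithin η K s q ![u, w]) s p v
        + fderivWithin ℝ (fun q => pullbackWithin η K s q ![u, v]) s p w := by
  have h := congrArg (fun T => T ![u, v, w]) (extDerivWithin_pullbackWithin η hK hs hsc hp)
  rw [extDerivWithin_apply (differentiableWithinAt_pullbackWithin η hK hs hp) (hs p hp)] at h
  have e1 : (fun i => tangentWithin n K s p (![u, v, w] i)) =
      ![tangentWithin n K s p u, tangentWithin n K s p v,
        tangentWithin n K s p w] := by
    funext i; fin_cases i <;> rfl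
  have e2 : Fin.removeNth 0 ![u, v, w] = ![v, w] := by funext i; fin_cases i <;> rfl
  have e3 : Fin.removeNth 1 ![u, v, w] = ![u, w] := by funext i; fin_cases i <;> rfl
  have e4 : Fin.removeNth 2 ![u, v, w] = ![u, v] := by funext i; fin_cases i <;> rfl
  refine Eq.trans ?_ (h.symm.trans ?_)
  · exact (congrArg (extDerivForm η (K p)) e1).symm
  · simp [Fin.sum_univ_three, e2, e3, e4, sub_eq_add_neg]

end Pullback

/-! ### Path space forms in terms of pulled back forms -/

section Bridge

variable {n : ℕ} {M : Type*} [TopologicalSpace M] [ChartedSpace (EuclideanSpace ℝ (Fin n)) M]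
  {E : Type*} [NormedAddCommGroup E] [NormedSpace ℝ E] {K : E → M} {s : Set E}

theorem velocity_eq_tangentWithin {c : ℝ → M} {γ : ℝ → E} {γ' : E} {σ : ℝ}
    (hK : ContMDiffOn 𝓘(ℝ, E) (𝓡 n) ∞ K s) (hγ : HasDerivWithinAt γ γ' (Icc 0 1) σ)
    (hs : MapsTo γ (Icc 0 1) s) (hc : ∀ r ∈ Icc (0 : ℝ) 1, c r = K (γ r))
    (hσ : σ ∈ Icc (0 : ℝ) 1) :
    velocity n c σ = tangentWithin n K s (γ σ) γ' := by
  have h1 : HasMFDerivWithinAt 𝓘(ℝ, E) (𝓡 n) K s (γ σ)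
      (mfderivWithin 𝓘(ℝ, E) (𝓡 n) K s (γ σ)) :=
    ((hK _ (hs hσ)).mdifferentiableWithinAt (by simp)).hasMFDerivWithinAt
  have h2 := (h1.comp σ (hasMFDerivWithinAt_iff_hasFDerivWithinAt.2 hγ.hasFDerivWithinAt)
    hs).congr_of_eventuallyEq (f₁ := c) (Filter.eventually_of_mem self_mem_nhdsWithin hc) (hc σ hσ)
  rw [velocity, h2.mfderivWithin (uniqueMDiffWithinAt_iff_uniqueDiffWithinAt.2
    (uniqueDiffOn_Icc zero_lt_one σ hσ))]
  exact congrArg (tangentWithin n K s (γ σ)) (one_smul ℝ γ')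

theorem tangentWithin_comp {E' : Type*} [NormedAddCommGroup E'] [NormedSpace ℝ E'] {ψ : E' → E}
    {ψ' : E' →L[ℝ] E} {t : Set E'} {p : E'} (hK : ContMDiffOn 𝓘(ℝ, E) (𝓡 n) ∞ K s)
    (hψ : HasFDerivWithinAt ψ ψ' t p) (hs : MapsTo ψ t s) (ht : UniqueDiffWithinAt ℝ t p)
    (hp : p ∈ t) :
    tangentWithin n (fun q => K (ψ q)) t p = (tangentWithin n K s (ψ p)).comp ψ' := by
  have h1 : HasMFDerivWithinAt 𝓘(ℝ, E) (𝓡 n) K s (ψ p)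
      (mfderivWithin 𝓘(ℝ, E) (𝓡 n) K s (ψ p)) :=
    ((hK _ (hs hp)).mdifferentiableWithinAt (by simp)).hasMFDerivWithinAt
  exact (h1.comp p (hasMFDerivWithinAt_iff_hasFDerivWithinAt.2 hψ) hs).mfderivWithin
    (uniqueMDiffWithinAt_iff_uniqueDiffWithinAt.2 ht)

variable {𝔤 : Type*} [NormedLieRing 𝔤] [NormedLieAlgebra 𝔤] [FiniteDimensional ℝ 𝔤]

theorem parallelTransport_eq_transport {V : Type*} [NormedAddCommGroup V] [NormedSpace ℝ V]
    [FiniteDimensional ℝ V] (ρ : 𝔤 →ₗ[ℝ] Module.End ℝ V) {A : DiffForm n M 1 𝔤} {X : ℝ → M}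
    {g : ℝ → 𝔤} (hg : ∀ r ∈ Icc (0 : ℝ) 1, A (X r) ![velocity n X r] = g r) {σ : ℝ}
    (hσ : σ ∈ Icc (0 : ℝ) 1) : parallelTransport ρ A X σ = transport ρ g σ := by
  have key : ∀ k : ℕ, ∀ σ ∈ Icc (0 : ℝ) 1,
      transportTerm ρ A X k σ = orderedExpTerm (fun r => -repCLM ρ (g r)) k σ := by
    intro k
    induction k with
    | zero => intro σ _; rfl
    | succ k ih =>
      intro σ hσ
      refine intervalIntegral.integral_congr fun r hr => ?_
      rw [uIcc_of_le hσ.2] at hr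
      have hr' : r ∈ Icc (0 : ℝ) 1 := ⟨hσ.1.trans hr.1, hr.2⟩
      simp only
      rw [ih r hr', hg r hr', map_neg, map_neg]
      rfl
  exact tsum_congr fun k => key k σ hσ

variable {𝔥 : Type*} [NormedLieRing 𝔥] [NormedLieAlgebra 𝔥] [FiniteDimensional ℝ 𝔥]
  (C : DifferentialCrossedModule 𝔤 𝔥)

theorem standardConnection_eq_chenOne {A : DiffForm n M 1 𝔤} {B : DiffForm n M 2 𝔥} {X : ℝ → M}
    {v : ∀ σ, TangentSpace (𝓡 n) (X σ)} {g : ℝ → 𝔤} {q : ℝ → 𝔥}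
    (hg : ∀ r ∈ Icc (0 : ℝ) 1, A (X r) ![velocity n X r] = g r)
    (hq : ∀ r ∈ Icc (0 : ℝ) 1, B (X r) ![velocity n X r, v r] = q r) :
    standardConnection C A B X v = chenOne C g q := by
  refine intervalIntegral.integral_congr fun r hr => ?_
  rw [uIcc_of_le zero_le_one] at hr
  simp only [transportedB]
  rw [parallelTransport_eq_transport C.action hg hr, hq r hr]

theorem chenTwoForm_eq_chenTwo {A : DiffForm n M 1 𝔤} {B : DiffForm n M 2 𝔥} {X : ℝ → M}
    {v w : ∀ σ, TangentSpace (𝓡 n) (X σ)} {g fv fw : ℝ → 𝔤} {qv qw : ℝ → 𝔥}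
    (hgc : Continuous g) (hqvc : Continuous qv) (hqwc : Continuous qw)
    (hg : ∀ r ∈ Icc (0 : ℝ) 1, A (X r) ![velocity n X r] = g r)
    (hqv : ∀ r ∈ Icc (0 : ℝ) 1, B (X r) ![velocity n X r, v r] = qv r)
    (hqw : ∀ r ∈ Icc (0 : ℝ) 1, B (X r) ![velocity n X r, w r] = qw r)
    (hfv : ∀ r ∈ Icc (0 : ℝ) 1, fakeCurvature C A B (X r) (velocity n X r) (v r) = fv r)
    (hfw : ∀ r ∈ Icc (0 : ℝ) 1, fakeCurvature C A B (X r) (velocity n X r) (w r) = fw r) :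
    chenTwoForm C A B X v w = chenTwo C g fv fw qv qw := by
  refine intervalIntegral.integral_congr fun r hr => ?_
  rw [uIcc_of_le zero_le_one] at hr
  simp only [transportedFake]
  rw [parallelTransport_eq_transport (adjointAction 𝔤) hg hr, hfv r hr, hfw r hr]
  have hW := continuous_transport_self C.action hgc
  have e1 : ∀ x : 𝔤, ∀ q : ℝ → 𝔥, Continuous q →
      C.action x (∫ p in (0 : ℝ)..r, transport C.action g p (q p)) =
        ∫ p in (0 : ℝ)..r, C.action x (transport C.action g p (q p)) := fun x q hq =>
    (ContinuousLinearMap.intervalIntegral_comp_comm (repCLM C.action x)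
      ((hW.clm_apply hq).intervalIntegrable _ _)).symm
  have hc : ∀ x : 𝔤, ∀ q : ℝ → 𝔥, Continuous q →
      Continuous fun p => C.action x (transport C.action g p (q p)) := fun x q hq =>
    (repCLM C.action x).continuous.comp (hW.clm_apply hq)
  rw [e1 _ _ hqvc, e1 _ _ hqwc, ← intervalIntegral.integral_sub
    ((hc _ _ hqvc).intervalIntegrable _ _) ((hc _ _ hqwc).intervalIntegrable _ _)]
  refine intervalIntegral.integral_congr fun p hp => ?_
  rw [uIcc_of_le hr.1] at hp
  have hp' : p ∈ Icc (0 : ℝ) 1 := ⟨hp.1, hp.2.trans hr.2⟩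
  simp only [transportedB]
  rw [parallelTransport_eq_transport C.action hg hp', hqv p hp', hqw p hp']

end Bridge

section Thin

variable {n : ℕ} {𝔤 : Type*} [NormedLieRing 𝔤] [NormedLieAlgebra 𝔤] [FiniteDimensional ℝ 𝔤]
  {𝔥 : Type*} [NormedLieRing 𝔥] [NormedLieAlgebra 𝔥] [FiniteDimensional ℝ 𝔥]
  (C : DifferentialCrossedModule 𝔤 𝔥) {E : Type*} [NormedAddCommGroup E] [NormedSpace ℝ E]

theorem not_linearIndependent_of_finrank_range_lt {L : E →L[ℝ] EuclideanSpace ℝ (Fin n)}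
    (hL : Module.finrank ℝ (LinearMap.range L.toLinearMap) < 3) (u v w : E) :
    ¬ LinearIndependent ℝ ![L u, L v, L w] := by
  intro h
  have h1 := finrank_span_eq_card h
  have h2 : Submodule.span ℝ (range ![L u, L v, L w]) ≤ LinearMap.range L.toLinearMap := by
    rw [Submodule.span_le]
    rintro _ ⟨i, rfl⟩
    fin_cases i
    exacts [⟨u, rfl⟩, ⟨v, rfl⟩, ⟨w, rfl⟩]
  have h3 := Submodule.finrank_mono h2
  rw [h1, Fintype.card_fin] at h3
  omega

/-- A 1-form as a linear map. -/
def oneFormLinear {F : Type*} [NormedAddCommGroup F] [NormedSpace ℝ F]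
    (a : E [⋀^Fin 1]→L[ℝ] F) : E →ₗ[ℝ] F where
  toFun x := a ![x]
  map_add' x y := by
    have h : ∀ x : E, Function.update ![0] 0 x = ![x] := fun x => by
      funext i; fin_cases i; rfl
    have := a.map_update_add ![0] 0 x y
    rwa [h, h, h] at this
  map_smul' c x := by
    have h : ∀ x : E, Function.update ![0] 0 x = ![x] := fun x => by
      funext i; fin_cases i; rfl
    have := a.map_update_smul ![0] 0 c x
    rwa [h, h] at this

/-- A 2-form as a bilinear map. -/
def twoFormLinear {F : Type*} [NormedAddCommGroup F] [NormedSpace ℝ F]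
    (b : E [⋀^Fin 2]→L[ℝ] F) : E →ₗ[ℝ] E →ₗ[ℝ] F :=
  have h0 : ∀ x z : E, Function.update ![0, z] 0 x = ![x, z] := fun x z => by
    funext i; fin_cases i <;> rfl
  have h1 : ∀ x z : E, Function.update ![x, 0] 1 z = ![x, z] := fun x z => by
    funext i; fin_cases i <;> rfl
  LinearMap.mk₂ ℝ (fun x y => b ![x, y])
    (fun x y z => by
      have := b.map_update_add ![0, z] 0 x y
      rwa [h0, h0, h0] at this)
    (fun c x y => by
      have := b.map_update_smul ![0, y] 0 c x
      rwa [h0, h0] at this)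
    (fun x y z => by
      have := b.map_update_add ![x, 0] 1 y z
      rwa [h1, h1, h1] at this)
    (fun c x y => by
      have := b.map_update_smul ![x, 0] 1 c y
      rwa [h1, h1] at this)

theorem twoFormLinear_apply {F : Type*} [NormedAddCommGroup F] [NormedSpace ℝ F]
    (b : E [⋀^Fin 2]→L[ℝ] F) (x y : E) : twoFormLinear b x y = b ![x, y] := rfl

theorem alternate_action_eq_zero (a : EuclideanSpace ℝ (Fin n) [⋀^Fin 1]→L[ℝ] 𝔤)
    (b : EuclideanSpace ℝ (Fin n) [⋀^Fin 2]→L[ℝ] 𝔥) {U V W : EuclideanSpace ℝ (Fin n)}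
    (h : ¬ LinearIndependent ℝ ![U, V, W]) :
    C.action (a ![U]) (b ![V, W]) - C.action (a ![V]) (b ![U, W])
      + C.action (a ![W]) (b ![U, V]) = 0 := by
  set a' := oneFormLinear a
  set b' := twoFormLinear b
  have hb0 : ∀ x, b' x x = 0 := fun x =>
    b.map_eq_zero_of_eq ![x, x] (i := 0) (j := 1) rfl (by decide)
  have hb1 : ∀ x y, b' x y = -b' y x := fun x y => by
    have := hb0 (x + y)
    simp only [map_add, LinearMap.add_apply, hb0, zero_add, add_zero] at this
    exact eq_neg_of_add_eq_zero_right this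
  change C.action (a' U) (b' V W) - C.action (a' V) (b' U W) + C.action (a' W) (b' U V) = 0
  obtain ⟨g, hg, i, hi⟩ := Fintype.not_linearIndependent_iff.1 h
  simp only [Fin.sum_univ_three, Matrix.cons_val_zero, Matrix.cons_val_one, Matrix.cons_val] at hg
  have hsolve : ∀ {c d e : ℝ} {x y z : EuclideanSpace ℝ (Fin n)}, c ≠ 0 →
      c • x + d • y + e • z = 0 → x = (-(d / c)) • y + (-(e / c)) • z := by
    intro c d e x y z hc h
    have h1 : c • x = -(d • y + e • z) := by
      rw [eq_neg_iff_add_eq_zero, ← add_assoc]; exact h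
    rw [← inv_smul_smul₀ hc x, h1]
    module
  fin_cases i
  · rw [hsolve (c := g 0) hi hg]
    simp only [map_add, map_smul, LinearMap.add_apply, LinearMap.smul_apply, hb0, hb1 W V, smul_neg,
      map_neg, map_zero]
    module
  · rw [hsolve (c := g 1) (d := g 0) (e := g 2) (x := V) (y := U) (z := W) hi
      (by rw [← hg]; module)]
    simp only [map_add, map_smul, LinearMap.add_apply, LinearMap.smul_apply, hb0, map_zero]
    module
  · rw [hsolve (c := g 2) (d := g 0) (e := g 1) (x := W) (y := U) (z := V) hi
      (by rw [← hg]; module)]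
    simp only [map_add, map_smul, LinearMap.add_apply, LinearMap.smul_apply, hb0, hb1 V U, smul_neg,
      map_neg, map_zero]
    module

end Thin

/-! ### Families of paths -/

section FormsAlong

variable {n : ℕ} {M : Type*} [TopologicalSpace M] [ChartedSpace (EuclideanSpace ℝ (Fin n)) M]
  {𝔤 : Type*} [NormedLieRing 𝔤] [NormedLieAlgebra 𝔤] [FiniteDimensional ℝ 𝔤]
  {𝔥 : Type*} [NormedLieRing 𝔥] [NormedLieAlgebra 𝔥] [FiniteDimensional ℝ 𝔥]
  (C : DifferentialCrossedModule 𝔤 𝔥) (A : DiffForm n M 1 𝔤) (B : DiffForm n M 2 𝔥)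
  {E : Type*} [NormedAddCommGroup E] [NormedSpace ℝ E]

/-- The pull-back of the curvature of `A` along a map. -/
noncomputable def curvatureWithin (K : E → M) (s : Set E) (u v p : E) : 𝔤 :=
  twoFormLinear (extDerivForm A (K p)) (tangentWithin n K s p u) (tangentWithin n K s p v) +
    ⁅oneFormLinear (formAt A (K p)) (tangentWithin n K s p u),
      oneFormLinear (formAt A (K p)) (tangentWithin n K s p v)⁆

/-- The pull-back of the 2-form `F_A + dt(B)` along a map. -/
noncomputable def fakeWithin (K : E → M) (s : Set E) (u v p : E) : 𝔤 :=
  curvatureWithin A K s u v p +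
    C.dt (twoFormLinear (formAt B (K p)) (tangentWithin n K s p u) (tangentWithin n K s p v))

/-- The pull-back of a 1-form along a map, on a vector. -/
noncomputable def oneWithin {F : Type*} [NormedAddCommGroup F] [NormedSpace ℝ F]
    (A : DiffForm n M 1 F) (K : E → M) (s : Set E) (u p : E) : F :=
  oneFormLinear (formAt A (K p)) (tangentWithin n K s p u)

/-- The pull-back of a 2-form along a map, on two vectors. -/
noncomputable def twoWithin {F : Type*} [NormedAddCommGroup F] [NormedSpace ℝ F]
    (B : DiffForm n M 2 F) (K : E → M) (s : Set E) (u v p : E) : F :=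
  twoFormLinear (formAt B (K p)) (tangentWithin n K s p u) (tangentWithin n K s p v)

theorem oneWithin_eq {F : Type*} [NormedAddCommGroup F] [NormedSpace ℝ F]
    (A : DiffForm n M 1 F) (K : E → M) (s : Set E) (u p : E) :
    oneWithin A K s u p = pullbackWithin A K s p ![u] := by
  refine congrArg (formAt A (K p)) ?_
  funext i; fin_cases i; rfl

theorem twoWithin_eq {F : Type*} [NormedAddCommGroup F] [NormedSpace ℝ F]
    (B : DiffForm n M 2 F) (K : E → M) (s : Set E) (u v p : E) :
    twoWithin B K s u v p = pullbackWithin B K s p ![u, v] := by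
  refine congrArg (formAt B (K p)) ?_
  funext i; fin_cases i <;> rfl

variable [IsManifold (𝓡 n) ∞ M] {K : E → M} {s : Set E}

theorem contDiffOn_oneWithin {F : Type*} [NormedAddCommGroup F] [NormedSpace ℝ F]
    (A : DiffForm n M 1 F) (hK : ContMDiffOn 𝓘(ℝ, E) (𝓡 n) ∞ K s) (hs : UniqueDiffOn ℝ s) (u : E) :
    ContDiffOn ℝ ∞ (oneWithin A K s u) s :=
  (contDiffOn_pullbackWithin_apply A hK hs ![u]).congr fun p _ => oneWithin_eq A K s u p

theorem contDiffOn_twoWithin {F : Type*} [NormedAddCommGroup F] [NormedSpace ℝ F]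
    (B : DiffForm n M 2 F) (hK : ContMDiffOn 𝓘(ℝ, E) (𝓡 n) ∞ K s) (hs : UniqueDiffOn ℝ s)
    (u v : E) : ContDiffOn ℝ ∞ (twoWithin B K s u v) s :=
  (contDiffOn_pullbackWithin_apply B hK hs ![u, v]).congr fun p _ => twoWithin_eq B K s u v p

theorem curvatureWithin_eq (hK : ContMDiffOn 𝓘(ℝ, E) (𝓡 n) ∞ K s) (hs : UniqueDiffOn ℝ s)
    (hsc : s ⊆ closure (interior s)) {p : E} (hp : p ∈ s) (u v : E) :
    curvatureWithin A K s u v p = fderivWithin ℝ (oneWithin A K s v) s p u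
      - fderivWithin ℝ (oneWithin A K s u) s p v + ⁅oneWithin A K s u p, oneWithin A K s v p⁆ := by
  have h := extDerivAt_mfderivWithin_one A hK hs hsc hp u v
  have e : ∀ u, oneWithin A K s u = fun q => pullbackWithin A K s q ![u] := fun u =>
    funext fun q => oneWithin_eq A K s u q
  rw [e u, e v, ← h, curvatureWithin, twoFormLinear_apply, ← e u, ← e v]
  congr 1

theorem continuousOn_curvatureWithin (hK : ContMDiffOn 𝓘(ℝ, E) (𝓡 n) ∞ K s)
    (hs : UniqueDiffOn ℝ s) (hsc : s ⊆ closure (interior s)) (u v : E) :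
    ContinuousOn (curvatureWithin A K s u v) s := by
  have h1 := contDiffOn_oneWithin A hK hs u
  have h2 := contDiffOn_oneWithin A hK hs v
  have h3 : ContinuousOn (fun p => ⁅oneWithin A K s u p, oneWithin A K s v p⁆) s :=
    ((repCLM (adjointAction 𝔤)).continuous.comp_continuousOn h1.continuousOn).clm_apply
      h2.continuousOn
  exact ((((h2.continuousOn_fderivWithin hs (by simp)).clm_apply continuousOn_const).sub
    ((h1.continuousOn_fderivWithin hs (by simp)).clm_apply continuousOn_const)).add h3).congr
    fun p hp => curvatureWithin_eq A hK hs hsc hp u v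

theorem continuousOn_fakeWithin (hK : ContMDiffOn 𝓘(ℝ, E) (𝓡 n) ∞ K s)
    (hs : UniqueDiffOn ℝ s) (hsc : s ⊆ closure (interior s)) (u v : E) :
    ContinuousOn (fakeWithin C A B K s u v) s :=
  (continuousOn_curvatureWithin A hK hs hsc u v).add
    ((LinearMap.toContinuousLinearMap C.dt.toLinearMap).continuous.comp_continuousOn
      (contDiffOn_twoWithin B hK hs u v).continuousOn)

theorem fderivWithin_twoWithin_of_thin (hK : ContMDiffOn 𝓘(ℝ, E) (𝓡 n) ∞ K s)
    (hs : UniqueDiffOn ℝ s) (hsc : s ⊆ closure (interior s)) {p : E} (hp : p ∈ s)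
    (hthin : Module.finrank ℝ (LinearMap.range (tangentWithin n K s p).toLinearMap) < 3)
    (u v w : E) :
    fderivWithin ℝ (twoWithin B K s v w) s p u - fderivWithin ℝ (twoWithin B K s u w) s p v
      + fderivWithin ℝ (twoWithin B K s u v) s p w
      + C.action (oneWithin A K s u p) (twoWithin B K s v w p)
      - C.action (oneWithin A K s v p) (twoWithin B K s u w p)
      + C.action (oneWithin A K s w p) (twoWithin B K s u v p) = 0 := by
  have h := extDerivAt_mfderivWithin_two B hK hs hsc hp u v w
  have e : ∀ u v, twoWithin B K s u v = fun q => pullbackWithin B K s q ![u, v] := fun u v =>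
    funext fun q => twoWithin_eq B K s u v q
  have hd := not_linearIndependent_of_finrank_range_lt hthin u v w
  have h0 := (extDerivForm B (K p)).toAlternatingMap.map_linearDependent _ hd
  have h1 := alternate_action_eq_zero C (formAt A (K p)) (formAt B (K p)) hd
  have h2 : fderivWithin ℝ (twoWithin B K s v w) s p u - fderivWithin ℝ (twoWithin B K s u w) s p v
      + fderivWithin ℝ (twoWithin B K s u v) s p w = 0 := by
    rw [e, e, e]; exact h.symm.trans h0
  rw [h2, zero_add]
  exact h1

end FormsAlong

section Families

variable {n : ℕ} {M : Type*} [TopologicalSpace M] [ChartedSpace (EuclideanSpace ℝ (Fin n)) M]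
  {𝔤 : Type*} [NormedLieRing 𝔤] [NormedLieAlgebra 𝔤] [FiniteDimensional ℝ 𝔤]
  {𝔥 : Type*} [NormedLieRing 𝔥] [NormedLieAlgebra 𝔥] [FiniteDimensional ℝ 𝔥]
  (C : DifferentialCrossedModule 𝔤 𝔥) (A : DiffForm n M 1 𝔤) (B : DiffForm n M 2 𝔥)
  (K : ℝ × ℝ × ℝ → M)

/-- The pull-back of the path space connection along a two-parameter family of paths. -/
noncomputable def pathForm (w p : ℝ × ℝ) : 𝔥 :=
  chenOne C (fun σ => oneWithin A K univ (1, 0) (σ, p))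
    (fun σ => twoWithin B K univ (1, 0) (0, w) (σ, p))

/-- The derivative of `pathForm w` in the direction `v`. -/
noncomputable def pathVariation (v w p : ℝ × ℝ) : 𝔥 :=
  chenOneVariation C (fun σ => oneWithin A K univ (1, 0) (σ, p))
    (fun σ => oneWithin A K univ (0, v) (σ, p))
    (fun σ => curvatureWithin A K univ (1, 0) (0, v) (σ, p))
    (fun σ => twoWithin B K univ (1, 0) (0, w) (σ, p))
    (fun σ => fderiv ℝ (twoWithin B K univ (1, 0) (0, w)) (σ, p) (0, v))

/-- The pull-back of the path space 2-form along a two-parameter family of paths. -/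
noncomputable def pathChen (v w p : ℝ × ℝ) : 𝔥 :=
  chenTwo C (fun σ => oneWithin A K univ (1, 0) (σ, p))
    (fun σ => fakeWithin C A B K univ (1, 0) (0, v) (σ, p))
    (fun σ => fakeWithin C A B K univ (1, 0) (0, w) (σ, p))
    (fun σ => twoWithin B K univ (1, 0) (0, v) (σ, p))
    (fun σ => twoWithin B K univ (1, 0) (0, w) (σ, p))

variable [IsManifold (𝓡 n) ∞ M] {K}

theorem contDiff_oneWithin {F : Type*} [NormedAddCommGroup F] [NormedSpace ℝ F]
    (A : DiffForm n M 1 F) (hK : ContMDiff 𝓘(ℝ, ℝ × ℝ × ℝ) (𝓡 n) ∞ K) (u : ℝ × ℝ × ℝ) :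
    ContDiff ℝ ∞ (oneWithin A K univ u) :=
  contDiffOn_univ.1 (contDiffOn_oneWithin A hK.contMDiffOn uniqueDiffOn_univ u)

theorem contDiff_twoWithin {F : Type*} [NormedAddCommGroup F] [NormedSpace ℝ F]
    (B : DiffForm n M 2 F) (hK : ContMDiff 𝓘(ℝ, ℝ × ℝ × ℝ) (𝓡 n) ∞ K) (u v : ℝ × ℝ × ℝ) :
    ContDiff ℝ ∞ (twoWithin B K univ u v) :=
  contDiffOn_univ.1 (contDiffOn_twoWithin B hK.contMDiffOn uniqueDiffOn_univ u v)

theorem continuous_curvatureWithin (hK : ContMDiff 𝓘(ℝ, ℝ × ℝ × ℝ) (𝓡 n) ∞ K)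
    (u v : ℝ × ℝ × ℝ) : Continuous (curvatureWithin A K univ u v) :=
  continuousOn_univ.1 (continuousOn_curvatureWithin A hK.contMDiffOn uniqueDiffOn_univ (by simp) u v)

theorem continuous_fakeWithin (hK : ContMDiff 𝓘(ℝ, ℝ × ℝ × ℝ) (𝓡 n) ∞ K)
    (u v : ℝ × ℝ × ℝ) : Continuous (fakeWithin C A B K univ u v) :=
  continuousOn_univ.1 (continuousOn_fakeWithin C A B hK.contMDiffOn uniqueDiffOn_univ (by simp) u v)

theorem continuous_fderiv_apply_const {F G : Type*} [NormedAddCommGroup F] [NormedSpace ℝ F]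
    [NormedAddCommGroup G] [NormedSpace ℝ G] {f : F → G} (hf : ContDiff ℝ ∞ f) (v : F) :
    Continuous fun p => fderiv ℝ f p v :=
  (hf.continuous_fderiv (by simp)).clm_apply continuous_const

theorem continuous_slice {X : Type*} [TopologicalSpace X] {f : ℝ × ℝ × ℝ → X} (hf : Continuous f) :
    Continuous (uncurry fun (p : ℝ × ℝ) (σ : ℝ) => f (σ, p)) :=
  hf.comp (f := fun q : (ℝ × ℝ) × ℝ => (q.2, q.1)) (by fun_prop)

theorem continuous_slice_line {X : Type*} [TopologicalSpace X] {γ : ℝ → ℝ × ℝ} (hγ : Continuous γ)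
    {f : ℝ × ℝ × ℝ → X} (hf : Continuous f) : Continuous (uncurry fun l σ => f (σ, γ l)) :=
  hf.comp (f := fun q : ℝ × ℝ => (q.2, γ q.1)) (by fun_prop)

theorem continuous_slice_point {X : Type*} [TopologicalSpace X] (p : ℝ × ℝ) {f : ℝ × ℝ × ℝ → X}
    (hf : Continuous f) : Continuous (fun σ => f (σ, p)) :=
  hf.comp (f := fun σ : ℝ => (σ, p)) (by fun_prop)

theorem continuous_pathForm (hK : ContMDiff 𝓘(ℝ, ℝ × ℝ × ℝ) (𝓡 n) ∞ K) (w : ℝ × ℝ) :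
    Continuous (pathForm C A B K w) :=
  continuous_chenOne C (continuous_slice (contDiff_oneWithin A hK _).continuous)
    (continuous_slice (contDiff_twoWithin B hK _ _).continuous)

theorem continuous_pathVariation (hK : ContMDiff 𝓘(ℝ, ℝ × ℝ × ℝ) (𝓡 n) ∞ K) (v w : ℝ × ℝ) :
    Continuous (pathVariation C A B K v w) :=
  continuous_chenOneVariation C (continuous_slice (contDiff_oneWithin A hK _).continuous)
    (continuous_slice (contDiff_oneWithin A hK _).continuous)
    (continuous_slice (continuous_curvatureWithin A hK _ _))
    (continuous_slice (contDiff_twoWithin B hK _ _).continuous)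
    (continuous_slice (continuous_fderiv_apply_const (contDiff_twoWithin B hK _ _) _))

theorem continuous_pathChen (hK : ContMDiff 𝓘(ℝ, ℝ × ℝ × ℝ) (𝓡 n) ∞ K) (v w : ℝ × ℝ) :
    Continuous (pathChen C A B K v w) :=
  continuous_chenTwo C (continuous_slice (contDiff_oneWithin A hK _).continuous)
    (continuous_slice (continuous_fakeWithin C A B hK _ _))
    (continuous_slice (continuous_fakeWithin C A B hK _ _))
    (continuous_slice (contDiff_twoWithin B hK _ _).continuous)
    (continuous_slice (contDiff_twoWithin B hK _ _).continuous)

theorem hasDerivAt_line {F G : Type*} [NormedAddCommGroup F] [NormedSpace ℝ F]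
    [NormedAddCommGroup G] [NormedSpace ℝ G] {f : F → G} (hf : ContDiff ℝ ∞ f) {γ : ℝ → F} {v : F}
    {l : ℝ} (hγ : HasDerivAt γ v l) : HasDerivAt (fun l => f (γ l)) (fderiv ℝ f (γ l) v) l :=
  ((hf.differentiable (by simp)) (γ l)).hasFDerivAt.comp_hasDerivAt l hγ

theorem hasDerivAt_pathForm (hK : ContMDiff 𝓘(ℝ, ℝ × ℝ × ℝ) (𝓡 n) ∞ K)
    (h1 : ∀ p w : ℝ × ℝ, tangentWithin n K univ (1, p) (0, w) = 0) (v w : ℝ × ℝ)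
    {γ : ℝ → ℝ × ℝ} (hγ : ∀ l, HasDerivAt γ v l) (l : ℝ) :
    HasDerivAt (fun l => pathForm C A B K w (γ l)) (pathVariation C A B K v w (γ l)) l := by
  have hγc : Continuous γ := continuous_iff_continuousAt.2 fun l => (hγ l).continuousAt
  have hl : ∀ l r, HasDerivAt (fun l => (r, γ l)) ((0 : ℝ), v) l := fun l r =>
    (hasDerivAt_const l r).prodMk (hγ l)
  have hr : ∀ l r, HasDerivAt (fun r => (r, γ l)) ((1 : ℝ), (0 : ℝ × ℝ)) r := fun l r =>
    (hasDerivAt_id r).prodMk (hasDerivAt_const r _)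
  have ha := contDiff_oneWithin A hK (1, 0)
  have hav := contDiff_oneWithin A hK (0, v)
  have hb := contDiff_twoWithin B hK (1, 0) (0, w)
  convert! hasDerivAt_chenOne C (continuous_slice_line hγc ha.continuous) (continuous_slice_line hγc hav.continuous)
    (continuous_slice_line hγc (continuous_fderiv_apply_const ha (0, v)))
    (continuous_slice_line hγc (continuous_fderiv_apply_const hav (1, 0))) (continuous_slice_line hγc hb.continuous)
    (continuous_slice_line hγc (continuous_fderiv_apply_const hb (0, v)))
    (fun l r => hasDerivAt_line ha (hl l r)) (fun l r => hasDerivAt_line hav (hr l r)) (fun l => ?_)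
    (fun l r => hasDerivAt_line hb (hl l r)) l using 1
  · rw [pathVariation]
    congr 1
    funext σ
    rw [curvatureWithin_eq A hK.contMDiffOn uniqueDiffOn_univ (by simp) (mem_univ _),
      fderivWithin_univ, fderivWithin_univ]
  · rw [oneWithin, h1, map_zero]

theorem pathVariation_sub_add_lie (hK : ContMDiff 𝓘(ℝ, ℝ × ℝ × ℝ) (𝓡 n) ∞ K)
    (h0 : ∀ p w : ℝ × ℝ, tangentWithin n K univ (0, p) (0, w) = 0)
    (h1 : ∀ p w : ℝ × ℝ, tangentWithin n K univ (1, p) (0, w) = 0)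
    (hthin : ∀ p, Module.finrank ℝ (LinearMap.range (tangentWithin n K univ p).toLinearMap) < 3)
    (v w p : ℝ × ℝ) :
    pathVariation C A B K v w p - pathVariation C A B K w v p
      + ⁅pathForm C A B K v p, pathForm C A B K w p⁆ = - pathChen C A B K v w p := by
  have hr : ∀ r, HasDerivAt (fun r => (r, p)) ((1 : ℝ), (0 : ℝ × ℝ)) r := fun r =>
    (hasDerivAt_id r).prodMk (hasDerivAt_const r _)
  have hb := fun u v => contDiff_twoWithin B hK u v
  have ha := fun u => continuous_slice_point p (contDiff_oneWithin A hK u).continuous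
  refine chenOneVariation_sub_add_lie C (ha _) (ha _) (ha _)
    (continuous_slice_point p (continuous_curvatureWithin A hK _ _)) (continuous_slice_point p (continuous_curvatureWithin A hK _ _))
    (continuous_slice_point p (hb _ _).continuous) (continuous_slice_point p (hb _ _).continuous)
    (continuous_slice_point p (continuous_fderiv_apply_const (hb _ _) _)) (continuous_slice_point p (continuous_fderiv_apply_const (hb _ _) _))
    (continuous_slice_point p (continuous_fderiv_apply_const (hb (0, v) (0, w)) (1, 0)))
    (r := fun σ => twoWithin B K univ (0, v) (0, w) (σ, p))
    (fun σ => hasDerivAt_line (hb (0, v) (0, w)) (hr σ)) ?_ ?_ fun σ _ => ?_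
  · rw [twoWithin, h0, map_zero, LinearMap.zero_apply]
  · rw [twoWithin, h1, map_zero, LinearMap.zero_apply]
  · have := fderivWithin_twoWithin_of_thin C A B hK.contMDiffOn uniqueDiffOn_univ (by simp)
      (mem_univ (σ, p)) (hthin (σ, p)) (1, 0) (0, v) (0, w)
    simpa only [fderivWithin_univ] using this

end Families

/-! ### Holonomy of families of bigons -/

section FormCongr

variable {n : ℕ} {M : Type*} [TopologicalSpace M] [ChartedSpace (EuclideanSpace ℝ (Fin n)) M]

theorem oneForm_congr {F : Type*} [NormedAddCommGroup F] [NormedSpace ℝ F] (A : DiffForm n M 1 F)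
    {x y : M} (hxy : x = y) {v : TangentSpace (𝓡 n) x} {v' : EuclideanSpace ℝ (Fin n)}
    (hv : v = v') : A x ![v] = oneFormLinear (formAt A y) v' := by
  subst hxy hv; rfl

theorem twoForm_congr {F : Type*} [NormedAddCommGroup F] [NormedSpace ℝ F] (B : DiffForm n M 2 F)
    {x y : M} (hxy : x = y) {v w : TangentSpace (𝓡 n) x} {v' w' : EuclideanSpace ℝ (Fin n)}
    (hv : v = v') (hw : w = w') : B x ![v, w] = twoFormLinear (formAt B y) v' w' := by
  subst hxy hv hw; rfl

theorem fakeCurvature_congr {𝔤 : Type*} [NormedLieRing 𝔤] [NormedLieAlgebra 𝔤]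
    {𝔥 : Type*} [NormedLieRing 𝔥] [NormedLieAlgebra 𝔥] (C : DifferentialCrossedModule 𝔤 𝔥)
    (A : DiffForm n M 1 𝔤) (B : DiffForm n M 2 𝔥)
    {x y : M} (hxy : x = y) {v w : TangentSpace (𝓡 n) x} {v' w' : EuclideanSpace ℝ (Fin n)}
    (hv : v = v') (hw : w = w') : fakeCurvature C A B x v w =
      twoFormLinear (extDerivForm A y) v' w' +
        ⁅oneFormLinear (formAt A y) v', oneFormLinear (formAt A y) w'⁆ +
        C.dt (twoFormLinear (formAt B y) v' w') := by
  subst hxy hv hw; rfl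

end FormCongr

section HolonomyFamily

variable {n m : ℕ} {M : Type*} [TopologicalSpace M] [ChartedSpace (EuclideanSpace ℝ (Fin n)) M]
  {𝔤 : Type*} [NormedLieRing 𝔤] [NormedLieAlgebra 𝔤] [FiniteDimensional ℝ 𝔤]
  {𝔥 : Type*} [NormedLieRing 𝔥] [NormedLieAlgebra 𝔥] [FiniteDimensional ℝ 𝔥]
  (C : DifferentialCrossedModule 𝔤 𝔥) (A : DiffForm n M 1 𝔤) (B : DiffForm n M 2 𝔥)
  {K : ℝ × ℝ × ℝ → M}

theorem standardConnection_eq_pathForm (hK : ContMDiff 𝓘(ℝ, ℝ × ℝ × ℝ) (𝓡 n) ∞ K)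
    {S : ℝ → ℝ → M} {ν : ℝ}
    (hS : ∀ σ ∈ Icc (0 : ℝ) 1, ∀ τ ∈ Icc (0 : ℝ) 1, S σ τ = K (σ, τ, ν)) {τ : ℝ}
    (hτ : τ ∈ Icc (0 : ℝ) 1) :
    standardConnection C A B (fun σ => S σ τ) (pathTangent n S τ) =
      pathForm C A B K (1, 0) (τ, ν) := by
  have hv : ∀ r ∈ Icc (0 : ℝ) 1, velocity n (fun σ => S σ τ) r =
      tangentWithin n K univ (r, τ, ν) (1, 0, 0) := fun r hr =>
    velocity_eq_tangentWithin (γ := fun σ => (σ, τ, ν)) hK.contMDiffOn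
      ((hasDerivAt_id r).prodMk (hasDerivAt_const r (τ, ν))).hasDerivWithinAt (mapsTo_univ _ _)
      (fun σ hσ => hS σ hσ τ hτ) hr
  have hw : ∀ r ∈ Icc (0 : ℝ) 1, pathTangent n S τ r =
      tangentWithin n K univ (r, τ, ν) (0, 1, 0) := fun r hr =>
    velocity_eq_tangentWithin (γ := fun τ => (r, τ, ν)) hK.contMDiffOn
      ((hasDerivAt_const τ r).prodMk
        ((hasDerivAt_id τ).prodMk (hasDerivAt_const τ ν))).hasDerivWithinAt (mapsTo_univ _ _)
      (fun τ hτ => hS r hr τ hτ) hτ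
  exact standardConnection_eq_chenOne C
    (fun r hr => oneForm_congr A (hS r hr τ hτ) (hv r hr))
    (fun r hr => twoForm_congr B (hS r hr τ hτ) (hv r hr) (hw r hr))

variable [IsManifold (𝓡 n) ∞ M]
  {H : Type*} [TopologicalSpace H] [ChartedSpace (EuclideanSpace ℝ (Fin m)) H]
  [Group H]

theorem IsPathOrderedExp.congr {f g : ℝ → GroupLieAlgebra (𝓡 m) H} {h : H}
    (hf : IsPathOrderedExp f h) (hfg : ∀ τ ∈ Icc (0 : ℝ) 1, f τ = g τ) : IsPathOrderedExp g h := by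
  obtain ⟨w, h0, h1, hw⟩ := hf
  exact ⟨w, h0, h1, fun τ hτ => ⟨(hw τ hτ).1, by rw [← hfg τ hτ]; exact (hw τ hτ).2⟩⟩

variable [LieGroup (𝓡 m) ∞ H] (φ : 𝔥 ≃ₗ⁅ℝ⁆ GroupLieAlgebra (𝓡 m) H)

/-- The identification of `𝔥` with the model space of `H`. -/
noncomputable def modelEquiv : 𝔥 ≃L[ℝ] EuclideanSpace ℝ (Fin m) :=
  LinearEquiv.toContinuousLinearEquiv (F := EuclideanSpace ℝ (Fin m)) φ.toLinearEquiv

theorem modelEquiv_lie (x z : 𝔥) : modelEquiv φ ⁅x, z⁆ =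
    fderiv ℝ (leftField m H) (chartBase m H) (modelEquiv φ x) (modelEquiv φ z)
      - fderiv ℝ (leftField m H) (chartBase m H) (modelEquiv φ z) (modelEquiv φ x) :=
  (LieEquiv.map_lie φ x z).trans (bracket_groupLieAlgebra (φ x) (φ z))

/-- The logarithmic derivative of the holonomy of a thin family of bigons. -/
theorem hasLogDerivWithinAt_holonomy [T2Space H] (hK : ContMDiff 𝓘(ℝ, ℝ × ℝ × ℝ) (𝓡 n) ∞ K)
    (h0 : ∀ p w : ℝ × ℝ, tangentWithin n K univ (0, p) (0, w) = 0)
    (h1 : ∀ p w : ℝ × ℝ, tangentWithin n K univ (1, p) (0, w) = 0)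
    (hthin : ∀ p, Module.finrank ℝ (LinearMap.range (tangentWithin n K univ p).toLinearMap) < 3)
    (h2 : ∀ σ ν, tangentWithin n K univ (σ, 0, ν) (0, 0, 1) = 0)
    (h3 : ∀ σ ν, tangentWithin n K univ (σ, 1, ν) (0, 0, 1) = 0)
    {w : ℝ → ℝ → H} (hw0 : ∀ ν, w ν 0 = 1)
    (hw : ∀ ν, ∀ τ ∈ Icc (0 : ℝ) 1, HasLogDerivWithinAt (w ν)
      (modelEquiv φ (pathForm C A B K (1, 0) (τ, ν))) (Icc 0 1) τ) (ν₀ : ℝ) :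
    HasLogDerivWithinAt (fun ν => w ν 1) (modelEquiv φ (∫ τ in (0 : ℝ)..1,
      transport (adjointAction 𝔥) (fun τ => pathForm C A B K (1, 0) (τ, ν₀)) τ
        (pathChen C A B K (1, 0) (0, 1) (τ, ν₀)))) univ ν₀ := by
  set f : ℝ → 𝔥 := fun τ => pathForm C A B K (1, 0) (τ, ν₀) with hf
  set b : ℝ → 𝔥 := fun τ => pathForm C A B K (0, 1) (τ, ν₀) with hb
  set κ : ℝ → 𝔥 := fun τ => pathChen C A B K (1, 0) (0, 1) (τ, ν₀) with hκ
  have hsw : ∀ {X : Type _} [TopologicalSpace X] {g : ℝ × ℝ → X}, Continuous g →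
      Continuous (uncurry fun ν τ => g (τ, ν)) := fun hg =>
    hg.comp (f := fun q : ℝ × ℝ => (q.2, q.1)) (by fun_prop)
  have hfc : Continuous f := (continuous_pathForm C A B hK (1, 0)).comp (by fun_prop)
  have hκc : Continuous κ := (continuous_pathChen C A B hK (1, 0) (0, 1)).comp (by fun_prop)
  set P := transport (adjointAction 𝔥) f
  set Q := transportInv (adjointAction 𝔥) f
  have hPc : Continuous fun τ => P τ (κ τ) :=
    (continuous_transport_self (adjointAction 𝔥) hfc).clm_apply hκc
  set J : ℝ → 𝔥 := fun τ => ∫ t in (0 : ℝ)..τ, P t (κ t)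
  have hJ : ∀ τ, HasDerivAt J (P τ (κ τ)) τ := fun τ =>
    intervalIntegral.integral_hasDerivAt_right (hPc.intervalIntegrable _ _)
      (hPc.stronglyMeasurableAtFilter _ _) hPc.continuousAt
  set η : ℝ → 𝔥 := fun τ => Q τ (J τ)
  have hη : ∀ τ, HasDerivAt η (⁅η τ, f τ⁆ + κ τ) τ := by
    intro τ
    convert! (hasDerivAt_transportInv (adjointAction 𝔥) hfc τ).clm_apply (hJ τ) using 1
    rw [transportInv_transport_apply (adjointAction 𝔥) hfc]
    congr 1
    exact (lie_skew (η τ) (f τ)).symm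
  have hb' : ∀ τ, HasDerivAt b (pathVariation C A B K (0, 1) (1, 0) (τ, ν₀) + ⁅b τ, f τ⁆ - κ τ) τ := by
    intro τ
    have h4 := hasDerivAt_pathForm C A B hK h1 (1, 0) (0, 1) (γ := fun τ => (τ, ν₀))
      (fun l => (hasDerivAt_id l).prodMk (hasDerivAt_const l ν₀)) τ
    have h5 := pathVariation_sub_add_lie C A B hK h0 h1 hthin (1, 0) (0, 1) (τ, ν₀)
    convert! h4 using 1
    have h6 : ⁅b τ, f τ⁆ = -⁅f τ, b τ⁆ := (lie_skew (b τ) (f τ)).symm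
    change _ - _ + ⁅f τ, b τ⁆ = - κ τ at h5
    rw [h6, sub_eq_iff_eq_add, ← sub_eq_iff_eq_add', ← neg_eq_iff_eq_neg.2 h5]
    abel
  have hz : ∀ τ, (∀ σ, tangentWithin n K univ (σ, τ, ν₀) (0, 0, 1) = 0) → b τ = 0 := by
    intro τ h
    have : (fun σ => twoWithin B K univ (1, 0) (0, (0, 1)) (σ, τ, ν₀)) = fun _ => 0 := by
      funext σ
      rw [twoWithin]
      exact (congrArg _ (h σ)).trans (map_zero _)
    simp only [hb, pathForm, chenOne]
    simp only [funext_iff] at this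
    simp [this]
  have key := hasLogDerivWithinAt_endpoint (m := m) (H := H)
    (f := fun ν τ => modelEquiv φ (pathForm C A B K (1, 0) (τ, ν)))
    (f' := fun ν τ => modelEquiv φ (pathVariation C A B K (0, 1) (1, 0) (τ, ν)))
    (hsw ((modelEquiv φ).continuous.comp (continuous_pathForm C A B hK (1, 0))))
    (hsw ((modelEquiv φ).continuous.comp (continuous_pathVariation C A B hK (0, 1) (1, 0))))
    (fun ν τ => (modelEquiv φ).hasFDerivAt.comp_hasDerivAt ν
      (hasDerivAt_pathForm C A B hK h1 (0, 1) (1, 0) (γ := fun ν => (τ, ν))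
        (fun l => (hasDerivAt_const l τ).prodMk (hasDerivAt_id l)) ν)) hw0 hw (ν₀ := ν₀)
    (ξ := fun τ => modelEquiv φ (b τ + η τ)) ?_ ?_
  · have e : b 1 + η 1 = J 1 := by
      simp [hz 1 fun σ => h3 σ ν₀, η, Q]
    simp only [e] at key
    exact key
  · simp [hz 0 fun σ => h2 σ ν₀, η, J]
  · intro τ _
    have h7 := ((modelEquiv φ).hasFDerivAt.comp_hasDerivAt τ ((hb' τ).add (hη τ))).hasDerivWithinAt
      (s := Icc 0 1)
    convert! h7 using 1
    rw [← modelEquiv_lie, ← map_add]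
    refine congrArg (modelEquiv φ) ?_
    rw [add_lie]
    abel

theorem isPathSpaceHolonomy_of_logDeriv (hK : ContMDiff 𝓘(ℝ, ℝ × ℝ × ℝ) (𝓡 n) ∞ K)
    {S : ℝ → ℝ → M} {ν : ℝ}
    (hS : ∀ σ ∈ Icc (0 : ℝ) 1, ∀ τ ∈ Icc (0 : ℝ) 1, S σ τ = K (σ, τ, ν)) {w : ℝ → H}
    (hw0 : w 0 = 1) (hw : ∀ τ ∈ Icc (0 : ℝ) 1, HasLogDerivWithinAt w
      (modelEquiv φ (pathForm C A B K (1, 0) (τ, ν))) (Icc 0 1) τ) :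
    IsPathSpaceHolonomy φ (standardConnection C A B) S (w 1) := by
  refine (isPathOrderedExp_of_logDeriv hw0 hw).congr fun τ hτ => ?_
  rw [standardConnection_eq_pathForm C A B hK hS hτ]
  rfl

theorem IsPathSpaceHolonomy.exists_logDeriv (hK : ContMDiff 𝓘(ℝ, ℝ × ℝ × ℝ) (𝓡 n) ∞ K)
    {S : ℝ → ℝ → M} {ν : ℝ}
    (hS : ∀ σ ∈ Icc (0 : ℝ) 1, ∀ τ ∈ Icc (0 : ℝ) 1, S σ τ = K (σ, τ, ν)) {h : H}
    (hh : IsPathSpaceHolonomy φ (standardConnection C A B) S h) :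
    ∃ w : ℝ → H, w 0 = 1 ∧ w 1 = h ∧ ∀ τ ∈ Icc (0 : ℝ) 1, HasLogDerivWithinAt w
      (modelEquiv φ (pathForm C A B K (1, 0) (τ, ν))) (Icc 0 1) τ := by
  refine IsPathOrderedExp.exists_logDeriv (f := fun τ =>
    modelEquiv φ (pathForm C A B K (1, 0) (τ, ν))) (IsPathOrderedExp.congr hh fun τ hτ => ?_)
  rw [standardConnection_eq_pathForm C A B hK hS hτ]
  rfl

theorem logDeriv_endpoint_unique [T2Space H] {f : ℝ → EuclideanSpace ℝ (Fin m)} (hf : Continuous f)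
    {w₀ w₁ : ℝ → H} (h₀ : w₀ 0 = 1) (h₁ : w₁ 0 = 1)
    (hw₀ : ∀ τ ∈ Icc (0 : ℝ) 1, HasLogDerivWithinAt w₀ (f τ) (Icc 0 1) τ)
    (hw₁ : ∀ τ ∈ Icc (0 : ℝ) 1, HasLogDerivWithinAt w₁ (f τ) (Icc 0 1) τ) : w₀ 1 = w₁ 1 := by
  classical
  have key := hasLogDerivWithinAt_endpoint (m := m) (H := H) (f := fun _ τ => f τ)
    (f' := fun _ _ => 0) (w := fun ν => if ν = 0 then w₀ else w₁) (ν₀ := 0) (ξ := fun _ => 0)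
    (hf.comp continuous_snd) continuous_const (fun ν τ => hasDerivAt_const ν (f τ))
    (fun ν => by split_ifs <;> assumption)
    (fun ν => by split_ifs <;> assumption) rfl
    (fun τ _ => by simpa using hasDerivWithinAt_const τ (Icc 0 1) (0 : EuclideanSpace ℝ (Fin m)))
  have hc : Filter.Tendsto (fun ν : ℝ => (if ν = 0 then w₀ else w₁) 1) (𝓝[≠] 0) (𝓝 (w₀ 1)) := by
    have := ((continuousWithinAt_univ _ _).1 key.1).tendsto.mono_left
      (nhdsWithin_le_nhds (s := {(0 : ℝ)}ᶜ))
    simpa using this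
  have hc' : Filter.Tendsto (fun ν : ℝ => (if ν = 0 then w₀ else w₁) 1) (𝓝[≠] 0) (𝓝 (w₁ 1)) := by
    refine tendsto_const_nhds.congr' ?_
    filter_upwards [self_mem_nhdsWithin] with ν hν
    rw [if_neg (show ν ≠ 0 from hν)]
  exact tendsto_nhds_unique hc hc'

end HolonomyFamily

/-! ### Localization -/

section Localization

theorem eq_zero_of_integral_smul_eq_zero {V : Type*} [NormedAddCommGroup V] [NormedSpace ℝ V]
    [CompleteSpace V] {G : ℝ → V} (hG : Continuous G) {a b : ℝ} (ha : 0 ≤ a) (hb : b ≤ 1)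
    (h : ∀ c : ℝ → ℝ, ContDiff ℝ ∞ c → HasCompactSupport c → tsupport c ⊆ Ioo a b →
      ∫ x in (0 : ℝ)..1, c x • G x = 0) : ∀ x ∈ Ioo a b, G x = 0 := by
  have h1 := isOpen_Ioo.ae_eq_zero_of_integral_contDiff_smul_eq_zero (μ := volume) (U := Ioo a b)
    (f := G) (hG.locallyIntegrable.locallyIntegrableOn _) fun c hc hcs hsub => by
      rw [← h c hc hcs hsub]
      refine (intervalIntegral.integral_eq_integral_of_support_subset ?_).symm
      intro x hx
      have hx' : x ∈ Ioo a b := hsub (subset_tsupport c fun h0 => hx (by simp [h0]))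
      exact ⟨ha.trans_lt hx'.1, (hx'.2.trans_le hb).le⟩
  have h2 : G =ᵐ[volume.restrict (Ioo a b)] fun _ => 0 :=
    (ae_restrict_iff' measurableSet_Ioo).2 h1
  exact Measure.eqOn_open_of_ae_eq h2 isOpen_Ioo hG.continuousOn continuousOn_const

variable {𝔤 : Type*} [NormedLieRing 𝔤] [NormedLieAlgebra 𝔤] [FiniteDimensional ℝ 𝔤]
  {𝔥 : Type*} [NormedLieRing 𝔥] [NormedLieAlgebra 𝔥] [FiniteDimensional ℝ 𝔥]
  (C : DifferentialCrossedModule 𝔤 𝔥)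

theorem action_eq_zero_of_localized {f : ℝ → 𝔤} {b : ℝ → 𝔥} (hf : Continuous f) (hb : Continuous b)
    (h : ∀ (c₁ c₂ : ℝ → ℝ) (m m' : ℝ), m < m' → ContDiff ℝ ∞ c₁ → ContDiff ℝ ∞ c₂ →
      HasCompactSupport c₁ → HasCompactSupport c₂ → (∀ x, m ≤ x → c₁ x = 0) →
      (∀ x, x ≤ m' → c₂ x = 0) →
      C.action (∫ x in (0 : ℝ)..1, c₂ x • f x) (∫ x in (0 : ℝ)..1, c₁ x • b x) = 0)
    {p q : ℝ} (hp : 0 ≤ p) (hpq : p ≤ q) (hq : q ≤ 1) : C.action (f q) (b p) = 0 := by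
  have : CompleteSpace 𝔤 := FiniteDimensional.complete ℝ 𝔤
  have : CompleteSpace 𝔥 := FiniteDimensional.complete ℝ 𝔥
  have hzero : ∀ {c : ℝ → ℝ} {U : Set ℝ} {x : ℝ}, tsupport c ⊆ U → x ∉ U → c x = 0 :=
    fun hc hx => image_eq_zero_of_notMem_tsupport fun hx' => hx (hc hx')
  have key : ∀ p q : ℝ, 0 < p → p < q → q < 1 → C.action (f q) (b p) = 0 := by
    intro p q hp hpq hq
    set m := (2 * p + q) / 3
    set m' := (p + 2 * q) / 3
    have hm : p < m ∧ m < m' ∧ m' < q := by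
      refine ⟨?_, ?_, ?_⟩ <;> simp only [m, m'] <;> linarith
    have h1 : ∀ c₂ : ℝ → ℝ, ContDiff ℝ ∞ c₂ → HasCompactSupport c₂ → tsupport c₂ ⊆ Ioo m' 1 →
        C.action (∫ x in (0 : ℝ)..1, c₂ x • f x) (b p) = 0 := by
      intro c₂ hc₂ hs₂ ht₂
      refine eq_zero_of_integral_smul_eq_zero (G := fun p =>
        C.action (∫ x in (0 : ℝ)..1, c₂ x • f x) (b p)) (continuous_action C continuous_const hb)
        (a := 0) (b := m) le_rfl (by linarith) (fun c₁ hc₁ hs₁ ht₁ => ?_) p ⟨hp, hm.1⟩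
      rw [← h c₁ c₂ m m' hm.2.1 hc₁ hc₂ hs₁ hs₂ (fun x hx => hzero ht₁ fun h => not_le.2 h.2 hx)
        (fun x hx => hzero ht₂ fun h => not_le.2 h.1 hx)]
      have := (repCLM C.action (∫ x in (0 : ℝ)..1, c₂ x • f x)).intervalIntegral_comp_comm
        (μ := volume) (a := 0) (b := 1) (f := fun x => c₁ x • b x)
        ((hc₁.continuous.smul hb).intervalIntegrable _ _)
      rw [← repCLM_apply, ← this]
      simp
    refine eq_zero_of_integral_smul_eq_zero (G := fun q => C.action (f q) (b p))
        (continuous_action C hf continuous_const)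
        (a := m') (b := 1) (by linarith) le_rfl (fun c₂ hc₂ hs₂ ht₂ => ?_) q ⟨hm.2.2, hq⟩
    rw [← h1 c₂ hc₂ hs₂ ht₂]
    have := ((repCLM C.action).flip (b p)).intervalIntegral_comp_comm
        (μ := volume) (a := 0) (b := 1) (f := fun x => c₂ x • f x)
        ((hc₂.continuous.smul hf).intervalIntegrable _ _)
    rw [← repCLM_apply, ← ContinuousLinearMap.flip_apply, ← this]
    simp
  have hcont : Continuous fun t : ℝ =>
      C.action (f ((1 - t) * q + t * (2 / 3))) (b ((1 - t) * p + t * (1 / 3))) :=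
    continuous_action C (hf.comp (by fun_prop)) (hb.comp (by fun_prop))
  have h2 : Filter.Tendsto (fun t : ℝ =>
      C.action (f ((1 - t) * q + t * (2 / 3))) (b ((1 - t) * p + t * (1 / 3)))) (𝓝[>] 0)
      (𝓝 (C.action (f q) (b p))) := by
    have := (hcont.tendsto 0).mono_left (nhdsWithin_le_nhds (s := Ioi (0 : ℝ)))
    simpa using this
  refine tendsto_nhds_unique h2 (tendsto_const_nhds.congr' ?_)
  filter_upwards [Ioo_mem_nhdsGT (zero_lt_one' ℝ)] with t ht
  refine (key _ _ ?_ ?_ ?_).symm <;> nlinarith [ht.1, ht.2]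

theorem chenTwo_eq_zero {A Fv Fw : ℝ → 𝔤} {qv qw : ℝ → 𝔥} (hA : Continuous A)
    (hqv : Continuous qv) (hqw : Continuous qw)
    (h₁ : ∀ p q : ℝ, 0 ≤ p → p ≤ q → q ≤ 1 → C.action (transport (adjointAction 𝔤) A q (Fw q))
      (transport C.action A p (qv p)) = 0)
    (h₂ : ∀ p q : ℝ, 0 ≤ p → p ≤ q → q ≤ 1 → C.action (transport (adjointAction 𝔤) A q (Fv q))
      (transport C.action A p (qw p)) = 0) : chenTwo C A Fv Fw qv qw = 0 := by
  have hW := continuous_transport_self C.action hA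
  have key : ∀ (x : 𝔤) (q : ℝ → 𝔥), Continuous q → ∀ σ, 0 ≤ σ →
      (∀ p ∈ Icc 0 σ, C.action x (transport C.action A p (q p)) = 0) →
      C.action x (∫ p in (0 : ℝ)..σ, transport C.action A p (q p)) = 0 := by
    intro x q hq σ hσ h
    rw [← repCLM_apply, ← ContinuousLinearMap.intervalIntegral_comp_comm _
      ((hW.clm_apply hq).intervalIntegrable _ _)]
    rw [intervalIntegral.integral_congr (g := fun _ => 0), intervalIntegral.integral_zero]
    intro p hp
    rw [uIcc_of_le hσ] at hp
    exact h p hp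
  rw [chenTwo, intervalIntegral.integral_congr (g := fun _ => 0), intervalIntegral.integral_zero]
  intro σ hσ
  rw [uIcc_of_le zero_le_one] at hσ
  simp only
  rw [key _ _ hqv σ hσ.1 fun p hp => h₁ p σ hp.1 hp.2 hσ.2,
    key _ _ hqw σ hσ.1 fun p hp => h₂ p σ hp.1 hp.2 hσ.2, sub_zero]

theorem chenTwo_localized {A fv fw : ℝ → 𝔤} {bv bw : ℝ → 𝔥} (hA : Continuous A)
    (hfw : Continuous fw) (hbv : Continuous bv) (hbw : Continuous bw) {c₁ c₂ : ℝ → ℝ}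
    (hc₁ : Continuous c₁) (hc₂ : Continuous c₂) {m m' : ℝ} (hm : m < m')
    (h₁ : ∀ x, m ≤ x → c₁ x = 0) (h₂ : ∀ x, x ≤ m' → c₂ x = 0) (l : ℝ) :
    chenTwo C A (fun σ => c₁ σ • fv σ + (l * c₂ σ) • fw σ) (fun σ => c₂ σ • fw σ)
      (fun σ => c₁ σ • bv σ + (l * c₂ σ) • bw σ) (fun σ => c₂ σ • bw σ) =
    C.action (∫ σ in (0 : ℝ)..1, c₂ σ • transport (adjointAction 𝔤) A σ (fw σ))
      (∫ σ in (0 : ℝ)..1, c₁ σ • transport C.action A σ (bv σ)) := by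
  have hW := continuous_transport_self C.action hA
  have hWg := continuous_transport_self (adjointAction 𝔤) hA
  set W := transport C.action A
  set Wg := transport (adjointAction 𝔤) A
  set J := ∫ σ in (0 : ℝ)..1, c₁ σ • W σ (bv σ)
  have hi₁ : ∀ a b, IntervalIntegrable (fun σ => c₁ σ • W σ (bv σ)) volume a b := fun a b =>
    (hc₁.smul (hW.clm_apply hbv)).intervalIntegrable _ _
  have hi₂ : ∀ a b, IntervalIntegrable (fun σ => c₂ σ • W σ (bw σ)) volume a b := fun a b =>
    (hc₂.smul (hW.clm_apply hbw)).intervalIntegrable _ _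
  have e1 : ∀ σ, ∫ r in (0 : ℝ)..σ, W r (c₁ r • bv r + (l * c₂ r) • bw r) =
      (∫ r in (0 : ℝ)..σ, c₁ r • W r (bv r)) + l • ∫ r in (0 : ℝ)..σ, c₂ r • W r (bw r) := by
    intro σ
    rw [← intervalIntegral.integral_smul, ← intervalIntegral.integral_add
      (g := fun r => l • (c₂ r • W r (bw r))) (hi₁ _ _)
      ((hi₂ _ _).smul l)]
    refine intervalIntegral.integral_congr fun r _ => ?_
    simp [mul_smul]
  have e2 : ∀ σ, ∫ r in (0 : ℝ)..σ, W r (c₂ r • bw r) = ∫ r in (0 : ℝ)..σ, c₂ r • W r (bw r) := by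
    intro σ
    refine intervalIntegral.integral_congr fun r _ => ?_
    simp
  have h3 : ∀ σ ∈ Icc (0 : ℝ) 1, c₁ σ ≠ 0 → ∫ r in (0 : ℝ)..σ, c₂ r • W r (bw r) = 0 := by
    intro σ hσ hne
    have hσm : σ < m := by
      by_contra hle
      exact hne (h₁ σ (not_lt.1 hle))
    rw [intervalIntegral.integral_congr (g := fun _ => 0), intervalIntegral.integral_zero]
    intro r hr
    rw [uIcc_of_le hσ.1] at hr
    simp [h₂ r (by linarith [hr.2])]
  have h4 : ∀ σ ∈ Icc (0 : ℝ) 1, c₂ σ ≠ 0 → ∫ r in (0 : ℝ)..σ, c₁ r • W r (bv r) = J := by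
    intro σ hσ hne
    have hσm : m' < σ := by
      by_contra hle
      exact hne (h₂ σ (not_lt.1 hle))
    rw [← sub_eq_zero, intervalIntegral.integral_interval_sub_left (hi₁ _ _) (hi₁ _ _),
      intervalIntegral.integral_congr (g := fun _ => 0), intervalIntegral.integral_zero]
    intro r hr
    rw [uIcc_of_ge hσ.2] at hr
    simp [h₁ r (by linarith [hr.1])]
  have e3 : C.action (∫ σ in (0 : ℝ)..1, c₂ σ • Wg σ (fw σ)) J =
      ∫ σ in (0 : ℝ)..1, C.action (c₂ σ • Wg σ (fw σ)) J :=
    (ContinuousLinearMap.intervalIntegral_comp_comm ((repCLM C.action).flip J)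
      ((hc₂.smul (hWg.clm_apply hfw)).intervalIntegrable _ _)).symm
  rw [e3]
  refine intervalIntegral.integral_congr fun σ hσ => ?_
  rw [uIcc_of_le zero_le_one] at hσ
  simp only
  change C.action (Wg σ (c₂ σ • fw σ)) (∫ r in (0 : ℝ)..σ, W r (c₁ r • bv r + (l * c₂ r) • bw r)) -
    C.action (Wg σ (c₁ σ • fv σ + (l * c₂ σ) • fw σ)) (∫ r in (0 : ℝ)..σ, W r (c₂ r • bw r)) = _
  rw [e1, e2]
  simp only [map_add, map_smul, LinearMap.add_apply, LinearMap.smul_apply]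
  by_cases hc1 : c₁ σ = 0
  · by_cases hc2 : c₂ σ = 0
    · simp [hc1, hc2]
    · rw [h4 σ hσ hc2, hc1]; module
  · have hc2 : c₂ σ = 0 := by
      by_contra hne
      have h5 : σ < m := by
        by_contra hle
        exact hc1 (h₁ σ (not_lt.1 hle))
      exact hne (h₂ σ (by linarith))
    rw [h3 σ hσ hc1, hc2]; simp

theorem transport_congr {V : Type*} [NormedAddCommGroup V] [NormedSpace ℝ V]
    [FiniteDimensional ℝ V] (ρ : 𝔤 →ₗ[ℝ] Module.End ℝ V) {g g' : ℝ → 𝔤}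
    (hg : ∀ r ∈ Icc (0 : ℝ) 1, g r = g' r) {σ : ℝ} (hσ : σ ∈ Icc (0 : ℝ) 1) :
    transport ρ g σ = transport ρ g' σ := by
  have key : ∀ k : ℕ, ∀ σ ∈ Icc (0 : ℝ) 1, orderedExpTerm (fun r => -repCLM ρ (g r)) k σ =
      orderedExpTerm (fun r => -repCLM ρ (g' r)) k σ := by
    intro k
    induction k with
    | zero => intro σ _; rfl
    | succ k ih =>
      intro σ hσ
      refine intervalIntegral.integral_congr fun r hr => ?_
      rw [uIcc_of_le hσ.2] at hr
      have hr' : r ∈ Icc (0 : ℝ) 1 := ⟨hσ.1.trans hr.1, hr.2⟩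
      simp only
      rw [ih r hr', hg r hr']
  exact tsum_congr fun k => key k σ hσ

/-- A smooth map of the line to the unit interval that is constant near the end points and the
identity away from them. -/
theorem exists_cutoff {ε : ℝ} (hε : 0 < ε) (hε1 : ε ≤ 1 / 2) : ∃ β : ℝ → ℝ, ContDiff ℝ ∞ β ∧
    (∀ x, β x ∈ Icc (0 : ℝ) 1) ∧ (∀ x, x ≤ ε / 3 → β x = 0) ∧ (∀ x, 1 - ε / 3 ≤ x → β x = 1) ∧
    ∀ x, β =ᶠ[𝓝 x] id ∨ (x < ε ∧ β x < ε) ∨ (1 - ε < x ∧ 1 - ε < β x) := by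
  set l : ℝ → ℝ := fun x => Real.smoothTransition ((ε / 2 - x) / (ε / 6))
  set u : ℝ → ℝ := fun x => Real.smoothTransition ((x - (1 - ε / 2)) / (ε / 6))
  have hl1 : ∀ x, x ≤ ε / 3 → l x = 1 := fun x hx =>
    Real.smoothTransition.one_of_one_le (by rw [le_div_iff₀ (by positivity)]; linarith)
  have hl0 : ∀ x, ε / 2 ≤ x → l x = 0 := fun x hx =>
    Real.smoothTransition.zero_of_nonpos (div_nonpos_of_nonpos_of_nonneg (by linarith)
      (by positivity))
  have hu1 : ∀ x, 1 - ε / 3 ≤ x → u x = 1 := fun x hx =>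
    Real.smoothTransition.one_of_one_le (by rw [le_div_iff₀ (by positivity)]; linarith)
  have hu0 : ∀ x, x ≤ 1 - ε / 2 → u x = 0 := fun x hx =>
    Real.smoothTransition.zero_of_nonpos (div_nonpos_of_nonpos_of_nonneg (by linarith)
      (by positivity))
  have hl : ∀ x, 0 ≤ l x ∧ l x ≤ 1 := fun x =>
    ⟨Real.smoothTransition.nonneg _, Real.smoothTransition.le_one _⟩
  have hu : ∀ x, 0 ≤ u x ∧ u x ≤ 1 := fun x =>
    ⟨Real.smoothTransition.nonneg _, Real.smoothTransition.le_one _⟩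
  have hlow : ∀ x, x ≤ ε / 2 → 0 ≤ (1 - l x - u x) * x + u x ∧
      (1 - l x - u x) * x + u x ≤ ε / 2 := by
    intro x hx
    rw [hu0 x (by linarith)]
    rcases le_total x (ε / 3) with h | h
    · rw [hl1 x h]; constructor <;> linarith
    · have := hl x
      constructor <;> nlinarith
  have hhigh : ∀ x, 1 - ε / 2 ≤ x → 1 - ε / 2 ≤ (1 - l x - u x) * x + u x ∧
      (1 - l x - u x) * x + u x ≤ 1 := by
    intro x hx
    rw [hl0 x (by linarith)]
    rcases le_total (1 - ε / 3) x with h | h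
    · rw [hu1 x h]; constructor <;> linarith
    · have := hu x
      constructor <;> nlinarith
  refine ⟨fun x => (1 - l x - u x) * x + u x, ?_, fun x => ?_, fun x hx => ?_, fun x hx => ?_,
    fun x => ?_⟩
  · have h1 : ContDiff ℝ ∞ l := Real.smoothTransition.contDiff.comp (by fun_prop)
    have h2 : ContDiff ℝ ∞ u := Real.smoothTransition.contDiff.comp (by fun_prop)
    fun_prop
  · simp only [mem_Icc]
    rcases le_total x (ε / 2) with h | h
    · exact ⟨(hlow x h).1, (hlow x h).2.trans (by linarith)⟩
    · rcases le_total (1 - ε / 2) x with h' | h'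
      · exact ⟨(by linarith : (0 : ℝ) ≤ 1 - ε / 2).trans (hhigh x h').1, (hhigh x h').2⟩
      · rw [hl0 x h, hu0 x h']; constructor <;> linarith
  · simp only; rw [hl1 x hx, hu0 x (by linarith)]; ring
  · simp only; rw [hl0 x (by linarith), hu1 x hx]; ring
  · rcases le_or_gt x (ε / 2) with h | h
    · exact Or.inr (Or.inl ⟨by linarith, (hlow x h).2.trans_lt (by linarith)⟩)
    · rcases le_or_gt (1 - ε / 2) x with h' | h'
      · exact Or.inr (Or.inr ⟨by linarith, (hhigh x h').1.trans_lt' (by linarith)⟩)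
      · left
        filter_upwards [Ioo_mem_nhds h h'] with y hy
        rw [hl0 y hy.1.le, hu0 y hy.2.le, id]; ring

end Localization

/-! ### Flatness from the vanishing of the path space 2-form -/

section Tangent

variable {n : ℕ} {M : Type*} [TopologicalSpace M] [ChartedSpace (EuclideanSpace ℝ (Fin n)) M]
  {E : Type*} [NormedAddCommGroup E] [NormedSpace ℝ E] {K : E → M} {s : Set E}
  {E' : Type*} [NormedAddCommGroup E'] [NormedSpace ℝ E']

theorem tangentWithin_eq_zero_of_const (hK : ContMDiff 𝓘(ℝ, E) (𝓡 n) ∞ K) {γ : ℝ → E} {u : E}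
    {t : ℝ} (hγ : HasDerivAt γ u t) {x : M} (hx : ∀ r, K (γ r) = x) :
    tangentWithin n K univ (γ t) u = 0 := by
  have h1 := tangentWithin_comp hK.contMDiffOn hγ.hasFDerivAt.hasFDerivWithinAt (mapsTo_univ γ univ)
    uniqueDiffWithinAt_univ (mem_univ t)
  have h2 : tangentWithin n (fun r => K (γ r)) univ t = 0 := by
    rw [show (fun r => K (γ r)) = fun _ => x from funext hx]
    exact mfderivWithin_const
  have h3 := congrArg (fun T : ℝ →L[ℝ] EuclideanSpace ℝ (Fin n) => T 1) (h1.symm.trans h2)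
  refine Eq.trans ?_ h3
  exact congrArg (tangentWithin n K univ (γ t)) (one_smul ℝ u).symm

theorem hasDerivAt_affine (p v : E) (t : ℝ) : HasDerivAt (fun r : ℝ => p + r • v) v t := by
  simpa using ((hasDerivAt_id t).smul_const v).const_add p

theorem finrank_range_comp_lt {G : Type*} [NormedAddCommGroup G] [NormedSpace ℝ G]
    {T : E →L[ℝ] EuclideanSpace ℝ (Fin n)} {k : ℕ}
    (hT : Module.finrank ℝ (LinearMap.range T.toLinearMap) < k) (L : G →L[ℝ] E) :
    Module.finrank ℝ (LinearMap.range (T.comp L).toLinearMap) < k :=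
  (Submodule.finrank_mono (LinearMap.range_comp_le_range L.toLinearMap T.toLinearMap)).trans_lt hT

theorem finrank_tangentWithin_comp_lt {ψ : E' → E} {k : ℕ} (hK : ContMDiffOn 𝓘(ℝ, E) (𝓡 n) ∞ K s)
    (hψ : ContDiff ℝ ∞ ψ) (hs : ∀ p, ψ p ∈ s)
    (hk : ∀ p ∈ s, Module.finrank ℝ (LinearMap.range (tangentWithin n K s p).toLinearMap) < k)
    (p : E') : Module.finrank ℝ
      (LinearMap.range (tangentWithin n (fun q => K (ψ q)) univ p).toLinearMap) < k := by
  rw [tangentWithin_comp hK ((hψ.differentiable (by simp)) p).hasFDerivAt.hasFDerivWithinAt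
    (fun q _ => hs q) uniqueDiffWithinAt_univ (mem_univ _)]
  exact finrank_range_comp_lt (hk _ (hs p)) _

theorem tangentWithin_slice_eq_zero {K : ℝ × ℝ × ℝ → M}
    (hK : ContMDiff 𝓘(ℝ, ℝ × ℝ × ℝ) (𝓡 n) ∞ K) {σ : ℝ} {x : M} (hx : ∀ p, K (σ, p) = x)
    (p w : ℝ × ℝ) : tangentWithin n K univ (σ, p) (0, w) = 0 := by
  have h := tangentWithin_eq_zero_of_const hK (γ := fun r => (σ, p + r • w)) (t := 0)
    ((hasDerivAt_const (0 : ℝ) σ).prodMk (hasDerivAt_affine p w 0)) fun r => hx _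
  have h1 : p + (0 : ℝ) • w = p := by rw [zero_smul, add_zero]
  exact h1 ▸ h

theorem tangentWithin_line_eq_zero {K : ℝ × ℝ × ℝ → M}
    (hK : ContMDiff 𝓘(ℝ, ℝ × ℝ × ℝ) (𝓡 n) ∞ K) {σ τ : ℝ} {x : M} (hx : ∀ ν, K (σ, τ, ν) = x)
    (ν : ℝ) : tangentWithin n K univ (σ, τ, ν) (0, 0, 1) = 0 :=
  tangentWithin_eq_zero_of_const hK (γ := fun ν => (σ, τ, ν)) (t := ν)
    ((hasDerivAt_const ν σ).prodMk ((hasDerivAt_const ν τ).prodMk (hasDerivAt_id ν))) hx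

variable {𝔤 : Type*} [NormedLieRing 𝔤] [NormedLieAlgebra 𝔤] [FiniteDimensional ℝ 𝔤]
  {𝔥 : Type*} [NormedLieRing 𝔥] [NormedLieAlgebra 𝔥] [FiniteDimensional ℝ 𝔥]
  (C : DifferentialCrossedModule 𝔤 𝔥) (A : DiffForm n M 1 𝔤) (B : DiffForm n M 2 𝔥)

theorem fakeWithin_linear (K : E → M) (s : Set E) (u v w p : E) (c d : ℝ) :
    fakeWithin C A B K s u (c • v + d • w) p =
      c • fakeWithin C A B K s u v p + d • fakeWithin C A B K s u w p := by
  simp only [fakeWithin, curvatureWithin, map_add, map_smul, lie_add, lie_smul]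
  module

theorem twoWithin_linear (K : E → M) (s : Set E) (u v w p : E) (c d : ℝ) :
    twoWithin B K s u (c • v + d • w) p =
      c • twoWithin B K s u v p + d • twoWithin B K s u w p := by
  simp only [twoWithin, map_add, map_smul]

end Tangent

section Backward

variable {n m : ℕ} {M : Type*} [TopologicalSpace M] [ChartedSpace (EuclideanSpace ℝ (Fin n)) M]
  [IsManifold (𝓡 n) ∞ M]
  {𝔤 : Type*} [NormedLieRing 𝔤] [NormedLieAlgebra 𝔤] [FiniteDimensional ℝ 𝔤]
  {𝔥 : Type*} [NormedLieRing 𝔥] [NormedLieAlgebra 𝔥] [FiniteDimensional ℝ 𝔥]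
  (C : DifferentialCrossedModule 𝔤 𝔥) (A : DiffForm n M 1 𝔤) (B : DiffForm n M 2 𝔥)

/-- The path space 2-form `∮_A(dα(T_a)(B), (F_A + dt(B))^a)` vanishes on pairs `(T, aT)`. -/
def ChenVanishes : Prop :=
  ∀ (s t : M) (X : ℝ → ℝ → M), IsPathCurve n s t X →
    ∀ a : ℝ → ℝ → ℝ, ContDiffOn ℝ ∞ (uncurry a) (Icc 0 1 ×ˢ Icc 0 1) →
      ∀ τ ∈ Icc (0 : ℝ) 1,
        chenTwoForm C A B (fun σ => X σ τ) (pathTangent n X τ)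
          (fun σ => a τ σ • pathTangent n X τ σ) = 0

variable {C A B} {K : ℝ × ℝ × ℝ → M}

theorem ChenVanishes.action_eq_zero (h : ChenVanishes C A B)
    (hK : ContMDiff 𝓘(ℝ, ℝ × ℝ × ℝ) (𝓡 n) ∞ K) {x y : M} {ε : ℝ} (hε : 0 < ε)
    (hx : ∀ σ p, σ < ε → K (σ, p) = x) (hy : ∀ σ p, 1 - ε < σ → K (σ, p) = y) (v w p : ℝ × ℝ)
    {r q : ℝ} (hr : 0 ≤ r) (hrq : r ≤ q) (hq : q ≤ 1) :
    C.action (transport (adjointAction 𝔤) (fun σ => oneWithin A K univ (1, 0) (σ, p)) q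
        (fakeWithin C A B K univ (1, 0) (0, w) (q, p)))
      (transport C.action (fun σ => oneWithin A K univ (1, 0) (σ, p)) r
        (twoWithin B K univ (1, 0) (0, v) (r, p))) = 0 := by
  set g : ℝ → 𝔤 := fun σ => oneWithin A K univ (1, 0) (σ, p)
  set f : ℝ × ℝ → ℝ → 𝔤 := fun w σ => fakeWithin C A B K univ (1, 0) (0, w) (σ, p)
  set b : ℝ × ℝ → ℝ → 𝔥 := fun v σ => twoWithin B K univ (1, 0) (0, v) (σ, p)
  have hg : Continuous g := continuous_slice_point p (contDiff_oneWithin A hK _).continuous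
  have hf : ∀ w, Continuous (f w) := fun w =>
    continuous_slice_point p (continuous_fakeWithin C A B hK _ _)
  have hb : ∀ v, Continuous (b v) := fun v =>
    continuous_slice_point p (contDiff_twoWithin B hK _ _).continuous
  have hW := continuous_transport_self C.action hg
  have hWg := continuous_transport_self (adjointAction 𝔤) hg
  refine action_eq_zero_of_localized C (f := fun q => transport (adjointAction 𝔤) g q (f w q))
    (b := fun r => transport C.action g r (b v r)) (hWg.clm_apply (hf w)) (hW.clm_apply (hb v))
    (fun c₁ c₂ m m' hm hc₁ hc₂ _ _ h₁ h₂ => ?_) hr hrq hq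
  have key := chenTwo_localized C hg (hf w) (hb v) (hb w) hc₁.continuous hc₂.continuous hm h₁ h₂ 1
    (fv := f v)
  rw [← key]
  set γ : ℝ × ℝ → ℝ × ℝ × ℝ := fun q => (q.1, p + q.2 • (c₁ q.1 • v + c₂ q.1 • w)) with hγ
  have hγs : ContDiff ℝ ∞ γ := by fun_prop
  set X : ℝ → ℝ → M := fun σ t => K (γ (σ, t))
  have hX : ContMDiff 𝓘(ℝ, ℝ × ℝ) (𝓡 n) ∞ (uncurry X) := hK.comp hγs.contMDiff
  have hcurve : IsPathCurve n x y X := by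
    refine ⟨hX.contMDiffOn, fun τ _ => ⟨ContMDiff.contMDiffOn ?_, ε, hε, fun σ _ =>
      ⟨fun hσ => hx σ _ hσ, fun hσ => hy σ _ hσ⟩⟩⟩
    have h3 : ContDiff ℝ ∞ fun σ : ℝ => (σ, τ) := by fun_prop
    exact hX.comp h3.contMDiff
  set a : ℝ → ℝ := fun σ => Real.smoothTransition ((σ - m) / (m' - m)) with ha
  have has : ContDiff ℝ ∞ a := Real.smoothTransition.contDiff.comp (by fun_prop)
  have hm' : 0 < m' - m := sub_pos.2 hm
  have ha₁ : ∀ σ, a σ * c₁ σ = 0 := by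
    intro σ
    rcases le_total m σ with h' | h'
    · rw [h₁ σ h', mul_zero]
    · rw [ha]
      simp only
      rw [Real.smoothTransition.zero_of_nonpos
        (div_nonpos_of_nonpos_of_nonneg (by linarith) hm'.le), zero_mul]
  have ha₂ : ∀ σ, a σ * c₂ σ = c₂ σ := by
    intro σ
    rcases le_total σ m' with h' | h'
    · rw [h₂ σ h', mul_zero]
    · rw [ha]
      simp only
      rw [Real.smoothTransition.one_of_one_le (by rw [le_div_iff₀ hm']; linarith), one_mul]
  have hzero := h x y X hcurve (fun _ σ => a σ)
    (has.comp (contDiff_snd (E := ℝ) (F := ℝ))).contDiffOn 0 (by simp)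
  have hX0 : ∀ r, X r 0 = K (r, p) := fun r => by simp [X, γ]
  have hv : ∀ r ∈ Icc (0 : ℝ) 1, velocity n (fun σ => X σ 0) r =
      tangentWithin n K univ (r, p) (1, 0) := fun r hr =>
    velocity_eq_tangentWithin (γ := fun σ => (σ, p)) hK.contMDiffOn
      ((hasDerivAt_id r).prodMk (hasDerivAt_const r p)).hasDerivWithinAt (mapsTo_univ _ _)
      (fun σ _ => hX0 σ) hr
  have hT : ∀ r ∈ Icc (0 : ℝ) 1, pathTangent n X 0 r =
      tangentWithin n K univ (r, p) (c₁ r • (0, v) + (1 * c₂ r) • (0, w)) := fun r hr => by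
    have h3 := velocity_eq_tangentWithin (c := X r) (γ := fun t => γ (r, t)) (σ := 0) hK.contMDiffOn
      ((hasDerivAt_const (0 : ℝ) r).prodMk
        (hasDerivAt_affine p (c₁ r • v + c₂ r • w) 0)).hasDerivWithinAt (mapsTo_univ _ _)
      (fun t _ => rfl) (by simp)
    have h4 : γ (r, 0) = (r, p) := by simp [γ]
    rw [h4] at h3
    refine h3.trans (congrArg (tangentWithin n K univ (r, p)) ?_)
    simp
  have haT : ∀ r ∈ Icc (0 : ℝ) 1, a r • pathTangent n X 0 r =
      tangentWithin n K univ (r, p) (c₂ r • (0, w) + (0 : ℝ) • (0, w)) := fun r hr => by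
    refine (congrArg (fun z : EuclideanSpace ℝ (Fin n) => a r • z) (hT r hr)).trans ?_
    refine (map_smul (tangentWithin n K univ (r, p)) (a r) _).symm.trans ?_
    refine congrArg (tangentWithin n K univ (r, p)) ?_
    rw [smul_add, smul_smul, smul_smul, ha₁, one_mul, ha₂]
    simp
  rw [← hzero]
  refine (chenTwoForm_eq_chenTwo C hg ?_ ?_ (fun r hr => oneForm_congr A (hX0 r) (hv r hr))
    (fun r hr => ?_) (fun r hr => ?_) (fun r hr => ?_) (fun r hr => ?_)).symm
  · exact (hc₁.continuous.smul (hb v)).add ((continuous_const.mul hc₂.continuous).smul (hb w))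
  · exact hc₂.continuous.smul (hb w)
  · exact (twoForm_congr B (hX0 r) (hv r hr) (hT r hr)).trans (twoWithin_linear B K univ _ _ _ _ _ _)
  · refine (twoForm_congr B (hX0 r) (hv r hr) (haT r hr)).trans
      ((twoWithin_linear B K univ _ _ _ _ _ _).trans ?_)
    rw [zero_smul, add_zero]
  · exact (fakeCurvature_congr C A B (hX0 r) (hv r hr) (hT r hr)).trans
      (fakeWithin_linear C A B K univ _ _ _ _ _ _)
  · refine (fakeCurvature_congr C A B (hX0 r) (hv r hr) (haT r hr)).trans
      ((fakeWithin_linear C A B K univ _ _ _ _ _ _).trans ?_)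
    rw [zero_smul, add_zero]

theorem ChenVanishes.pathChen_eq_zero (h : ChenVanishes C A B)
    (hK : ContMDiff 𝓘(ℝ, ℝ × ℝ × ℝ) (𝓡 n) ∞ K) {x y : M} {ε : ℝ} (hε : 0 < ε)
    (hx : ∀ σ p, σ < ε → K (σ, p) = x) (hy : ∀ σ p, 1 - ε < σ → K (σ, p) = y) (v w p : ℝ × ℝ) :
    pathChen C A B K v w p = 0 :=
  chenTwo_eq_zero C (continuous_slice_point p (contDiff_oneWithin A hK _).continuous)
    (continuous_slice_point p (contDiff_twoWithin B hK _ _).continuous)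
    (continuous_slice_point p (contDiff_twoWithin B hK _ _).continuous)
    (fun _ _ => h.action_eq_zero hK hε hx hy v w p)
    (fun _ _ => h.action_eq_zero hK hε hx hy w v p)

theorem IsBigon.comp_cutoff {s t : M} {S : ℝ → ℝ → M} {ε : ℝ} {β : ℝ → ℝ}
    (hS : ∀ σ ∈ Icc (0 : ℝ) 1, ∀ τ ∈ Icc (0 : ℝ) 1,
      (σ < ε → S σ τ = s) ∧ (1 - ε < σ → S σ τ = t) ∧
      (τ < ε → S σ τ = S σ 0) ∧ (1 - ε < τ → S σ τ = S σ 1))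
    (hβ : ∀ x, β x ∈ Icc (0 : ℝ) 1)
    (hβ' : ∀ x, β =ᶠ[𝓝 x] id ∨ (x < ε ∧ β x < ε) ∨ (1 - ε < x ∧ 1 - ε < β x)) {σ τ : ℝ}
    (hσ : σ ∈ Icc (0 : ℝ) 1) (hτ : τ ∈ Icc (0 : ℝ) 1) : S (β σ) (β τ) = S σ τ := by
  have h1 : S (β σ) (β τ) = S σ (β τ) := by
    rcases hβ' σ with h | h | h
    · rw [h.eq_of_nhds, id]
    · rw [(hS _ (hβ σ) _ (hβ τ)).1 h.2, (hS _ hσ _ (hβ τ)).1 h.1]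
    · rw [(hS _ (hβ σ) _ (hβ τ)).2.1 h.2, (hS _ hσ _ (hβ τ)).2.1 h.1]
  rw [h1]
  rcases hβ' τ with h | h | h
  · rw [h.eq_of_nhds, id]
  · rw [(hS _ hσ _ (hβ τ)).2.2.1 h.2, (hS _ hσ _ hτ).2.2.1 h.1]
  · rw [(hS _ hσ _ (hβ τ)).2.2.2 h.2, (hS _ hσ _ hτ).2.2.2 h.1]

theorem ChenVanishes.exists_holonomy {H : Type*} [TopologicalSpace H] [T2Space H]
    [ChartedSpace (EuclideanSpace ℝ (Fin m)) H] [Group H] [LieGroup (𝓡 m) ∞ H]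
    (φ : 𝔥 ≃ₗ⁅ℝ⁆ GroupLieAlgebra (𝓡 m) H) (h : ChenVanishes C A B)
    (hK : ContMDiff 𝓘(ℝ, ℝ × ℝ × ℝ) (𝓡 n) ∞ K) {x y : M} {ε : ℝ} (hε : 0 < ε)
    (hx : ∀ σ p, σ < ε → K (σ, p) = x) (hy : ∀ σ p, 1 - ε < σ → K (σ, p) = y)
    (hthin : ∀ p, Module.finrank ℝ (LinearMap.range (tangentWithin n K univ p).toLinearMap) < 3)
    {c₀ c₁ : ℝ → M} (h2 : ∀ σ ν, K (σ, 0, ν) = c₀ σ) (h3 : ∀ σ ν, K (σ, 1, ν) = c₁ σ)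
    {S₁ S₂ : ℝ → ℝ → M}
    (hS₁ : ∀ σ ∈ Icc (0 : ℝ) 1, ∀ τ ∈ Icc (0 : ℝ) 1, S₁ σ τ = K (σ, τ, 0))
    (hS₂ : ∀ σ ∈ Icc (0 : ℝ) 1, ∀ τ ∈ Icc (0 : ℝ) 1, S₂ σ τ = K (σ, τ, 1)) :
    ∃ h : H, IsPathSpaceHolonomy φ (standardConnection C A B) S₁ h ∧
      IsPathSpaceHolonomy φ (standardConnection C A B) S₂ h := by
  choose w hw0 hw using fun ν : ℝ => exists_logDeriv (m := m) (H := H)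
    (f := fun τ => modelEquiv φ (pathForm C A B K (1, 0) (τ, ν)))
    ((modelEquiv φ).continuous.comp ((continuous_pathForm C A B hK (1, 0)).comp (by fun_prop)))
  have hflat := fun ν => hasLogDerivWithinAt_holonomy C A B φ hK
    (tangentWithin_slice_eq_zero hK fun p => hx 0 p hε)
    (tangentWithin_slice_eq_zero hK fun p => hy 1 p (by linarith)) hthin
    (fun σ => tangentWithin_line_eq_zero hK (h2 σ)) (fun σ => tangentWithin_line_eq_zero hK (h3 σ))
    hw0 hw ν
  simp only [h.pathChen_eq_zero hK hε hx hy, map_zero,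
    intervalIntegral.integral_zero] at hflat
  refine ⟨w 0 1, isPathSpaceHolonomy_of_logDeriv C A B φ hK hS₁ (hw0 0) (hw 0), ?_⟩
  rw [eq_of_hasLogDerivWithinAt_zero (m := m) hflat 0 1]
  exact isPathSpaceHolonomy_of_logDeriv C A B φ hK hS₂ (hw0 1) (hw 1)

theorem ChenVanishes.isRFlat {H : Type*} [TopologicalSpace H] [T2Space H]
    [ChartedSpace (EuclideanSpace ℝ (Fin m)) H] [Group H] [LieGroup (𝓡 m) ∞ H]
    (φ : 𝔥 ≃ₗ⁅ℝ⁆ GroupLieAlgebra (𝓡 m) H) (h : ChenVanishes C A B) :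
    IsRFlat φ (standardConnection C A B) := by
  rintro s t S₁ S₂ ⟨-, ε₁, hε₁, hS₁⟩ ⟨-, ε₂, hε₂, hS₂⟩ ⟨K, hK, hK01, hKτ, hKσ, hrank⟩
  set ε := min (1 / 2) (min ε₁ ε₂)
  have hε : 0 < ε := by positivity
  obtain ⟨β, hβs, hβ, hβ0, hβ1, hβ'⟩ := exists_cutoff hε (min_le_left _ _)
  have e1 : ε ≤ ε₁ := (min_le_right _ _).trans (min_le_left _ _)
  have e2 : ε ≤ ε₂ := (min_le_right _ _).trans (min_le_right _ _)
  set cube : Set (ℝ × ℝ × ℝ) := Icc 0 1 ×ˢ Icc 0 1 ×ˢ Icc 0 1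
  set ψ : ℝ × ℝ × ℝ → ℝ × ℝ × ℝ := fun p => (β p.1, β p.2.1, β p.2.2)
  have hψ : ContDiff ℝ ∞ ψ := by fun_prop
  have hψc : ∀ p, ψ p ∈ cube := fun p => ⟨hβ _, hβ _, hβ _⟩
  set Kc : ℝ × ℝ × ℝ → M := fun p => K (ψ p)
  have hKc : ContMDiff 𝓘(ℝ, ℝ × ℝ × ℝ) (𝓡 n) ∞ Kc := hK.comp_contMDiff hψ.contMDiff hψc
  have hm0 : (0 : ℝ) ∈ Icc (0 : ℝ) 1 := by simp
  have hm1 : (1 : ℝ) ∈ Icc (0 : ℝ) 1 := by simp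
  have hx : ∀ σ p, σ < ε / 3 → Kc (σ, p) = s := by
    intro σ p hσ
    simp only [Kc, ψ, hβ0 σ hσ.le]
    rw [(hKσ _ (hβ p.1) _ (hβ p.2)).1, (hS₁ 0 hm0 _ (hβ p.1)).1 hε₁]
  have hy : ∀ σ p, 1 - ε / 3 < σ → Kc (σ, p) = t := by
    intro σ p hσ
    simp only [Kc, ψ, hβ1 σ hσ.le]
    rw [(hKσ _ (hβ p.1) _ (hβ p.2)).2.2.1, (hS₁ 1 hm1 _ (hβ p.1)).2.1 (by linarith)]
  have hthin : ∀ p, Module.finrank ℝ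
      (LinearMap.range (tangentWithin n Kc univ p).toLinearMap) < 3 := by
    intro p
    exact finrank_tangentWithin_comp_lt hK hψ hψc hrank p
  have hβ00 : β 0 = 0 := hβ0 0 (by positivity)
  have hβ11 : β 1 = 1 := hβ1 1 (by linarith)
  have h2 : ∀ σ ν, Kc (σ, 0, ν) = S₁ (β σ) 0 := by
    intro σ ν
    simp only [Kc, ψ, hβ00]
    exact (hKτ _ (hβ σ) _ (hβ ν)).1
  have h3 : ∀ σ ν, Kc (σ, 1, ν) = S₁ (β σ) 1 := by
    intro σ ν
    simp only [Kc, ψ, hβ11]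
    exact (hKτ _ (hβ σ) _ (hβ ν)).2.2.1
  have hc1 : ∀ σ ∈ Icc (0 : ℝ) 1, ∀ τ ∈ Icc (0 : ℝ) 1, S₁ σ τ = Kc (σ, τ, 0) := by
    intro σ hσ τ hτ
    simp only [Kc, ψ, hβ00]
    rw [(hK01 _ (hβ σ) _ (hβ τ)).1]
    refine (IsBigon.comp_cutoff (s := s) (t := t) (ε := ε) (fun σ hσ τ hτ => ?_) hβ hβ' hσ hτ).symm
    obtain ⟨a, b, c, d⟩ := hS₁ σ hσ τ hτ
    exact ⟨fun h => a (h.trans_le e1), fun h => b (by linarith), fun h => c (h.trans_le e1),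
      fun h => d (by linarith)⟩
  have hc2 : ∀ σ ∈ Icc (0 : ℝ) 1, ∀ τ ∈ Icc (0 : ℝ) 1, S₂ σ τ = Kc (σ, τ, 1) := by
    intro σ hσ τ hτ
    simp only [Kc, ψ, hβ11]
    rw [(hK01 _ (hβ σ) _ (hβ τ)).2]
    refine (IsBigon.comp_cutoff (s := s) (t := t) (ε := ε) (fun σ hσ τ hτ => ?_) hβ hβ' hσ hτ).symm
    obtain ⟨a, b, c, d⟩ := hS₂ σ hσ τ hτ
    exact ⟨fun h => a (h.trans_le e2), fun h => b (by linarith), fun h => c (h.trans_le e2),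
      fun h => d (by linarith)⟩
  exact h.exists_holonomy φ hKc (by positivity : 0 < ε / 3) hx hy hthin h2 h3 hc1 hc2

end Backward

/-! ### Vanishing of the path space 2-form from flatness -/

section Composition

variable {n : ℕ} {M : Type*} [TopologicalSpace M] [ChartedSpace (EuclideanSpace ℝ (Fin n)) M]
  {E : Type*} [NormedAddCommGroup E] [NormedSpace ℝ E] {K : E → M} {s : Set E}
  {E' : Type*} [NormedAddCommGroup E'] [NormedSpace ℝ E'] {ψ : E' → E}

theorem tangentWithin_comp_apply (hK : ContMDiffOn 𝓘(ℝ, E) (𝓡 n) ∞ K s) (hψ : ContDiff ℝ ∞ ψ)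
    (hs : ∀ p, ψ p ∈ s) (p u : E') :
    tangentWithin n (fun q => K (ψ q)) univ p u = tangentWithin n K s (ψ p) (fderiv ℝ ψ p u) := by
  rw [tangentWithin_comp hK ((hψ.differentiable (by simp)) p).hasFDerivAt.hasFDerivWithinAt
    (fun q _ => hs q) uniqueDiffWithinAt_univ (mem_univ _)]
  rfl

theorem finrank_tangentWithin_surface_lt {Y : ℝ × ℝ → M} {s : Set (ℝ × ℝ)} {ψ : E' → ℝ × ℝ}
    (hY : ContMDiffOn 𝓘(ℝ, ℝ × ℝ) (𝓡 n) ∞ Y s) (hψ : ContDiff ℝ ∞ ψ) (hs : ∀ p, ψ p ∈ s)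
    {t : Set E'} (ht : UniqueDiffOn ℝ t) {p : E'} (hp : p ∈ t) : Module.finrank ℝ
      (LinearMap.range (tangentWithin n (fun q => Y (ψ q)) t p).toLinearMap) < 3 := by
  rw [tangentWithin_comp hY ((hψ.differentiable (by simp)) p).hasFDerivAt.hasFDerivWithinAt
    (fun q _ => hs q) (ht p hp) hp]
  refine finrank_range_comp_lt ?_ _
  refine (LinearMap.finrank_range_le _).trans_lt ?_
  simp

variable {𝔤 : Type*} [NormedLieRing 𝔤] [NormedLieAlgebra 𝔤] [FiniteDimensional ℝ 𝔤]
  {𝔥 : Type*} [NormedLieRing 𝔥] [NormedLieAlgebra 𝔥] [FiniteDimensional ℝ 𝔥]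
  (C : DifferentialCrossedModule 𝔤 𝔥) (A : DiffForm n M 1 𝔤) (B : DiffForm n M 2 𝔥)

theorem oneWithin_comp (hK : ContMDiffOn 𝓘(ℝ, E) (𝓡 n) ∞ K s) (hψ : ContDiff ℝ ∞ ψ)
    (hs : ∀ p, ψ p ∈ s) (u p : E') : oneWithin A (fun q => K (ψ q)) univ u p =
      oneWithin A K s (fderiv ℝ ψ p u) (ψ p) := by
  simp only [oneWithin, tangentWithin_comp_apply hK hψ hs]

theorem twoWithin_comp (hK : ContMDiffOn 𝓘(ℝ, E) (𝓡 n) ∞ K s) (hψ : ContDiff ℝ ∞ ψ)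
    (hs : ∀ p, ψ p ∈ s) (u v p : E') : twoWithin B (fun q => K (ψ q)) univ u v p =
      twoWithin B K s (fderiv ℝ ψ p u) (fderiv ℝ ψ p v) (ψ p) := by
  simp only [twoWithin, tangentWithin_comp_apply hK hψ hs]

theorem fakeWithin_comp (hK : ContMDiffOn 𝓘(ℝ, E) (𝓡 n) ∞ K s) (hψ : ContDiff ℝ ∞ ψ)
    (hs : ∀ p, ψ p ∈ s) (u v p : E') : fakeWithin C A B (fun q => K (ψ q)) univ u v p =
      fakeWithin C A B K s (fderiv ℝ ψ p u) (fderiv ℝ ψ p v) (ψ p) := by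
  simp only [fakeWithin, curvatureWithin, tangentWithin_comp_apply hK hψ hs]

theorem fakeWithin_smul_smul (K : E → M) (s : Set E) (u v p : E) (c d : ℝ) :
    fakeWithin C A B K s (c • u) (d • v) p = (c * d) • fakeWithin C A B K s u v p := by
  simp only [fakeWithin, curvatureWithin, map_smul, LinearMap.smul_apply, smul_lie, lie_smul]
  module

theorem twoWithin_smul_smul (K : E → M) (s : Set E) (u v p : E) (c d : ℝ) :
    twoWithin B K s (c • u) (d • v) p = (c * d) • twoWithin B K s u v p := by
  simp only [twoWithin, map_smul, LinearMap.smul_apply]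
  module

theorem oneWithin_smul (K : E → M) (s : Set E) (u p : E) (c : ℝ) :
    oneWithin A K s (c • u) p = c • oneWithin A K s u p := by
  simp only [oneWithin, map_smul]

theorem chenTwo_smul (g fv fw : ℝ → 𝔤) (qv qw : ℝ → 𝔥) (c : ℝ) :
    chenTwo C g fv (fun σ => c • fw σ) qv (fun σ => c • qw σ) = c • chenTwo C g fv fw qv qw := by
  simp only [chenTwo, map_smul, LinearMap.smul_apply, intervalIntegral.integral_smul, ← smul_sub]

variable {Y : E → M} {s : Set E} {ψ ψ' : ℝ × ℝ × ℝ → E}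

theorem pathForm_comp_congr (hY : ContMDiffOn 𝓘(ℝ, E) (𝓡 n) ∞ Y s) (hψ : ContDiff ℝ ∞ ψ)
    (hs : ∀ p, ψ p ∈ s) (hψ' : ContDiff ℝ ∞ ψ') (hs' : ∀ p, ψ' p ∈ s) {w p : ℝ × ℝ}
    (h : ∀ σ, ψ (σ, p) = ψ' (σ, p))
    (h1 : ∀ σ, fderiv ℝ ψ (σ, p) (1, 0) = fderiv ℝ ψ' (σ, p) (1, 0))
    (hw : ∀ σ, fderiv ℝ ψ (σ, p) (0, w) = fderiv ℝ ψ' (σ, p) (0, w)) :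
    pathForm C A B (fun q => Y (ψ q)) w p = pathForm C A B (fun q => Y (ψ' q)) w p := by
  simp only [pathForm, oneWithin_comp A hY hψ hs, oneWithin_comp A hY hψ' hs',
    twoWithin_comp B hY hψ hs, twoWithin_comp B hY hψ' hs', h, h1, hw]

theorem pathChen_comp_smul (hY : ContMDiffOn 𝓘(ℝ, E) (𝓡 n) ∞ Y s) (hψ : ContDiff ℝ ∞ ψ)
    (hs : ∀ p, ψ p ∈ s) (hψ' : ContDiff ℝ ∞ ψ') (hs' : ∀ p, ψ' p ∈ s) {v w p : ℝ × ℝ} {c : ℝ}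
    (h : ∀ σ, ψ (σ, p) = ψ' (σ, p))
    (h1 : ∀ σ, fderiv ℝ ψ (σ, p) (1, 0) = fderiv ℝ ψ' (σ, p) (1, 0))
    (hv : ∀ σ, fderiv ℝ ψ (σ, p) (0, v) = fderiv ℝ ψ' (σ, p) (0, v))
    (hw : ∀ σ, fderiv ℝ ψ (σ, p) (0, w) = c • fderiv ℝ ψ' (σ, p) (0, w)) :
    pathChen C A B (fun q => Y (ψ q)) v w p = c • pathChen C A B (fun q => Y (ψ' q)) v w p := by
  have e1 : ∀ u v p, fakeWithin C A B Y s u (c • v) p = c • fakeWithin C A B Y s u v p :=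
    fun u v p => by simpa using fakeWithin_smul_smul C A B Y s u v p 1 c
  have e2 : ∀ u v p, twoWithin B Y s u (c • v) p = c • twoWithin B Y s u v p :=
    fun u v p => by simpa using twoWithin_smul_smul B Y s u v p 1 c
  simp only [pathChen, oneWithin_comp A hY hψ hs, oneWithin_comp A hY hψ' hs',
    twoWithin_comp B hY hψ hs, twoWithin_comp B hY hψ' hs', fakeWithin_comp C A B hY hψ hs,
    fakeWithin_comp C A B hY hψ' hs', h, h1, hv, hw, e1, e2, chenTwo_smul]

end Composition

section Forward

variable {n m : ℕ} {M : Type*} [TopologicalSpace M] [ChartedSpace (EuclideanSpace ℝ (Fin n)) M]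
  [IsManifold (𝓡 n) ∞ M]
  {𝔤 : Type*} [NormedLieRing 𝔤] [NormedLieAlgebra 𝔤] [FiniteDimensional ℝ 𝔤]
  {𝔥 : Type*} [NormedLieRing 𝔥] [NormedLieAlgebra 𝔥] [FiniteDimensional ℝ 𝔥]
  {C : DifferentialCrossedModule 𝔤 𝔥} {A : DiffForm n M 1 𝔤} {B : DiffForm n M 2 𝔥}
  {H : Type*} [TopologicalSpace H] [T2Space H]
  [ChartedSpace (EuclideanSpace ℝ (Fin m)) H] [Group H] [LieGroup (𝓡 m) ∞ H]
  {φ : 𝔥 ≃ₗ⁅ℝ⁆ GroupLieAlgebra (𝓡 m) H}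

theorem IsRFlat.integral_transport_pathChen_eq_zero (hflat : IsRFlat φ (standardConnection C A B))
    {Y : ℝ × ℝ → M} {s : Set (ℝ × ℝ)} (hY : ContMDiffOn 𝓘(ℝ, ℝ × ℝ) (𝓡 n) ∞ Y s)
    {ψ : ℝ × ℝ × ℝ → ℝ × ℝ} (hψ : ContDiff ℝ ∞ ψ) (hs : ∀ p, ψ p ∈ s) {x y : M} {ε : ℝ}
    (hε : 0 < ε) (hx : ∀ σ p, σ < ε → Y (ψ (σ, p)) = x)
    (hy : ∀ σ p, 1 - ε < σ → Y (ψ (σ, p)) = y)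
    (h2 : ∀ σ τ ν, τ < ε → ψ (σ, τ, ν) = ψ (σ, 0, 0))
    (h3 : ∀ σ τ ν, 1 - ε < τ → ψ (σ, τ, ν) = ψ (σ, 1, 0)) :
    ∫ τ in (0 : ℝ)..1, transport (adjointAction 𝔥)
      (fun τ => pathForm C A B (fun q => Y (ψ q)) (1, 0) (τ, 0)) τ
        (pathChen C A B (fun q => Y (ψ q)) (1, 0) (0, 1) (τ, 0)) = 0 := by
  set K : ℝ × ℝ × ℝ → M := fun q => Y (ψ q)
  have hK : ContMDiff 𝓘(ℝ, ℝ × ℝ × ℝ) (𝓡 n) ∞ K := hY.comp_contMDiff hψ.contMDiff hs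
  have hthin : ∀ p, Module.finrank ℝ
      (LinearMap.range (tangentWithin n K univ p).toLinearMap) < 3 := fun p =>
    finrank_tangentWithin_surface_lt hY hψ hs uniqueDiffOn_univ (mem_univ p)
  have h1ε : 1 - ε < 1 := by linarith
  set S : ℝ → ℝ → ℝ → M := fun ν σ τ => K (σ, τ, ν)
  have hbig : ∀ ν, IsBigon n x y (S ν) := by
    intro ν
    have h4 : ContDiff ℝ ∞ fun p : ℝ × ℝ => (p.1, p.2, ν) := by fun_prop
    refine ⟨(hK.comp h4.contMDiff).contMDiffOn, ε, hε, fun σ _ τ _ => ⟨fun h => hx σ _ h,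
      fun h => hy σ _ h, fun h => ?_, fun h => ?_⟩⟩
    · exact congrArg Y ((h2 σ τ ν h).trans (h2 σ 0 ν hε).symm)
    · exact congrArg Y ((h3 σ τ ν h).trans (h3 σ 1 ν h1ε).symm)
  have hhom : ∀ ν, ThinHomotopic n (S 0) (S ν) := by
    intro ν
    have h4 : ContDiff ℝ ∞ fun p : ℝ × ℝ × ℝ => (p.1, p.2.1, p.2.2 * ν) := by fun_prop
    refine ⟨fun p => Y (ψ (p.1, p.2.1, p.2.2 * ν)), (hK.comp h4.contMDiff).contMDiffOn,
      fun σ _ τ _ => ⟨?_, ?_⟩, fun σ _ ν' _ => ⟨?_, ?_, ?_, ?_⟩, fun τ _ ν' _ => ⟨?_, ?_, ?_, ?_⟩,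
      fun p hp => ?_⟩
    · exact congrArg (fun r => K (σ, τ, r)) (zero_mul ν)
    · exact congrArg (fun r => K (σ, τ, r)) (one_mul ν)
    · exact congrArg Y ((h2 _ _ _ hε).trans (h2 _ _ _ hε).symm)
    · exact congrArg Y ((h2 _ _ _ hε).trans (h2 _ _ _ hε).symm)
    · exact congrArg Y ((h3 _ _ _ h1ε).trans (h3 _ _ _ h1ε).symm)
    · exact congrArg Y ((h3 _ _ _ h1ε).trans (h3 _ _ _ h1ε).symm)
    · exact (hx 0 _ hε).trans (hx 0 _ hε).symm
    · exact (hx 0 _ hε).trans (hx 0 _ hε).symm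
    · exact (hy 1 _ h1ε).trans (hy 1 _ h1ε).symm
    · exact (hy 1 _ h1ε).trans (hy 1 _ h1ε).symm
    · have hI : UniqueDiffOn ℝ (Icc (0 : ℝ) 1) := uniqueDiffOn_Icc zero_lt_one
      exact finrank_tangentWithin_surface_lt hY (hψ.comp h4) (fun _ => hs _)
        (hI.prod (hI.prod hI)) hp
  have hex : ∀ ν, ∃ w₀ w : ℝ → H, w₀ 0 = 1 ∧ w 0 = 1 ∧ w₀ 1 = w 1 ∧
      (∀ τ ∈ Icc (0 : ℝ) 1, HasLogDerivWithinAt w₀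
        (modelEquiv φ (pathForm C A B K (1, 0) (τ, 0))) (Icc 0 1) τ) ∧
      ∀ τ ∈ Icc (0 : ℝ) 1, HasLogDerivWithinAt w
        (modelEquiv φ (pathForm C A B K (1, 0) (τ, ν))) (Icc 0 1) τ := by
    intro ν
    obtain ⟨g, hg₀, hg⟩ := hflat x y (S 0) (S ν) (hbig 0) (hbig ν) (hhom ν)
    obtain ⟨w₀, h4, h5, h6⟩ := IsPathSpaceHolonomy.exists_logDeriv C A B φ hK
      (S := S 0) (ν := 0) (fun _ _ _ _ => rfl) hg₀
    obtain ⟨w, h7, h8, h9⟩ := IsPathSpaceHolonomy.exists_logDeriv C A B φ hK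
      (S := S ν) (ν := ν) (fun _ _ _ _ => rfl) hg
    exact ⟨w₀, w, h4, h7, h5.trans h8.symm, h6, h9⟩
  choose w₀ w hw₀0 hw0 hend hw₀ hw using hex
  have hconst : (fun ν => w ν 1) = fun _ => w₀ 0 1 := by
    funext ν
    rw [← hend ν]
    exact logDeriv_endpoint_unique
      ((modelEquiv φ).continuous.comp ((continuous_pathForm C A B hK (1, 0)).comp
        (by fun_prop : Continuous fun τ : ℝ => (τ, (0 : ℝ))))) (hw₀0 ν) (hw₀0 0) (hw₀ ν) (hw₀ 0)
  have hder := hasLogDerivWithinAt_holonomy C A B φ hK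
    (tangentWithin_slice_eq_zero hK fun p => hx 0 p hε)
    (tangentWithin_slice_eq_zero hK fun p => hy 1 p h1ε) hthin
    (fun σ => tangentWithin_line_eq_zero hK fun ν => congrArg Y (h2 σ 0 ν hε))
    (fun σ => tangentWithin_line_eq_zero hK fun ν => congrArg Y (h3 σ 1 ν h1ε)) hw0 hw 0
  rw [hconst] at hder
  exact (modelEquiv φ).map_eq_zero_iff.1
    (hder.unique uniqueDiffWithinAt_univ (hasLogDerivWithinAt_const _ _ _))

theorem exists_localized_ramp : ∃ a : ℝ → ℝ, ContDiff ℝ ∞ a ∧ (∀ τ, |a τ| ≤ 1) ∧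
    (∀ τ, τ ≤ 1 / 4 → a τ = 0) ∧ (∀ τ, 3 / 4 ≤ τ → a τ = 0) ∧ a (1 / 2) = 0 ∧
    deriv a (1 / 2) = 1 := by
  let l : ContDiffBump (1 / 2 : ℝ) := ⟨1 / 8, 1 / 4, by norm_num, by norm_num⟩
  have hz : ∀ τ : ℝ, 1 / 4 ≤ |τ - 1 / 2| → l τ = 0 := fun τ h =>
    l.zero_of_le_dist (by rw [Real.dist_eq]; exact h)
  have hl1 : ∀ᶠ τ in 𝓝 (1 / 2 : ℝ), (τ - 1 / 2) * l τ = τ - 1 / 2 := by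
    filter_upwards [l.eventuallyEq_one] with τ h
    rw [h]; simp
  refine ⟨fun τ => (τ - 1 / 2) * l τ, (contDiff_id.sub contDiff_const).mul l.contDiff,
    fun τ => ?_, fun τ h => ?_, fun τ h => ?_, by norm_num, ?_⟩
  · rcases le_total (1 / 4) |τ - 1 / 2| with h | h
    · simp only
      rw [hz τ h]; simp
    · simp only
      rw [abs_mul, abs_of_nonneg l.nonneg]
      exact mul_le_one₀ (by linarith) l.nonneg l.le_one
  · simp only
    rw [hz τ (by rw [le_abs]; right; linarith), mul_zero]
  · simp only
    rw [hz τ (by rw [le_abs]; left; linarith), mul_zero]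
  · rw [Filter.EventuallyEq.deriv_eq hl1]
    simp

theorem fderiv_apply_eq_of_line {F G : Type*} [NormedAddCommGroup F] [NormedSpace ℝ F]
    [NormedAddCommGroup G] [NormedSpace ℝ G] {f : F → G} (hf : ContDiff ℝ ∞ f) {γ : ℝ → F} {v : F}
    {w : G} {l : ℝ} (hγ : HasDerivAt γ v l) (h : HasDerivAt (fun r => f (γ r)) w l) :
    fderiv ℝ f (γ l) v = w :=
  (hasDerivAt_line hf hγ).unique h

/-- A family of reparametrized variations of the line `ℝ × {ρ}` in the plane. -/
noncomputable def variationFamily (β c₁ c₂ a h : ℝ → ℝ) (ρ δ : ℝ) (p : ℝ × ℝ × ℝ) : ℝ × ℝ :=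
  (β p.1, ρ + δ * (c₁ p.1 * a p.2.1 + c₂ p.1 * Real.sin (p.2.2 * h p.2.1)))

section VariationFamily

variable {β c₁ c₂ a h : ℝ → ℝ} {ρ δ : ℝ}

theorem variationFamily_zero (σ τ : ℝ) :
    variationFamily β c₁ c₂ a h ρ δ (σ, τ, 0) = (β σ, ρ + δ * (c₁ σ * a τ)) := by
  simp [variationFamily]

theorem variationFamily_eq_of_zero {τ τ' : ℝ} (ha : a τ = a τ') (h₀ : h τ = 0) (σ ν : ℝ) :
    variationFamily β c₁ c₂ a h ρ δ (σ, τ, ν) = variationFamily β c₁ c₂ a h ρ δ (σ, τ', 0) := by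
  simp [variationFamily, ha, h₀]

theorem contDiff_variationFamily (hβ : ContDiff ℝ ∞ β) (hc₁ : ContDiff ℝ ∞ c₁)
    (hc₂ : ContDiff ℝ ∞ c₂) (ha : ContDiff ℝ ∞ a) (hh : ContDiff ℝ ∞ h) :
    ContDiff ℝ ∞ (variationFamily β c₁ c₂ a h ρ δ) := by
  unfold variationFamily
  fun_prop

theorem hasDerivAt_of_contDiff {u : ℝ → ℝ} (hu : ContDiff ℝ ∞ u) (r : ℝ) :
    HasDerivAt u (deriv u r) r :=
  (hu.differentiable (by simp) r).hasDerivAt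

theorem fderiv_variationFamily_fst (hβ : ContDiff ℝ ∞ β) (hc₁ : ContDiff ℝ ∞ c₁)
    (hc₂ : ContDiff ℝ ∞ c₂) (ha : ContDiff ℝ ∞ a) (hh : ContDiff ℝ ∞ h) (σ τ : ℝ) :
    fderiv ℝ (variationFamily β c₁ c₂ a h ρ δ) (σ, τ, 0) (1, 0) =
      (deriv β σ, δ * (deriv c₁ σ * a τ)) :=
  fderiv_apply_eq_of_line (contDiff_variationFamily hβ hc₁ hc₂ ha hh) (γ := fun r => (r, τ, 0))
    ((hasDerivAt_id σ).prodMk (hasDerivAt_const σ _)) (by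
      simp only [variationFamily_zero]
      exact (hasDerivAt_of_contDiff hβ σ).prodMk
        ((((hasDerivAt_of_contDiff hc₁ σ).mul_const (a τ)).const_mul δ).const_add ρ))

theorem fderiv_variationFamily_snd (hβ : ContDiff ℝ ∞ β) (hc₁ : ContDiff ℝ ∞ c₁)
    (hc₂ : ContDiff ℝ ∞ c₂) (ha : ContDiff ℝ ∞ a) (hh : ContDiff ℝ ∞ h) (σ τ : ℝ) :
    fderiv ℝ (variationFamily β c₁ c₂ a h ρ δ) (σ, τ, 0) (0, 1, 0) =
      (0, δ * (c₁ σ * deriv a τ)) :=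
  fderiv_apply_eq_of_line (contDiff_variationFamily hβ hc₁ hc₂ ha hh) (γ := fun r => (σ, r, 0))
    ((hasDerivAt_const τ σ).prodMk ((hasDerivAt_id τ).prodMk (hasDerivAt_const τ _))) (by
      simp only [variationFamily_zero]
      exact (hasDerivAt_const τ (β σ)).prodMk
        ((((hasDerivAt_of_contDiff ha τ).const_mul (c₁ σ)).const_mul δ).const_add ρ))

theorem fderiv_variationFamily_trd (hβ : ContDiff ℝ ∞ β) (hc₁ : ContDiff ℝ ∞ c₁)
    (hc₂ : ContDiff ℝ ∞ c₂) (ha : ContDiff ℝ ∞ a) (hh : ContDiff ℝ ∞ h) (σ τ : ℝ) :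
    fderiv ℝ (variationFamily β c₁ c₂ a h ρ δ) (σ, τ, 0) (0, 0, 1) = (0, δ * (c₂ σ * h τ)) :=
  fderiv_apply_eq_of_line (contDiff_variationFamily hβ hc₁ hc₂ ha hh) (γ := fun r => (σ, τ, r))
    ((hasDerivAt_const 0 σ).prodMk ((hasDerivAt_const 0 τ).prodMk (hasDerivAt_id 0))) (by
      have h4 : HasDerivAt (fun r : ℝ => Real.sin (r * h τ)) (h τ) 0 := by
        simpa using ((hasDerivAt_id (0 : ℝ)).mul_const (h τ)).sin
      exact (hasDerivAt_const 0 (β σ)).prodMk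
        ((((h4.const_mul (c₂ σ)).const_add (c₁ σ * a τ)).const_mul δ).const_add ρ))

end VariationFamily

theorem IsRFlat.pathChen_variationFamily_eq_zero (hflat : IsRFlat φ (standardConnection C A B))
    {Y : ℝ × ℝ → M} {s : Set (ℝ × ℝ)} (hY : ContMDiffOn 𝓘(ℝ, ℝ × ℝ) (𝓡 n) ∞ Y s)
    {β c₁ c₂ a : ℝ → ℝ} (hβ : ContDiff ℝ ∞ β) (hc₁ : ContDiff ℝ ∞ c₁) (hc₂ : ContDiff ℝ ∞ c₂)
    (ha : ContDiff ℝ ∞ a) (hal : ∀ τ, τ ≤ 1 / 4 → a τ = 0) (har : ∀ τ, 3 / 4 ≤ τ → a τ = 0)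
    {ρ δ : ℝ} (hmem : ∀ h p, variationFamily β c₁ c₂ a h ρ δ p ∈ s)
    {x y : M} {ε : ℝ} (hε : 0 < ε) (hε' : ε ≤ 1 / 4)
    (hx : ∀ σ r, σ < ε → (β σ, r) ∈ s → Y (β σ, r) = x)
    (hy : ∀ σ r, 1 - ε < σ → (β σ, r) ∈ s → Y (β σ, r) = y) :
    pathChen C A B (fun q => Y (variationFamily β c₁ c₂ a (fun _ => 1) ρ δ q)) (1, 0) (0, 1)
      (1 / 2, 0) = 0 := by
  have h1c : ContDiff ℝ ∞ fun _ : ℝ => (1 : ℝ) := contDiff_const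
  have hψ : ∀ h, ContDiff ℝ ∞ h → ContDiff ℝ ∞ (variationFamily β c₁ c₂ a h ρ δ) := fun h hh =>
    contDiff_variationFamily hβ hc₁ hc₂ ha hh
  have hK := hY.comp_contMDiff (hψ _ h1c).contMDiff (hmem _)
  set P : ℝ → 𝔥 := fun τ =>
    pathForm C A B (fun q => Y (variationFamily β c₁ c₂ a (fun _ => 1) ρ δ q)) (1, 0) (τ, 0)
  set κ : ℝ → 𝔥 := fun τ => pathChen C A B
    (fun q => Y (variationFamily β c₁ c₂ a (fun _ => 1) ρ δ q)) (1, 0) (0, 1) (τ, 0)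
  have hsl : Continuous fun τ : ℝ => (τ, (0 : ℝ)) := by fun_prop
  have hP : Continuous P := (continuous_pathForm C A B hK (1, 0)).comp hsl
  have hκ : Continuous κ := (continuous_pathChen C A B hK (1, 0) (0, 1)).comp hsl
  have hint : ∀ h : ℝ → ℝ, ContDiff ℝ ∞ h → HasCompactSupport h →
      tsupport h ⊆ Ioo (1 / 4) (3 / 4) →
      ∫ τ in (0 : ℝ)..1, h τ • transport (adjointAction 𝔥) P τ (κ τ) = 0 := by
    intro h hh _ hsupp
    have hzero : ∀ τ, τ ∉ Ioo (1 / 4 : ℝ) (3 / 4) → h τ = 0 := fun τ hτ =>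
      image_eq_zero_of_notMem_tsupport fun hτ' => hτ (hsupp hτ')
    rw [← hflat.integral_transport_pathChen_eq_zero hY (hψ h hh) (hmem h) hε
      (fun σ p hσ => hx σ _ hσ (hmem h (σ, p))) (fun σ p hσ => hy σ _ hσ (hmem h (σ, p)))
      (fun σ τ ν hτ => variationFamily_eq_of_zero
        ((hal τ (by linarith)).trans (hal 0 (by norm_num)).symm)
        (hzero τ fun h' => by linarith [h'.1]) σ ν)
      (fun σ τ ν hτ => variationFamily_eq_of_zero
        ((har τ (by linarith)).trans (har 1 (by norm_num)).symm)
        (hzero τ fun h' => by linarith [h'.2]) σ ν)]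
    refine intervalIntegral.integral_congr fun τ _ => ?_
    have e0 : ∀ σ τ, variationFamily β c₁ c₂ a h ρ δ (σ, τ, 0) =
        variationFamily β c₁ c₂ a (fun _ => 1) ρ δ (σ, τ, 0) := fun σ τ => by
      rw [variationFamily_zero, variationFamily_zero]
    have e3 : ∀ σ τ, fderiv ℝ (variationFamily β c₁ c₂ a h ρ δ) (σ, τ, 0) (1, 0) =
        fderiv ℝ (variationFamily β c₁ c₂ a (fun _ => 1) ρ δ) (σ, τ, 0) (1, 0) := fun σ τ =>
      (fderiv_variationFamily_fst hβ hc₁ hc₂ ha hh σ τ).trans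
        (fderiv_variationFamily_fst hβ hc₁ hc₂ ha h1c σ τ).symm
    have e4 : ∀ σ τ, fderiv ℝ (variationFamily β c₁ c₂ a h ρ δ) (σ, τ, 0) (0, 1, 0) =
        fderiv ℝ (variationFamily β c₁ c₂ a (fun _ => 1) ρ δ) (σ, τ, 0) (0, 1, 0) := fun σ τ =>
      (fderiv_variationFamily_snd hβ hc₁ hc₂ ha hh σ τ).trans
        (fderiv_variationFamily_snd hβ hc₁ hc₂ ha h1c σ τ).symm
    have e1 : (fun τ => pathForm C A B (fun q => Y (variationFamily β c₁ c₂ a h ρ δ q)) (1, 0)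
        (τ, 0)) = P := funext fun τ =>
      pathForm_comp_congr C A B hY (hψ h hh) (hmem h) (hψ _ h1c) (hmem _) (fun σ => e0 σ τ)
        (fun σ => e3 σ τ) fun σ => e4 σ τ
    have e2 : pathChen C A B (fun q => Y (variationFamily β c₁ c₂ a h ρ δ q)) (1, 0) (0, 1)
        (τ, 0) = h τ • κ τ :=
      pathChen_comp_smul C A B hY (hψ h hh) (hmem h) (hψ _ h1c) (hmem _) (fun σ => e0 σ τ)
        (fun σ => e3 σ τ) (fun σ => e4 σ τ) fun σ => by
          rw [fderiv_variationFamily_trd hβ hc₁ hc₂ ha hh, fderiv_variationFamily_trd hβ hc₁ hc₂ ha h1c,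
            Prod.smul_mk, smul_eq_mul, smul_eq_mul]
          congr 1 <;> ring
    rw [e1, e2, map_smul]
  have : CompleteSpace 𝔥 := FiniteDimensional.complete ℝ 𝔥
  have h5 := eq_zero_of_integral_smul_eq_zero
    ((continuous_transport_self (adjointAction 𝔥) hP).clm_apply hκ) (by norm_num) (by norm_num)
    hint (1 / 2) ⟨by norm_num, by norm_num⟩
  have h6 := transportInv_transport_apply (adjointAction 𝔥) hP (1 / 2) (κ (1 / 2))
  rw [h5, map_zero] at h6
  exact h6.symm

theorem pathChen_variationFamily {Y : ℝ × ℝ → M} {s : Set (ℝ × ℝ)}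
    (hY : ContMDiffOn 𝓘(ℝ, ℝ × ℝ) (𝓡 n) ∞ Y s)
    (hsu : UniqueDiffOn ℝ s) (hsc : s ⊆ closure (interior s))
    {β c₁ c₂ a : ℝ → ℝ} (hβ : ContDiff ℝ ∞ β) (hc₁ : ContDiff ℝ ∞ c₁) (hc₂ : ContDiff ℝ ∞ c₂)
    (ha : ContDiff ℝ ∞ a) (ha0 : a (1 / 2) = 0) (had : deriv a (1 / 2) = 1)
    {ρ δ : ℝ} (hmem : ∀ h p, variationFamily β c₁ c₂ a h ρ δ p ∈ s)
    {m₁ m₂ : ℝ} (hm : m₁ < m₂) (h₁ : ∀ x, m₁ ≤ x → c₁ x = 0) (h₂ : ∀ x, x ≤ m₂ → c₂ x = 0)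
    {g f : ℝ → 𝔤} {b : ℝ → 𝔥} (hg : ∀ σ, g σ = deriv β σ • oneWithin A Y s (1, 0) (β σ, ρ))
    (hf : ∀ σ, f σ = deriv β σ • fakeWithin C A B Y s (1, 0) (0, 1) (β σ, ρ))
    (hb : ∀ σ, b σ = deriv β σ • twoWithin B Y s (1, 0) (0, 1) (β σ, ρ)) :
    pathChen C A B (fun q => Y (variationFamily β c₁ c₂ a (fun _ => 1) ρ δ q)) (1, 0) (0, 1)
      (1 / 2, 0) = C.action
      (∫ σ in (0 : ℝ)..1, c₂ σ • transport (adjointAction 𝔤) g σ (δ • f σ))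
      (∫ σ in (0 : ℝ)..1, c₁ σ • transport C.action g σ (δ • b σ)) := by
  have h1c : ContDiff ℝ ∞ fun _ : ℝ => (1 : ℝ) := contDiff_const
  have hψ := contDiff_variationFamily (ρ := ρ) (δ := δ) hβ hc₁ hc₂ ha h1c
  have p1 : ∀ σ, variationFamily β c₁ c₂ a (fun _ => 1) ρ δ (σ, 1 / 2, 0) = (β σ, ρ) := fun σ => by
    rw [variationFamily_zero, ha0]; simp
  have p2 : ∀ σ, fderiv ℝ (variationFamily β c₁ c₂ a (fun _ => 1) ρ δ) (σ, 1 / 2, 0) (1, 0) =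
      deriv β σ • ((1 : ℝ), (0 : ℝ)) := fun σ => by
    rw [fderiv_variationFamily_fst hβ hc₁ hc₂ ha h1c, ha0]; simp
  have p3 : ∀ σ, fderiv ℝ (variationFamily β c₁ c₂ a (fun _ => 1) ρ δ) (σ, 1 / 2, 0) (0, 1, 0) =
      (δ * c₁ σ) • ((0 : ℝ), (1 : ℝ)) := fun σ => by
    rw [fderiv_variationFamily_snd hβ hc₁ hc₂ ha h1c, had]; simp
  have p4 : ∀ σ, fderiv ℝ (variationFamily β c₁ c₂ a (fun _ => 1) ρ δ) (σ, 1 / 2, 0) (0, 0, 1) =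
      (δ * c₂ σ) • ((0 : ℝ), (1 : ℝ)) := fun σ => by
    rw [fderiv_variationFamily_trd hβ hc₁ hc₂ ha h1c]; simp
  have hβρ : ∀ σ, (β σ, ρ) ∈ s := fun σ => p1 σ ▸ hmem _ _
  have hcβ := hβ.continuous_deriv (by simp)
  have hpt : Continuous fun σ => (β σ, ρ) := hβ.continuous.prodMk continuous_const
  have hgc : Continuous g := by
    rw [show g = _ from funext hg]
    exact hcβ.smul ((contDiffOn_oneWithin A hY hsu _).continuousOn.comp_continuous hpt hβρ)
  have hfc : Continuous f := by
    rw [show f = _ from funext hf]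
    exact hcβ.smul ((continuousOn_fakeWithin C A B hY hsu hsc _ _).comp_continuous hpt hβρ)
  have hbc : Continuous b := by
    rw [show b = _ from funext hb]
    exact hcβ.smul ((contDiffOn_twoWithin B hY hsu _ _).continuousOn.comp_continuous hpt hβρ)
  refine Eq.trans ?_ (chenTwo_localized C hgc (hfc.const_smul δ) (hbc.const_smul δ)
    (hbc.const_smul δ) hc₁.continuous hc₂.continuous hm h₁ h₂ 0 (fv := fun σ => δ • f σ))
  unfold pathChen
  congr 1 <;> funext σ
  · rw [oneWithin_comp A hY hψ (hmem _), p1, p2, oneWithin_smul, hg]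
  · rw [fakeWithin_comp C A B hY hψ (hmem _), p1, p2, p3, fakeWithin_smul_smul, hf]
    module
  · rw [fakeWithin_comp C A B hY hψ (hmem _), p1, p2, p4, fakeWithin_smul_smul, Pi.smul_apply, hf]
    module
  · rw [twoWithin_comp B hY hψ (hmem _), p1, p2, p3, twoWithin_smul_smul, Pi.smul_apply, hb]
    module
  · rw [twoWithin_comp B hY hψ (hmem _), p1, p2, p4, twoWithin_smul_smul, Pi.smul_apply, hb]
    module

theorem IsRFlat.action_integral_eq_zero (hflat : IsRFlat φ (standardConnection C A B))
    {Y : ℝ × ℝ → M} {s : Set (ℝ × ℝ)} (hY : ContMDiffOn 𝓘(ℝ, ℝ × ℝ) (𝓡 n) ∞ Y s)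
    (hsu : UniqueDiffOn ℝ s) (hsc : s ⊆ closure (interior s)) {β c₁ c₂ : ℝ → ℝ}
    (hβ : ContDiff ℝ ∞ β) (hc₁ : ContDiff ℝ ∞ c₁) (hc₂ : ContDiff ℝ ∞ c₂) {ρ δ : ℝ} (hδ : δ ≠ 0)
    (hmem : ∀ σ u v, |u| ≤ 1 → |v| ≤ 1 → (β σ, ρ + δ * (c₁ σ * u + c₂ σ * v)) ∈ s)
    {x y : M} {ε : ℝ} (hε : 0 < ε) (hε' : ε ≤ 1 / 4)
    (hx : ∀ σ r, σ < ε → (β σ, r) ∈ s → Y (β σ, r) = x)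
    (hy : ∀ σ r, 1 - ε < σ → (β σ, r) ∈ s → Y (β σ, r) = y)
    {m₁ m₂ : ℝ} (hm : m₁ < m₂) (h₁ : ∀ x, m₁ ≤ x → c₁ x = 0) (h₂ : ∀ x, x ≤ m₂ → c₂ x = 0)
    {g f : ℝ → 𝔤} {b : ℝ → 𝔥} (hg : ∀ σ, g σ = deriv β σ • oneWithin A Y s (1, 0) (β σ, ρ))
    (hf : ∀ σ, f σ = deriv β σ • fakeWithin C A B Y s (1, 0) (0, 1) (β σ, ρ))
    (hb : ∀ σ, b σ = deriv β σ • twoWithin B Y s (1, 0) (0, 1) (β σ, ρ)) :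
    C.action (∫ σ in (0 : ℝ)..1, c₂ σ • transport (adjointAction 𝔤) g σ (f σ))
      (∫ σ in (0 : ℝ)..1, c₁ σ • transport C.action g σ (b σ)) = 0 := by
  obtain ⟨a, ha, ha1, hal, har, ha0, had⟩ := exists_localized_ramp
  have hmem' : ∀ h p, variationFamily β c₁ c₂ a h ρ δ p ∈ s := fun h p =>
    hmem _ _ _ (ha1 _) (Real.abs_sin_le_one _)
  have h6 := hflat.pathChen_variationFamily_eq_zero hY hβ hc₁ hc₂ ha hal har hmem' hε hε' hx hy
  rw [pathChen_variationFamily hY hsu hsc hβ hc₁ hc₂ ha ha0 had hmem' hm h₁ h₂ hg hf hb] at h6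
  have e1 : ∀ σ, c₂ σ • transport (adjointAction 𝔤) g σ (δ • f σ) =
      δ • c₂ σ • transport (adjointAction 𝔤) g σ (f σ) := fun σ => by rw [map_smul, smul_comm]
  have e2 : ∀ σ, c₁ σ • transport C.action g σ (δ • b σ) =
      δ • c₁ σ • transport C.action g σ (b σ) := fun σ => by rw [map_smul, smul_comm]
  simp only [e1, e2] at h6
  simp only [map_smul, intervalIntegral.integral_smul, LinearMap.smul_apply] at h6
  simpa [hδ] using h6

end Forward

section ForwardSquare

variable {n m : ℕ} {M : Type*} [TopologicalSpace M] [ChartedSpace (EuclideanSpace ℝ (Fin n)) M]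

theorem tangentWithin_eq_zero_of_eqOn_const {E : Type*} [NormedAddCommGroup E] [NormedSpace ℝ E]
    {K : E → M} {s : Set E} (hK : ContMDiffOn 𝓘(ℝ, E) (𝓡 n) ∞ K s) {γ : ℝ → E} {u : E} {t : Set ℝ}
    {σ : ℝ} (hγ : HasDerivWithinAt γ u t σ) (hs : MapsTo γ t s) (ht : UniqueDiffWithinAt ℝ t σ)
    (hσ : σ ∈ t) {x : M} (hx : ∀ r ∈ t, K (γ r) = x) : tangentWithin n K s (γ σ) u = 0 := by
  have h1 := tangentWithin_comp hK hγ.hasFDerivWithinAt hs ht hσ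
  have h2 : tangentWithin n (fun r => K (γ r)) t σ = 0 :=
    ((hasMFDerivWithinAt_const x t σ).congr_of_eventuallyEq (f₁ := fun r => K (γ r))
      (Filter.eventually_of_mem self_mem_nhdsWithin hx) (hx σ hσ)).mfderivWithin
      (uniqueMDiffWithinAt_iff_uniqueDiffWithinAt.2 ht)
  have h3 := congrArg (fun T : ℝ →L[ℝ] EuclideanSpace ℝ (Fin n) => T 1) (h1.symm.trans h2)
  refine Eq.trans ?_ h3
  exact congrArg (tangentWithin n K s (γ σ)) (one_smul ℝ u).symm

/-- The closed unit square. -/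
def unitSquare : Set (ℝ × ℝ) := Icc 0 1 ×ˢ Icc 0 1

theorem uniqueDiffOn_unitSquare : UniqueDiffOn ℝ unitSquare :=
  (uniqueDiffOn_Icc zero_lt_one).prod (uniqueDiffOn_Icc zero_lt_one)

theorem unitSquare_subset_closure_interior : unitSquare ⊆ closure (interior unitSquare) := by
  rw [unitSquare, interior_prod_eq, closure_prod_eq, interior_Icc, closure_Ioo zero_ne_one]

/-- The point `(r, ρ)`, moved into the unit square. -/
noncomputable def clampSquare (ρ r : ℝ) : ℝ × ℝ :=
  (projIcc 0 1 zero_le_one r, projIcc 0 1 zero_le_one ρ)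

theorem clampSquare_mem (ρ r : ℝ) : clampSquare ρ r ∈ unitSquare :=
  ⟨(projIcc 0 1 zero_le_one r).2, (projIcc 0 1 zero_le_one ρ).2⟩

theorem clampSquare_of_mem {ρ r : ℝ} (hρ : ρ ∈ Icc (0 : ℝ) 1) (hr : r ∈ Icc (0 : ℝ) 1) :
    clampSquare ρ r = (r, ρ) := by
  rw [clampSquare, projIcc_of_mem _ hρ, projIcc_of_mem _ hr]

theorem continuous_comp_clampSquare {V : Type*} [TopologicalSpace V] {F : ℝ × ℝ → V}
    (hF : ContinuousOn F unitSquare) : Continuous (uncurry fun ρ r => F (clampSquare ρ r)) := by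
  refine hF.comp_continuous (f := fun p : ℝ × ℝ => clampSquare p.1 p.2) ?_ fun p =>
    clampSquare_mem _ _
  exact (continuous_subtype_val.comp (continuous_projIcc.comp continuous_snd)).prodMk
    (continuous_subtype_val.comp (continuous_projIcc.comp continuous_fst))

variable [IsManifold (𝓡 n) ∞ M]
  {𝔤 : Type*} [NormedLieRing 𝔤] [NormedLieAlgebra 𝔤] [FiniteDimensional ℝ 𝔤]
  {𝔥 : Type*} [NormedLieRing 𝔥] [NormedLieAlgebra 𝔥] [FiniteDimensional ℝ 𝔥]
  {C : DifferentialCrossedModule 𝔤 𝔥} {A : DiffForm n M 1 𝔤} {B : DiffForm n M 2 𝔥}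
  {H : Type*} [TopologicalSpace H] [T2Space H]
  [ChartedSpace (EuclideanSpace ℝ (Fin m)) H] [Group H] [LieGroup (𝓡 m) ∞ H]
  {φ : 𝔥 ≃ₗ⁅ℝ⁆ GroupLieAlgebra (𝓡 m) H} {s t : M} {X : ℝ → ℝ → M}

theorem tangentWithin_eq_zero_near_ends (hX : ContMDiffOn 𝓘(ℝ, ℝ × ℝ) (𝓡 n) ∞ (uncurry X) unitSquare)
    {ρ ε : ℝ} (hρ : ρ ∈ Icc (0 : ℝ) 1)
    (h : ∀ σ ∈ Icc (0 : ℝ) 1, (σ < ε → X σ ρ = s) ∧ (1 - ε < σ → X σ ρ = t))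
    {σ : ℝ} (hσ : σ ∈ Icc (0 : ℝ) 1) (hσε : σ < ε ∨ 1 - ε < σ) :
    tangentWithin n (uncurry X) unitSquare (σ, ρ) (1, 0) = 0 := by
  have hu : UniqueDiffWithinAt ℝ (Icc (0 : ℝ) 1) σ := uniqueDiffOn_Icc zero_lt_one σ hσ
  have hd : ∀ S : Set ℝ, HasDerivWithinAt (fun r : ℝ => (r, ρ)) ((1 : ℝ), (0 : ℝ)) S σ := fun S =>
    ((hasDerivAt_id σ).prodMk (hasDerivAt_const σ ρ)).hasDerivWithinAt
  rcases hσε with h1 | h1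
  · exact tangentWithin_eq_zero_of_eqOn_const (γ := fun r => (r, ρ)) hX (hd (Icc 0 1 ∩ Iio ε)) (fun r hr => ⟨hr.1, hρ⟩)
      (hu.inter (Iio_mem_nhds h1)) ⟨hσ, h1⟩ (x := s) fun r hr => (h r hr.1).1 hr.2
  · exact tangentWithin_eq_zero_of_eqOn_const (γ := fun r => (r, ρ)) hX (hd (Icc 0 1 ∩ Ioi (1 - ε)))
      (fun r hr => ⟨hr.1, hρ⟩) (hu.inter (Ioi_mem_nhds h1)) ⟨hσ, h1⟩ (x := t)
      fun r hr => (h r hr.1).2 hr.2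

theorem eq_deriv_smul_of_cutoff {V : Type*} [AddCommGroup V] [Module ℝ V] {F : ℝ → V} {ε : ℝ}
    (hF : ∀ σ ∈ Icc (0 : ℝ) 1, σ < ε ∨ 1 - ε < σ → F σ = 0) {β : ℝ → ℝ}
    (hβ : ∀ x, β x ∈ Icc (0 : ℝ) 1)
    (hβ' : ∀ x, β =ᶠ[𝓝 x] id ∨ (x < ε ∧ β x < ε) ∨ (1 - ε < x ∧ 1 - ε < β x)) {σ : ℝ}
    (hσ : σ ∈ Icc (0 : ℝ) 1) : F σ = deriv β σ • F (β σ) := by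
  rcases hβ' σ with h | h | h
  · rw [h.deriv_eq, h.eq_of_nhds, deriv_id, one_smul, id]
  · rw [hF σ hσ (Or.inl h.1), hF _ (hβ σ) (Or.inl h.2), smul_zero]
  · rw [hF σ hσ (Or.inr h.1), hF _ (hβ σ) (Or.inr h.2), smul_zero]

theorem abs_variation_le {c₁ c₂ C₁ C₂ u v r : ℝ} (h₁ : |c₁| ≤ C₁) (h₂ : |c₂| ≤ C₂) (hu : |u| ≤ 1)
    (hv : |v| ≤ 1) (hr : 0 ≤ r) : |r / (C₁ + C₂ + 1) * (c₁ * u + c₂ * v)| ≤ r := by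
  have hC₁ : 0 ≤ C₁ := (abs_nonneg _).trans h₁
  have hC₂ : 0 ≤ C₂ := (abs_nonneg _).trans h₂
  have h3 : |c₁ * u + c₂ * v| ≤ C₁ + C₂ + 1 := by
    have h4 : |c₁ * u| ≤ C₁ * 1 := by rw [abs_mul]; gcongr
    have h5 : |c₂ * v| ≤ C₂ * 1 := by rw [abs_mul]; gcongr
    linarith [abs_add_le (c₁ * u) (c₂ * v)]
  rw [abs_mul, abs_of_nonneg (by positivity)]
  calc r / (C₁ + C₂ + 1) * |c₁ * u + c₂ * v| ≤ r / (C₁ + C₂ + 1) * (C₁ + C₂ + 1) := by gcongr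
    _ = r := by field_simp

theorem IsRFlat.action_eq_zero_of_mem_Ioo (hflat : IsRFlat φ (standardConnection C A B))
    (hX : IsPathCurve n s t X) {ρ : ℝ} (hρ : ρ ∈ Ioo (0 : ℝ) 1) {p q : ℝ} (hp : 0 ≤ p)
    (hpq : p ≤ q) (hq : q ≤ 1) :
    C.action (transport (adjointAction 𝔤)
        (fun r => oneWithin A (uncurry X) unitSquare (1, 0) (clampSquare ρ r)) q
        (fakeWithin C A B (uncurry X) unitSquare (1, 0) (0, 1) (clampSquare ρ q)))
      (transport C.action
        (fun r => oneWithin A (uncurry X) unitSquare (1, 0) (clampSquare ρ r)) p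
        (twoWithin B (uncurry X) unitSquare (1, 0) (0, 1) (clampSquare ρ p))) = 0 := by
  have hXs : ContMDiffOn 𝓘(ℝ, ℝ × ℝ) (𝓡 n) ∞ (uncurry X) unitSquare := hX.1
  have hρ' := Ioo_subset_Icc_self hρ
  obtain ⟨-, ε₀, hε₀, hend⟩ := hX.2 ρ hρ'
  set ε := min (1 / 2) ε₀
  have hε : 0 < ε := by positivity
  have hε2 : ε ≤ 1 / 2 := min_le_left _ _
  have hε3 : ε ≤ ε₀ := min_le_right _ _
  obtain ⟨β, hβs, hβ, hβ0, hβ1, hβ'⟩ := exists_cutoff hε hε2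
  have hT : ∀ σ ∈ Icc (0 : ℝ) 1, σ < ε ∨ 1 - ε < σ →
      tangentWithin n (uncurry X) unitSquare (σ, ρ) (1, 0) = 0 := fun σ hσ h =>
    tangentWithin_eq_zero_near_ends hXs hρ' hend hσ
      (h.imp (fun h => h.trans_le hε3) fun h => by linarith)
  set g : ℝ → 𝔤 := fun r => oneWithin A (uncurry X) unitSquare (1, 0) (clampSquare ρ r)
  set f : ℝ → 𝔤 := fun r =>
    fakeWithin C A B (uncurry X) unitSquare (1, 0) (0, 1) (clampSquare ρ r)
  set b : ℝ → 𝔥 := fun r => twoWithin B (uncurry X) unitSquare (1, 0) (0, 1) (clampSquare ρ r)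
  set g' : ℝ → 𝔤 := fun σ =>
    deriv β σ • oneWithin A (uncurry X) unitSquare (1, 0) (β σ, ρ) with hg'
  set f' : ℝ → 𝔤 := fun σ =>
    deriv β σ • fakeWithin C A B (uncurry X) unitSquare (1, 0) (0, 1) (β σ, ρ) with hf'
  set b' : ℝ → 𝔥 := fun σ =>
    deriv β σ • twoWithin B (uncurry X) unitSquare (1, 0) (0, 1) (β σ, ρ) with hb'
  have hgc : Continuous g := (continuous_comp_clampSquare
    (contDiffOn_oneWithin A hXs uniqueDiffOn_unitSquare _).continuousOn).uncurry_left ρ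
  have hfc : Continuous f := (continuous_comp_clampSquare
    (continuousOn_fakeWithin C A B hXs uniqueDiffOn_unitSquare
      unitSquare_subset_closure_interior _ _)).uncurry_left ρ
  have hbc : Continuous b := (continuous_comp_clampSquare
    (contDiffOn_twoWithin B hXs uniqueDiffOn_unitSquare _ _).continuousOn).uncurry_left ρ
  have eg : ∀ σ ∈ Icc (0 : ℝ) 1, g σ = g' σ := fun σ hσ => by
    simp only [g, clampSquare_of_mem hρ' hσ, hg']
    exact eq_deriv_smul_of_cutoff (F := fun σ => oneWithin A (uncurry X) unitSquare (1, 0) (σ, ρ))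
      (fun σ hσ h => by simp only [oneWithin, hT σ hσ h, map_zero]) hβ hβ' hσ
  have ef : ∀ σ ∈ Icc (0 : ℝ) 1, f σ = f' σ := fun σ hσ => by
    simp only [f, clampSquare_of_mem hρ' hσ, hf']
    exact eq_deriv_smul_of_cutoff
      (F := fun σ => fakeWithin C A B (uncurry X) unitSquare (1, 0) (0, 1) (σ, ρ))
      (fun σ hσ h => by simp [fakeWithin, curvatureWithin, hT σ hσ h]) hβ hβ' hσ
  have eb : ∀ σ ∈ Icc (0 : ℝ) 1, b σ = b' σ := fun σ hσ => by
    simp only [b, clampSquare_of_mem hρ' hσ, hb']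
    exact eq_deriv_smul_of_cutoff
      (F := fun σ => twoWithin B (uncurry X) unitSquare (1, 0) (0, 1) (σ, ρ))
      (fun σ hσ h => by simp [twoWithin, hT σ hσ h]) hβ hβ' hσ
  refine action_eq_zero_of_localized C (f := fun q => transport (adjointAction 𝔤) g q (f q))
    (b := fun r => transport C.action g r (b r))
    ((continuous_transport_self (adjointAction 𝔤) hgc).clm_apply hfc)
    ((continuous_transport_self C.action hgc).clm_apply hbc)
    (fun c₁ c₂ m₁ m₂ hm hc₁ hc₂ hs₁ hs₂ h₁ h₂ => ?_) hp hpq hq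
  obtain ⟨C₁, hC₁⟩ := hs₁.exists_bound_of_continuous hc₁.continuous
  obtain ⟨C₂, hC₂⟩ := hs₂.exists_bound_of_continuous hc₂.continuous
  have hC₁0 : 0 ≤ C₁ := (norm_nonneg _).trans (hC₁ 0)
  have hC₂0 : 0 ≤ C₂ := (norm_nonneg _).trans (hC₂ 0)
  have hr : 0 < min ρ (1 - ρ) := lt_min hρ.1 (by linarith [hρ.2])
  have hmem : ∀ σ u v, |u| ≤ 1 → |v| ≤ 1 →
      (β σ, ρ + min ρ (1 - ρ) / (C₁ + C₂ + 1) * (c₁ σ * u + c₂ σ * v)) ∈ unitSquare := by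
    intro σ u v hu hv
    have h3 := abs_le.1 (abs_variation_le (hC₁ σ) (hC₂ σ) hu hv hr.le)
    refine ⟨hβ σ, ?_, ?_⟩
    · linarith [min_le_left ρ (1 - ρ), h3.1]
    · linarith [min_le_right ρ (1 - ρ), h3.2]
  have hδ : min ρ (1 - ρ) / (C₁ + C₂ + 1) ≠ 0 := by positivity
  have key := hflat.action_integral_eq_zero hXs uniqueDiffOn_unitSquare
    unitSquare_subset_closure_interior hβs hc₁ hc₂ hδ hmem (x := s) (y := t) (ε := ε / 3)
    (by positivity) (by linarith)
    (fun σ r hσ hr => by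
      rw [hβ0 σ hσ.le] at hr ⊢
      obtain ⟨-, η, hη, h⟩ := hX.2 r hr.2
      exact (h 0 hr.1).1 hη)
    (fun σ r hσ hr => by
      rw [hβ1 σ hσ.le] at hr ⊢
      obtain ⟨-, η, hη, h⟩ := hX.2 r hr.2
      exact (h 1 hr.1).2 (by linarith))
    hm h₁ h₂ (g := g') (f := f') (b := b') (fun _ => rfl) (fun _ => rfl) (fun _ => rfl)
  have i1 : ∫ σ in (0 : ℝ)..1, c₂ σ • transport (adjointAction 𝔤) g σ (f σ) =
      ∫ σ in (0 : ℝ)..1, c₂ σ • transport (adjointAction 𝔤) g' σ (f' σ) :=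
    intervalIntegral.integral_congr fun σ hσ => by
      rw [uIcc_of_le zero_le_one] at hσ
      simp only [transport_congr (adjointAction 𝔤) eg hσ, ef σ hσ]
  have i2 : ∫ σ in (0 : ℝ)..1, c₁ σ • transport C.action g σ (b σ) =
      ∫ σ in (0 : ℝ)..1, c₁ σ • transport C.action g' σ (b' σ) :=
    intervalIntegral.integral_congr fun σ hσ => by
      rw [uIcc_of_le zero_le_one] at hσ
      simp only [transport_congr C.action eg hσ, eb σ hσ]
  rw [i1, i2]
  exact key

theorem IsRFlat.action_eq_zero (hflat : IsRFlat φ (standardConnection C A B))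
    (hX : IsPathCurve n s t X) {ρ : ℝ} (hρ : ρ ∈ Icc (0 : ℝ) 1) {p q : ℝ} (hp : 0 ≤ p)
    (hpq : p ≤ q) (hq : q ≤ 1) :
    C.action (transport (adjointAction 𝔤)
        (fun r => oneWithin A (uncurry X) unitSquare (1, 0) (clampSquare ρ r)) q
        (fakeWithin C A B (uncurry X) unitSquare (1, 0) (0, 1) (clampSquare ρ q)))
      (transport C.action
        (fun r => oneWithin A (uncurry X) unitSquare (1, 0) (clampSquare ρ r)) p
        (twoWithin B (uncurry X) unitSquare (1, 0) (0, 1) (clampSquare ρ p))) = 0 := by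
  have hXs : ContMDiffOn 𝓘(ℝ, ℝ × ℝ) (𝓡 n) ∞ (uncurry X) unitSquare := hX.1
  have hg := continuous_comp_clampSquare
    (contDiffOn_oneWithin A hXs uniqueDiffOn_unitSquare (1, 0)).continuousOn
  have hf := continuous_transport_apply (adjointAction 𝔤) hg (continuous_comp_clampSquare
    (continuousOn_fakeWithin C A B hXs uniqueDiffOn_unitSquare
      unitSquare_subset_closure_interior (1, 0) (0, 1)))
  have hb := continuous_transport_apply C.action hg (continuous_comp_clampSquare
    (contDiffOn_twoWithin B hXs uniqueDiffOn_unitSquare (1, 0) (0, 1)).continuousOn)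
  have hc := continuous_action C (hf.uncurry_right q) (hb.uncurry_right p)
  have h1 : EqOn _ (fun _ => (0 : 𝔥)) (Ioo (0 : ℝ) 1) := fun ρ hρ =>
    hflat.action_eq_zero_of_mem_Ioo (C := C) (A := A) (B := B) hX hρ hp hpq hq
  have h2 := h1.closure hc continuous_const
  rw [closure_Ioo zero_ne_one] at h2
  exact h2 hρ

theorem IsRFlat.chenVanishes (hflat : IsRFlat φ (standardConnection C A B)) :
    ChenVanishes C A B := by
  intro s t X hX a ha τ hτ
  have hXs : ContMDiffOn 𝓘(ℝ, ℝ × ℝ) (𝓡 n) ∞ (uncurry X) unitSquare := hX.1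
  have hgc : Continuous fun r => oneWithin A (uncurry X) unitSquare (1, 0) (clampSquare τ r) :=
    (continuous_comp_clampSquare
      (contDiffOn_oneWithin A hXs uniqueDiffOn_unitSquare _).continuousOn).uncurry_left τ
  have hbc : Continuous fun r =>
      twoWithin B (uncurry X) unitSquare (1, 0) (0, 1) (clampSquare τ r) :=
    (continuous_comp_clampSquare
      (contDiffOn_twoWithin B hXs uniqueDiffOn_unitSquare _ _).continuousOn).uncurry_left τ
  set a' : ℝ → ℝ := fun r => a τ (projIcc (0 : ℝ) 1 zero_le_one r) with ha'
  have hac : Continuous a' :=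
    ha.continuousOn.comp_continuous (f := fun r : ℝ => (τ, (projIcc (0 : ℝ) 1 zero_le_one r : ℝ)))
      (continuous_const.prodMk (continuous_subtype_val.comp continuous_projIcc))
      fun r => ⟨hτ, (projIcc 0 1 zero_le_one r).2⟩
  have hab : Continuous fun r =>
      a' r • twoWithin B (uncurry X) unitSquare (1, 0) (0, 1) (clampSquare τ r) := hac.smul hbc
  have haa : ∀ r ∈ Icc (0 : ℝ) 1, a' r = a τ r := fun r hr => by
    simp only [ha', projIcc_of_mem _ hr]
  have hv : ∀ r ∈ Icc (0 : ℝ) 1, velocity n (fun σ => X σ τ) r =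
      tangentWithin n (uncurry X) unitSquare (r, τ) (1, 0) := fun r hr =>
    velocity_eq_tangentWithin (γ := fun σ => (σ, τ)) hXs
      ((hasDerivAt_id r).prodMk (hasDerivAt_const r τ)).hasDerivWithinAt
      (fun σ hσ => ⟨hσ, hτ⟩) (fun σ _ => rfl) hr
  have hT : ∀ r ∈ Icc (0 : ℝ) 1, pathTangent n X τ r =
      tangentWithin n (uncurry X) unitSquare (r, τ) (0, 1) := fun r hr =>
    velocity_eq_tangentWithin (c := X r) (γ := fun σ => (r, σ)) hXs
      ((hasDerivAt_const τ r).prodMk (hasDerivAt_id τ)).hasDerivWithinAt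
      (fun σ hσ => ⟨hr, hσ⟩) (fun σ _ => rfl) hτ
  have haT : ∀ r ∈ Icc (0 : ℝ) 1, a τ r • pathTangent n X τ r =
      tangentWithin n (uncurry X) unitSquare (r, τ) (a' r • ((0 : ℝ), (1 : ℝ))) := fun r hr => by
    refine (congrArg (fun z : EuclideanSpace ℝ (Fin n) => a τ r • z) (hT r hr)).trans ?_
    rw [haa r hr]
    exact (map_smul (tangentWithin n (uncurry X) unitSquare (r, τ)) (a τ r) _).symm
  have e1 : ∀ r p, fakeWithin C A B (uncurry X) unitSquare (1, 0) (r • ((0 : ℝ), (1 : ℝ))) p =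
      r • fakeWithin C A B (uncurry X) unitSquare (1, 0) (0, 1) p := fun r p => by
    have h := fakeWithin_smul_smul C A B (uncurry X) unitSquare (1, 0) (0, 1) p 1 r
    rwa [one_smul, one_mul] at h
  have e2 : ∀ r p, twoWithin B (uncurry X) unitSquare (1, 0) (r • ((0 : ℝ), (1 : ℝ))) p =
      r • twoWithin B (uncurry X) unitSquare (1, 0) (0, 1) p := fun r p => by
    have h := twoWithin_smul_smul B (uncurry X) unitSquare (1, 0) (0, 1) p 1 r
    rwa [one_smul, one_mul] at h
  have hcl : ∀ r ∈ Icc (0 : ℝ) 1, clampSquare τ r = (r, τ) := fun r hr => clampSquare_of_mem hτ hr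
  rw [chenTwoForm_eq_chenTwo C hgc hbc hab
    (fv := fun r => fakeWithin C A B (uncurry X) unitSquare (1, 0) (0, 1) (clampSquare τ r))
    (fw := fun r => a' r •
      fakeWithin C A B (uncurry X) unitSquare (1, 0) (0, 1) (clampSquare τ r))
    (fun r hr => ?_) (fun r hr => ?_) (fun r hr => ?_) (fun r hr => ?_) (fun r hr => ?_)]
  · refine chenTwo_eq_zero C hgc hbc hab (fun p q hp hpq hq => ?_)
      fun p q hp hpq hq => ?_
    · rw [map_smul, map_smul, LinearMap.smul_apply, hflat.action_eq_zero hX hτ hp hpq hq, smul_zero]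
    · rw [map_smul, map_smul, hflat.action_eq_zero hX hτ hp hpq hq, smul_zero]
  · rw [hcl r hr]
    exact oneForm_congr A rfl (hv r hr)
  · rw [hcl r hr]
    exact twoForm_congr B rfl (hv r hr) (hT r hr)
  · rw [hcl r hr, ← e2]
    exact twoForm_congr B rfl (hv r hr) (haT r hr)
  · rw [hcl r hr]
    exact fakeCurvature_congr C A B rfl (hv r hr) (hT r hr)
  · rw [hcl r hr, ← e1]
    exact fakeCurvature_congr C A B rfl (hv r hr) (haT r hr)

end ForwardSquare

theorem mainTheorem7 {n m : ℕ}
    {M : Type*} [TopologicalSpace M] [T2Space M] [SecondCountableTopology M]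
    [ChartedSpace (EuclideanSpace ℝ (Fin n)) M] [IsManifold (𝓡 n) ∞ M]
    {𝔤 : Type*} [NormedLieRing 𝔤] [NormedLieAlgebra 𝔤] [FiniteDimensional ℝ 𝔤]
    {𝔥 : Type*} [NormedLieRing 𝔥] [NormedLieAlgebra 𝔥] [FiniteDimensional ℝ 𝔥]
    (C : DifferentialCrossedModule 𝔤 𝔥)
    {H : Type*} [TopologicalSpace H] [T2Space H] [ChartedSpace (EuclideanSpace ℝ (Fin m)) H]
    [Group H] [LieGroup (𝓡 m) ∞ H]
    (φ : 𝔥 ≃ₗ⁅ℝ⁆ GroupLieAlgebra (𝓡 m) H)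
    (A : DiffForm n M 1 𝔤) (B : DiffForm n M 2 𝔥) :
    IsRFlat φ (standardConnection C A B) ↔
      ∀ (s t : M) (X : ℝ → ℝ → M), IsPathCurve n s t X →
        ∀ a : ℝ → ℝ → ℝ, ContDiffOn ℝ ∞ (uncurry a) (Icc 0 1 ×ˢ Icc 0 1) →
          ∀ τ ∈ Icc (0 : ℝ) 1,
            chenTwoForm C A B (fun σ => X σ τ) (pathTangent n X τ)
              (fun σ => a τ σ • pathTangent n X τ σ) = 0 := by
  exact ⟨fun h => h.chenVanishes, fun h => ChenVanishes.isRFlat φ h⟩
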